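/- Notation. For \(t\in\mathbb N\), \(t\ge 1\), let \(|x|_\infty=\max_j|x_j|\) on \(\mathbb R^t\). For \(\beta>0\) let \(\lfloor\beta\rfloor\) denote the largest integer \(k\ge 0\) with \(k<\beta\). For \(K>0\) let \(C^\beta_t([0,1]^t,K)\) be the set of functions \(f:[0,1]^t\to\mathbb R\) that are \(\lfloor\beta\rfloor\) times continuously differentiable on \([0,1]^t\) (one-sided derivatives at the boundary) with \[ \sum_{|\alpha|\le\lfloor\beta\rfloor}\|\partial^\alpha f\|_\infty+\sum_{|\alpha|=\lfloor\beta\rfloor}\ \sup_{x\ne y\in[0,1]^t}\frac{|\partial^\alpha f(x)-\partial^\alpha f(y)|}{|x-y|_\infty^{\beta-\lfloor\beta\rfloor}}\le K . \] Let \(\sigma_v(y)=(\max\{y_i-v_i,0\})_i\). For \(L\in\mathbb N_0\), \(p=(p_0,\dots,p_{L+1})\) and \(s\in\mathbb N_0\), let \(\mathcal F(L,p,s,\infty)\) be the set of functions \[ x\mapsto W^{(L)}\sigma_{v^{(L)}}W^{(L-1)}\sigma_{v^{(L-1)}}\cdots W^{(1)}\sigma_{v^{(1)}}W^{(0)}x,\qquad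 \mathbb R^{p_0}\to\mathbb R^{p_{L+1}}, \] with \(W^{(i)}\in\mathbb R^{p_{i+1}\times p_i}\), \(v^{(i)}\in\mathbb R^{p_i}\), all of whose entries are bounded by \(1\) in absolute value and at most \(s\) of which, in total, are nonzero. Theorem. Let \(t\ge1\) be an integer, \(\beta,K>0\), \(f\in C^\beta_t([0,1]^t,K)\), and let \(m\ge1\) and \(N\ge\max\{(\beta+1)^t,(K+1)e^t\}\) be integers. Put \(L=8+(m+5)(1+\lceil\log_2\max\{t,\beta\}\rceil)\). Then there are an integer \(s\le 141(t+\beta+1)^{3+t}N(m+6)\) and a network \[ \tilde f\in\mathcal F\big(L,(t,6(t+\lceil\beta\rceil)N,\dots,6(t+\lceil\beta\rceil)N,1),s,\infty\big) \] such that \[ \sup_{x\in[0,1]^t}|\tilde f(x)-f(x)|\le(2K+1)(1+t^2+\beta^2)6^tN2^{-m}+K3^\beta N^{-\beta/t}, \] and such that, if moreover \(\beta\ge1\) and \(K\ge1\), then the same \(\tilde f\) satisfies for every \(F\ge K\) and all \(x,y\in[0,1]^t\) \[ |\tilde f(x)-\tilde f(y)|\le 2\beta F(K+1)e^t\big(24\,t^6\,2^t\,N\,2^{-m}+3t\big)\,|x-y|_\infty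 . \] -/

import Mathlib

noncomputable section

namespace HolderNet

/-- The unit cube `[0,1]^t`. Vectors are `Fin t → ℝ`, whose norm is the maximum norm. -/
def unitCube (t : ℕ) : Set (Fin t → ℝ) := Set.Icc 0 1

/-! ### Hölder balls -/

/-- The largest integer strictly smaller than `β` (for `β > 0`). -/
def strictFloor (β : ℝ) : ℕ := ⌈β⌉₊ - 1

/-- The first order partial derivative `∂_i f` of a function on `P` (one-sided at the boundary). -/
def partialDeriv {t : ℕ} (P : Set (Fin t → ℝ)) (i : Fin t) (f : (Fin t → ℝ) → ℝ) :
    (Fin t → ℝ) → ℝ :=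
  fun x => lineDerivWithin ℝ f P x (Pi.single i 1)

/-- The partial derivative `∂^α f = ∂_1^{α_1} ⋯ ∂_t^{α_t} f` for a multi-index `α`. -/
def multiDeriv {t : ℕ} (P : Set (Fin t → ℝ)) (α : Fin t → ℕ) (f : (Fin t → ℝ) → ℝ) :
    (Fin t → ℝ) → ℝ :=
  (List.finRange t).foldr (fun i g => (partialDeriv P i)^[α i] g) f

/-- The supremum norm over `P`, possibly infinite. -/
def supNorm {t : ℕ} (P : Set (Fin t → ℝ)) (g : (Fin t → ℝ) → ℝ) : ENNReal :=
  ⨆ x ∈ P, ENNReal.ofReal |g x|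

/-- The Hölder seminorm `sup_{x ≠ y} |g x - g y| / |x - y|_∞ ^ b` over `P`, possibly infinite. -/
def holderSeminorm {t : ℕ} (P : Set (Fin t → ℝ)) (b : ℝ) (g : (Fin t → ℝ) → ℝ) : ENNReal :=
  ⨆ x ∈ P, ⨆ y ∈ P, ⨆ _ : x ≠ y, ENNReal.ofReal (|g x - g y| / ‖x - y‖ ^ b)

/-- The `β`-Hölder norm on `P`. The finset `Finset.piAntidiag Finset.univ j` consists of all
multi-indices `α` with `|α| = j`. -/
def holderNorm {t : ℕ} (P : Set (Fin t → ℝ)) (β : ℝ) (f : (Fin t → ℝ) → ℝ) : ENNReal :=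
  (∑ j ∈ Finset.range (strictFloor β + 1),
    ∑ α ∈ Finset.piAntidiag (Finset.univ : Finset (Fin t)) j, supNorm P (multiDeriv P α f)) +
  ∑ α ∈ Finset.piAntidiag (Finset.univ : Finset (Fin t)) (strictFloor β),
    holderSeminorm P (β - strictFloor β) (multiDeriv P α f)

/-- The ball `C^β(P, K)` of `β`-Hölder functions with radius `K`. Only the values of `f` on `P`
matter. -/
def holderBall {t : ℕ} (P : Set (Fin t → ℝ)) (β K : ℝ) : Set ((Fin t → ℝ) → ℝ) :=
  {f | ContDiffOn ℝ (strictFloor β : ℕ) f P ∧ holderNorm P β f ≤ ENNReal.ofReal K}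

/-! ### ReLU networks -/

/-- Parameters of a ReLU network with input dimension `a`, hidden layers of widths `h` (a list of
length `L`) and output dimension `b`, that is, with architecture `(L, (a, h, b))`: a weight matrix
and a shift vector for every hidden layer, and the weight matrix of the output layer. -/
inductive Net : ℕ → List ℕ → ℕ → Type
  | output {a b : ℕ} (W : Matrix (Fin b) (Fin a) ℝ) : Net a [] b
  | hidden {a c b : ℕ} {h : List ℕ} (W : Matrix (Fin c) (Fin a) ℝ) (v : Fin c → ℝ)
      (rest : Net c h b) : Net a (c :: h) b

/-- The function `x ↦ W_L σ_{v_L} W_{L-1} ⋯ W_1 σ_{v_1} W_0 x`, where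
`σ_v(y) = (max (y_i - v_i) 0)_i`. -/
def Net.eval {a b : ℕ} {h : List ℕ} : Net a h b → (Fin a → ℝ) → (Fin b → ℝ)
  | .output W, x => W.mulVec x
  | .hidden W v rest, x => rest.eval (fun i => max (W.mulVec x i - v i) 0)

/-- All entries of the weight matrices and of the shift vectors are bounded by one in absolute
value. -/
def Net.Bounded {a b : ℕ} {h : List ℕ} : Net a h b → Prop
  | .output W => ∀ i j, |W i j| ≤ 1
  | .hidden W v rest => (∀ i j, |W i j| ≤ 1) ∧ (∀ i, |v i| ≤ 1) ∧ rest.Bounded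

/-- The number of nonzero entries of all weight matrices and shift vectors. -/
def Net.active {a b : ℕ} {h : List ℕ} : Net a h b → ℕ
  | .output W => Set.ncard {ij : Fin _ × Fin _ | W ij.1 ij.2 ≠ 0}
  | .hidden W v rest =>
      Set.ncard {ij : Fin _ × Fin _ | W ij.1 ij.2 ≠ 0} + Set.ncard {i | v i ≠ 0} + rest.active

/-- The class `𝓕(L, (a, h, b), s, ∞)`, `L = h.length`, of functions computed by networks of the
given architecture with parameters bounded by one and at most `s` active parameters. -/
def netClass (a : ℕ) (h : List ℕ) (b s : ℕ) : Set ((Fin a → ℝ) → (Fin b → ℝ)) :=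
  {g | ∃ Φ : Net a h b, Φ.Bounded ∧ Φ.active ≤ s ∧ Φ.eval = g}

/-! ### Parameters of the approximating network -/

/-- The number of hidden layers `8 + (m + 5)(1 + ⌈log₂ (t ∨ β)⌉)`. -/
def depth (t : ℕ) (β : ℝ) (m : ℕ) : ℕ := 8 + (m + 5) * (1 + ⌈Real.logb 2 (max (t : ℝ) β)⌉₊)

/-- The width `6 (t + ⌈β⌉) N` of every hidden layer. -/
def width (t : ℕ) (β : ℝ) (N : ℕ) : ℕ := 6 * (t + ⌈β⌉₊) * N

/-- The Lipschitz constant `Lip(N, m)`. -/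
def lipConst (t : ℕ) (β K F : ℝ) (N m : ℕ) : ℝ :=
  2 * β * F * (K + 1) * Real.exp t * (24 * (t : ℝ) ^ 6 * 2 ^ t * N * (2 : ℝ)⁻¹ ^ m + 3 * t)

end HolderNet

end

/-! The approximant is a partition of unity applied to Taylor polynomials. On the grid with mesh
`1/M`, where `(M+1)^t ≤ N`, the products of the hat functions `max (1/M - |x_j - l_j/M|) 0`, scaled
by `M^t`, sum to one on the cube, and at every point at most `2^t` of them are nonzero. Gluing the
Taylor polynomials at the grid points with these weights approximates `f` up to `K M^{-β}`
(`exists_local_polynomial`, `abs_sum_prodHat_mul_sub_le`). Since `N^{1/t} ≤ 3M`, this is the term `K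
3^β N^{-β/t}`.

A ReLU network has to imitate the products. The sawtooth `tent^[n]` gives the dyadic interpolation
`sqApx n` of the square, and polarization gives `mulApx`, which multiplies on `[0,1]` up to
`2^{-n}`. Monomials and products of hats are computed by binary trees of such multiplications. Two
exact properties of `mulApx` are essential. It maps into `[0,1]`, so trees can be nested. It
vanishes when a factor vanishes, so the approximate hat products keep their supports and the errors
of only `2^t` grid points, rather than all `(M+1)^t`, accumulate (`localErr_eq_zero`).

Weights are bounded by one. Hence the polynomial coefficients are divided by an integer `B ≥ K e^t`,
the hats have height `1/M`, and the factors `M^t` and `B` are restored at the end by adding up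
copies of a neuron. Signs are treated by computing positive and negative parts separately. The
accumulated network error is at most `B M^t 2^t` times a local error of order `(1 + t² + β²)
2^{-m}`, and `B ≤ (2K+1) 3^t` gives the factor `6^t`.

For the Lipschitz bound each error estimate has a companion for increments: the error of `sqApx n`
is itself `2^{-n}`-Lipschitz, and this passes through trees and products
(`abs_treeApx_sub_prod_sub_le`, `abs_localErr_sub_le`). The glued approximation is Lipschitz
uniformly in `M` (`abs_sum_prodHat_mul_sub_sum_le`): at small distances the slope `tM` of a weight
meets a factor `|p_l - f|` of order `1/M`, and at large distances the approximation error is already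
dominated by `|x - y|`. The increment estimates need `2^{-m}` small. If it is not small, the
asserted error bound exceeds `K ≥ |f|` and the zero network serves. -/

namespace HolderNet

/-! ### Chains of ReLU layers over arbitrary finite index types -/

/-- The map `x ↦ σ_v (W x)` of a single hidden layer. -/
noncomputable def layer {ι κ : Type} [Fintype ι] (W : Matrix κ ι ℝ) (v : κ → ℝ) (x : ι → ℝ) :
    κ → ℝ :=
  fun i => max (W.mulVec x i - v i) 0

/-- `1` for a nonzero number and `0` for zero. -/
noncomputable def nz (r : ℝ) : ℕ := if r = 0 then 0 else 1

@[simp] lemma nz_zero : nz 0 = 0 := if_pos rfl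

@[simp] lemma nz_one : nz 1 = 1 := if_neg one_ne_zero

lemma nz_le_one (r : ℝ) : nz r ≤ 1 := by unfold nz; split_ifs <;> simp

/-- The number of nonzero entries of a vector. -/
noncomputable def nnzVec {κ : Type} [Fintype κ] (v : κ → ℝ) : ℕ := ∑ i, nz (v i)

/-- The number of nonzero entries of a matrix. -/
noncomputable def nnz {ι κ : Type} [Fintype ι] [Fintype κ] (W : Matrix κ ι ℝ) : ℕ :=
  ∑ i, nnzVec (W i)

/-- `ReluChain w L s f`: the map `f` is a composition of `L` hidden layers of width at most `w`,
with parameters bounded by one and at most `s` nonzero parameters. -/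
inductive ReluChain {κ : Type} [Fintype κ] (w : ℕ) :
    ∀ (_L _s : ℕ) {ι : Type} [Fintype ι], ((ι → ℝ) → (κ → ℝ)) → Prop
  | nil (s : ℕ) : ReluChain w 0 s id
  | cons {ι μ : Type} [Fintype ι] [Fintype μ] {L s s' : ℕ} {g : (μ → ℝ) → (κ → ℝ)}
      (W : Matrix μ ι ℝ) (v : μ → ℝ) (hW : ∀ i j, |W i j| ≤ 1) (hv : ∀ i, |v i| ≤ 1)
      (hw : Fintype.card μ ≤ w) (hs : nnz W + nnzVec v + s ≤ s') (hg : ReluChain w L s g) :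
      ReluChain w (L + 1) s' (fun x => g (layer W v x))

lemma nnzVec_le_card {κ : Type} [Fintype κ] (v : κ → ℝ) : nnzVec v ≤ Fintype.card κ := by
  unfold nnzVec
  calc _ ≤ ∑ _i : κ, 1 := Finset.sum_le_sum fun i _ => nz_le_one _
    _ = _ := by simp

lemma nnz_le_card {ι κ : Type} [Fintype ι] [Fintype κ] (W : Matrix κ ι ℝ) :
    nnz W ≤ Fintype.card κ * Fintype.card ι := by
  unfold nnz
  calc _ ≤ ∑ _i : κ, Fintype.card ι := Finset.sum_le_sum fun i _ => nnzVec_le_card _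
    _ = _ := by simp

@[simp] lemma nnzVec_zero {κ : Type} [Fintype κ] : nnzVec (fun _ : κ => 0) = 0 := by
  simp [nnzVec]

lemma nnzVec_eq_ncard {κ : Type} [Fintype κ] (v : κ → ℝ) : nnzVec v = {i | v i ≠ 0}.ncard := by
  classical
  rw [nnzVec, Set.ncard_eq_toFinset_card', Set.toFinset_ofPred, Finset.card_filter]
  exact Finset.sum_congr rfl fun i _ => by by_cases h : v i = 0 <;> simp [nz, h]

lemma nnz_eq_ncard {ι κ : Type} [Fintype ι] [Fintype κ] (W : Matrix κ ι ℝ) :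
    nnz W = {ij : κ × ι | W ij.1 ij.2 ≠ 0}.ncard := by
  rw [← nnzVec_eq_ncard (fun ij : κ × ι => W ij.1 ij.2)]
  simp only [nnz, nnzVec, Fintype.sum_prod_type]

namespace ReluChain

lemma mono {ι κ : Type} [Fintype ι] [Fintype κ] {w w' L s s' : ℕ} {f : (ι → ℝ) → (κ → ℝ)}
    (h : ReluChain w L s f) (hw : w ≤ w') (hs : s ≤ s') : ReluChain w' L s' f := by
  induction h generalizing s' with
  | nil => exact nil _
  | cons W v hW hv hc hs₀ _ ih => exact cons W v hW hv (hc.trans hw) (hs₀.trans hs) (ih le_rfl)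

lemma comp {ι κ μ : Type} [Fintype ι] [Fintype κ] [Fintype μ] {w L L' s s' : ℕ}
    {f : (ι → ℝ) → (κ → ℝ)} {g : (κ → ℝ) → (μ → ℝ)} (hg : ReluChain w L' s' g)
    (hf : ReluChain w L s f) : ReluChain w (L + L') (s + s') (fun x => g (f x)) := by
  induction hf with
  | nil => simpa using hg.mono le_rfl (Nat.le_add_left _ _)
  | cons W v hW hv hc hs _ ih =>
    rw [Nat.add_right_comm]
    exact cons W v hW hv hc (by omega) ih

lemma single {ι κ : Type} [Fintype ι] [Fintype κ] {w s : ℕ}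
    (W : Matrix κ ι ℝ) (v : κ → ℝ) (hW : ∀ i j, |W i j| ≤ 1) (hv : ∀ i, |v i| ≤ 1)
    (hw : Fintype.card κ ≤ w) (hs : nnz W + nnzVec v ≤ s) : ReluChain w 1 s (layer W v) :=
  cons W v hW hv hw hs (nil 0)

lemma dense {ι κ : Type} [Fintype ι] [Fintype κ] {w s : ℕ}
    (W : Matrix κ ι ℝ) (v : κ → ℝ) (hW : ∀ i j, |W i j| ≤ 1) (hv : ∀ i, |v i| ≤ 1)
    (hw : Fintype.card κ ≤ w) (hs : Fintype.card κ * (Fintype.card ι + 1) ≤ s) :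
    ReluChain w 1 s (layer W v) :=
  single W v hW hv hw ((add_le_add (nnz_le_card W) (nnzVec_le_card v)).trans (by linarith))

/-- Copies of one chain, side by side. -/
lemma copies (A : Type) [Fintype A] {ι κ : Type} [Fintype ι] [Fintype κ] {w L s : ℕ}
    {f : (ι → ℝ) → (κ → ℝ)} (h : ReluChain w L s f) :
    ReluChain (Fintype.card A * w) L (Fintype.card A * s)
      (fun (x : A × ι → ℝ) (p : A × κ) => f (fun i => x (p.1, i)) p.2) := by
  classical
  induction h with
  | nil => exact nil _
  | @cons ι μ _ _ L s s' g W v hW hv hc hs _ ih =>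
    -- The block diagonal matrix. Its zero blocks are not counted, so the cost grows by the factor
    -- `|A|` instead of `|A|²`.
    let W' : Matrix (A × μ) (A × ι) ℝ := Matrix.of fun p r => if p.1 = r.1 then W p.2 r.2 else 0
    have hW' : ∀ p r, W' p r = if p.1 = r.1 then W p.2 r.2 else 0 := fun _ _ => rfl
    have key := cons (s' := Fintype.card A * s') W' (fun p => v p.2)
      (fun p r => by rw [hW']; split_ifs <;> simp [hW]) (fun p => hv p.2)
      (by rw [Fintype.card_prod]; gcongr) (s := Fintype.card A * s) ?_ ih
    · have : ∀ (x : A × ι → ℝ) a,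
          (fun i => layer W' (fun p => v p.2) x (a, i)) = layer W v (fun i => x (a, i)) := by
        intro x a
        funext i
        simp only [layer, Matrix.mulVec, dotProduct, Fintype.sum_prod_type, hW']
        rw [Finset.sum_eq_single a (fun b _ hb => by simp [hb.symm]) (by simp)]
        simp
      simpa only [this] using key
    · have h1 : nnz W' = Fintype.card A * nnz W := by
        simp only [nnz, nnzVec, Fintype.sum_prod_type, hW']
        rw [← smul_eq_mul, ← Finset.card_univ, ← Finset.sum_const]
        refine Finset.sum_congr rfl fun a _ => Finset.sum_congr rfl fun i _ => ?_
        rw [Finset.sum_eq_single a (fun b _ hb => by simp [hb.symm]) (by simp)]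
        simp
      have h2 : nnzVec (fun p : A × μ => v p.2) = Fintype.card A * nnzVec v := by
        simp [nnzVec, Fintype.sum_prod_type]
      rw [h1, h2, ← mul_add, ← mul_add]
      gcongr

/-- Two chains of the same length, side by side. -/
lemma parallel {ι κ ι' κ' : Type} [Fintype ι] [Fintype κ] [Fintype ι'] [Fintype κ']
    {w w' L s s' : ℕ} {f : (ι → ℝ) → (κ → ℝ)} {f' : (ι' → ℝ) → (κ' → ℝ)}
    (h : ReluChain w L s f) (h' : ReluChain w' L s' f') :
    ReluChain (w + w') L (s + s')
      (fun (x : ι ⊕ ι' → ℝ) => Sum.elim (f (fun i => x (Sum.inl i))) (f' (fun i => x (Sum.inr i)))) := by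
  induction h generalizing ι' s' with
  | nil =>
    cases h'
    have : (fun x : κ ⊕ κ' → ℝ =>
        Sum.elim (id fun i => x (Sum.inl i)) (id fun i => x (Sum.inr i))) = id :=
      funext fun x => Sum.elim_comp_inl_inr _
    rw [this]
    exact nil _
  | @cons ι μ _ _ L s s₁ g W v hW hv hc hs _ ih =>
    cases h' with
    | @cons _ μ' _ _ _ s₂ _ g' W' v' hW' hv' hc' hs' hg' =>
    have key := cons (ι := ι ⊕ ι') (μ := μ ⊕ μ') (s' := s₁ + s')
      (Matrix.fromBlocks W 0 0 W') (Sum.elim v v')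
      (by rintro (i | i) (j | j) <;> simp [hW, hW']) (by rintro (i | i) <;> simp [hv, hv'])
      (by rw [Fintype.card_sum]; gcongr) (s := s + s₂) ?_ (ih hg')
    · have e1 : ∀ x : ι ⊕ ι' → ℝ,
          (fun i => layer (Matrix.fromBlocks W 0 0 W') (Sum.elim v v') x (Sum.inl i))
            = layer W v (fun i => x (Sum.inl i)) := fun x => funext fun i => by
        simp [layer, Matrix.mulVec, dotProduct]
      have e2 : ∀ x : ι ⊕ ι' → ℝ,
          (fun i => layer (Matrix.fromBlocks W 0 0 W') (Sum.elim v v') x (Sum.inr i))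
            = layer W' v' (fun i => x (Sum.inr i)) := fun x => funext fun i => by
        simp [layer, Matrix.mulVec, dotProduct]
      simpa only [e1, e2] using key
    · have h1 : nnz (Matrix.fromBlocks W 0 0 W') = nnz W + nnz W' := by
        simp [nnz, nnzVec]
      have h2 : nnzVec (Sum.elim v v') = nnzVec v + nnzVec v' := by
        simp [nnzVec]
      rw [h1, h2]
      omega

end ReluChain

/-- The componentwise positive part, iterated. -/
noncomputable def delay {ι : Type} : ℕ → (ι → ℝ) → (ι → ℝ)
  | 0 => id
  | k + 1 => fun x => delay k (fun i => max (x i) 0)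

lemma delay_eq {ι : Type} (k : ℕ) {x : ι → ℝ} (hx : ∀ i, 0 ≤ x i) : delay k x = x := by
  induction k with
  | zero => rfl
  | succ k ih =>
    have : (fun i => max (x i) 0) = x := funext fun i => max_eq_left (hx i)
    simp [delay, this, ih]

/-- Idle layers bring subnetworks of different depth to a common length. They act as the identity
because only nonnegative values are passed through them. -/
lemma reluChain_delay {ι : Type} [Fintype ι] {w : ℕ} (hw : Fintype.card ι ≤ w) (k : ℕ) :
    ReluChain w k (k * Fintype.card ι) (delay (ι := ι) k) := by
  classical
  induction k with
  | zero => exact .nil _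
  | succ k ih =>
    have key := ReluChain.cons (s' := (k + 1) * Fintype.card ι) (1 : Matrix ι ι ℝ) (fun _ => 0)
      (fun i j => by rw [Matrix.one_apply]; split_ifs <;> simp) (by simp) hw ?_ ih
    · have : ∀ x : ι → ℝ, layer 1 (fun _ => 0) x = fun i => max (x i) 0 :=
        fun x => funext fun i => by simp [layer]
      simp only [this] at key
      exact key
    · have : nnz (1 : Matrix ι ι ℝ) = Fintype.card ι := by
        simp [nnz, nnzVec, Matrix.one_apply, apply_ite nz]
      rw [this, nnzVec_zero]
      linarith

/-! ### From chains to networks -/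

/-- Padding by zeros along the embeddings turns width at most `w` into width exactly `w` and creates
no nonzero entry. Columns outside the range of `e` vanish, so the values of the padding neurons are
irrelevant. -/
lemma exists_extend_matrix {ι κ ι' κ' : Type} [Fintype ι] [Fintype κ] [Fintype ι'] [Fintype κ']
    (e : ι ↪ ι') (e' : κ ↪ κ') (W : Matrix κ ι ℝ) (hW : ∀ i j, |W i j| ≤ 1) :
    ∃ W' : Matrix κ' ι' ℝ, (∀ i j, |W' i j| ≤ 1) ∧ {ij : κ' × ι' | W' ij.1 ij.2 ≠ 0}.ncard ≤ nnz W ∧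
      ∀ x i, W'.mulVec x (e' i) = W.mulVec (fun j => x (e j)) i := by
  classical
  refine ⟨Function.extend e' (fun i => Function.extend e (W i) 0) 0, fun i j => ?_, ?_, fun x i => ?_⟩
  · by_cases hi : ∃ i', e' i' = i
    · obtain ⟨i', rfl⟩ := hi
      rw [e'.injective.extend_apply]
      by_cases hj : ∃ j', e j' = j
      · obtain ⟨j', rfl⟩ := hj
        rw [e.injective.extend_apply]
        exact hW _ _
      · rw [Function.extend_apply' _ _ _ hj]; simp
    · rw [Function.extend_apply' _ _ _ hi]; simp
  · rw [nnz_eq_ncard]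
    refine (Set.ncard_le_ncard (t := (fun p : κ × ι => (e' p.1, e p.2)) ''
      {ij : κ × ι | W ij.1 ij.2 ≠ 0}) ?_ (Set.toFinite _)).trans
      (Set.ncard_image_le (Set.toFinite _))
    rintro ⟨i, j⟩ hij
    simp only [Set.mem_ofPred_eq] at hij
    by_cases hi : ∃ i', e' i' = i
    · obtain ⟨i', rfl⟩ := hi
      rw [e'.injective.extend_apply] at hij
      by_cases hj : ∃ j', e j' = j
      · obtain ⟨j', rfl⟩ := hj
        rw [e.injective.extend_apply] at hij
        exact ⟨(i', j'), hij, rfl⟩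
      · rw [Function.extend_apply' _ _ _ hj] at hij; simp at hij
    · rw [Function.extend_apply' _ _ _ hi] at hij; simp at hij
  · simp only [Matrix.mulVec, dotProduct]
    rw [e'.injective.extend_apply]
    symm
    refine Fintype.sum_of_injective e e.injective _ _ (fun j hj => ?_) fun j => ?_
    · rw [Function.extend_apply' _ _ _ (by simpa using hj)]; simp
    · rw [e.injective.extend_apply]

lemma exists_extend_vec {κ κ' : Type} [Fintype κ] [Fintype κ'] (e : κ ↪ κ') (v : κ → ℝ)
    (hv : ∀ i, |v i| ≤ 1) :
    ∃ v' : κ' → ℝ, (∀ i, |v' i| ≤ 1) ∧ {i | v' i ≠ 0}.ncard ≤ nnzVec v ∧ ∀ i, v' (e i) = v i := by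
  refine ⟨Function.extend e v 0, fun i => ?_, ?_, fun i => e.injective.extend_apply _ _ _⟩
  · by_cases hi : ∃ i', e i' = i
    · obtain ⟨i', rfl⟩ := hi
      rw [e.injective.extend_apply]
      exact hv _
    · rw [Function.extend_apply' _ _ _ hi]; simp
  · rw [nnzVec_eq_ncard]
    refine (Set.ncard_le_ncard (t := e '' {i | v i ≠ 0}) ?_ (Set.toFinite _)).trans
      (Set.ncard_image_le (Set.toFinite _))
    intro i hi
    simp only [Set.mem_ofPred_eq] at hi
    by_cases hi' : ∃ i', e i' = i
    · obtain ⟨i', rfl⟩ := hi'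
      rw [e.injective.extend_apply] at hi
      exact ⟨i', hi, rfl⟩
    · rw [Function.extend_apply' _ _ _ hi'] at hi; simp at hi

lemma ReluChain.exists_net {ι κ : Type} [Fintype ι] [Fintype κ] {w L s b : ℕ}
    {f : (ι → ℝ) → (κ → ℝ)} (h : ReluChain w L s f) (O : Matrix (Fin b) κ ℝ)
    (hO : ∀ i j, |O i j| ≤ 1) (a : ℕ) (e : ι ↪ Fin a) :
    ∃ Φ : Net a (List.replicate L w) b, Φ.Bounded ∧ Φ.active ≤ s + nnz O ∧
      ∀ x, Φ.eval x = O.mulVec (f (fun i => x (e i))) := by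
  induction h generalizing a with
  | nil s =>
    obtain ⟨W', h1, h2, h3⟩ := exists_extend_matrix e (.refl _) O hO
    exact ⟨.output W', h1, h2.trans (Nat.le_add_left _ _), fun x => funext fun i => h3 x i⟩
  | @cons ι μ _ _ L s s' g W v hW hv hc hs _ ih =>
    obtain ⟨e'⟩ : Nonempty (μ ↪ Fin w) := Function.Embedding.nonempty_of_card_le (by simpa using hc)
    obtain ⟨Φ, hΦ, hact, heval⟩ := ih w e'
    obtain ⟨W', h1, h2, h3⟩ := exists_extend_matrix e e' W hW
    obtain ⟨v', h4, h5, h6⟩ := exists_extend_vec e' v hv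
    refine ⟨.hidden W' v' Φ, ⟨h1, h4, hΦ⟩, ?_, fun x => ?_⟩
    · simp only [Net.active]
      omega
    · simp only [Net.eval]
      rw [heval]
      congr 2
      funext i
      simp only [layer, h3, h6]

/-- The zero network is the approximant when the error bound is trivial. -/
lemma exists_zero_net (h : List ℕ) : ∀ a b : ℕ,
    ∃ Φ : Net a h b, Φ.Bounded ∧ Φ.active = 0 ∧ ∀ x, Φ.eval x = 0 := by
  induction h with
  | nil => exact fun a b => ⟨.output 0, by simp [Net.Bounded], by simp [Net.active], by simp [Net.eval]⟩
  | cons c h ih =>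
    intro a b
    obtain ⟨Φ, h1, h2, h3⟩ := ih c b
    exact ⟨.hidden 0 0 Φ, ⟨by simp, by simp, h1⟩, by simp [Net.active, h2], by simp [Net.eval, h3]⟩

/-! ### Approximate squaring and multiplication by sawtooth functions -/

/-- The tent map of the unit interval. -/
noncomputable def tent (u : ℝ) : ℝ := 2 * u - 4 * max (u - 1 / 2) 0

lemma tent_of_le {u : ℝ} (hu : u ≤ 1 / 2) : tent u = 2 * u := by
  rw [tent, max_eq_right (by linarith)]; ring

lemma tent_of_ge {u : ℝ} (hu : 1 / 2 ≤ u) : tent u = 2 - 2 * u := by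
  rw [tent, max_eq_left (by linarith)]; ring

lemma tent_mem {u : ℝ} (hu : u ∈ Set.Icc (0 : ℝ) 1) : tent u ∈ Set.Icc (0 : ℝ) 1 := by
  obtain ⟨h0, h1⟩ := hu
  rcases le_total u (1 / 2) with h | h
  · rw [tent_of_le h]; constructor <;> linarith
  · rw [tent_of_ge h]; constructor <;> linarith

lemma abs_tent_sub_le (u v : ℝ) : |tent u - tent v| ≤ 2 * |u - v| := by
  have key : ∀ a b : ℝ, a ≤ b → |tent a - tent b| ≤ 2 * (b - a) := by
    intro a b hab
    rcases le_total a (1 / 2) with h | h <;> rcases le_total b (1 / 2) with h' | h'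
    · rw [tent_of_le h, tent_of_le h', abs_le]; constructor <;> linarith
    · rw [tent_of_le h, tent_of_ge h', abs_le]; constructor <;> linarith
    · rw [tent_of_ge h, tent_of_le h', abs_le]; constructor <;> linarith
    · rw [tent_of_ge h, tent_of_ge h', abs_le]; constructor <;> linarith
  rcases le_total u v with h | h
  · rw [abs_sub_comm u v, abs_of_nonneg (sub_nonneg.2 h)]; exact key u v h
  · rw [abs_sub_comm (tent u), abs_of_nonneg (sub_nonneg.2 h)]; exact key v u h

lemma tent_iterate_mem (n : ℕ) {u : ℝ} (hu : u ∈ Set.Icc (0 : ℝ) 1) :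
    tent^[n] u ∈ Set.Icc (0 : ℝ) 1 := by
  induction n with
  | zero => simpa using hu
  | succ n ih => rw [Function.iterate_succ_apply']; exact tent_mem ih

lemma abs_tent_iterate_sub_le (n : ℕ) (u v : ℝ) :
    |tent^[n] u - tent^[n] v| ≤ 2 ^ n * |u - v| := by
  induction n with
  | zero => simp
  | succ n ih =>
    rw [Function.iterate_succ_apply', Function.iterate_succ_apply', pow_succ]
    exact (abs_tent_sub_le _ _).trans (by linarith)

lemma tent_iterate_of_le (n : ℕ) {u : ℝ} (hu : u ≤ (2 ^ n : ℝ)⁻¹) :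
    u ∈ Set.Icc (0 : ℝ) 1 → tent^[n] u = 2 ^ n * u := by
  intro h
  induction n with
  | zero => simp
  | succ n ih =>
    have h2 : (0 : ℝ) < 2 ^ n := by positivity
    have h3 : u * 2 ^ (n + 1) ≤ 1 := by
      rwa [← one_div, le_div_iff₀ (by positivity)] at hu
    rw [pow_succ] at h3
    rw [Function.iterate_succ_apply', ih, tent_of_le (by linarith), pow_succ]
    · ring
    · rw [← one_div, le_div_iff₀ h2]
      nlinarith [h.1]

/-- The piecewise linear interpolation of the square function on the dyadic grid of level `n`. -/
noncomputable def sqApx (n : ℕ) (u : ℝ) : ℝ := u ^ 2 + (tent^[n] u - (tent^[n] u) ^ 2) / 4 ^ n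

lemma sqApx_zero_left (u : ℝ) : sqApx 0 u = u := by simp [sqApx]

/-- On both branches of the tent, `w - w² - tent w / 4 = (tent w - tent w ²) / 4`. Refining the
interpolation thus subtracts a multiple of the next sawtooth, an operation that is linear in
quantities available to a network. -/
lemma sqApx_succ (n : ℕ) (u : ℝ) : sqApx (n + 1) u = sqApx n u - tent^[n + 1] u / 4 ^ (n + 1) := by
  rw [sqApx, sqApx, Function.iterate_succ_apply', pow_succ (4 : ℝ)]
  generalize tent^[n] u = w
  have : w - w ^ 2 - tent w / 4 = (tent w - tent w ^ 2) / 4 := by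
    rcases le_total w (1 / 2) with h | h
    · rw [tent_of_le h]; ring
    · rw [tent_of_ge h]; ring
  have h4 : (0 : ℝ) < 4 ^ n := by positivity
  have h5 : (w - w ^ 2) / 4 ^ n - tent w / (4 ^ n * 4) = (tent w - tent w ^ 2) / (4 ^ n * 4) := by
    calc _ = (w - w ^ 2 - tent w / 4) / 4 ^ n := by field_simp
      _ = _ := by rw [this]; field_simp
  linarith

lemma sqApx_sub_sq_mem (n : ℕ) {u : ℝ} (hu : u ∈ Set.Icc (0 : ℝ) 1) :
    sqApx n u - u ^ 2 ∈ Set.Icc (0 : ℝ) (2 ^ n)⁻¹ := by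
  obtain ⟨h0, h1⟩ := tent_iterate_mem n hu
  have h24 : (2 : ℝ) ^ n ≤ 4 ^ n := by gcongr; norm_num
  rw [sqApx, add_sub_cancel_left]
  refine ⟨div_nonneg (by nlinarith) (by positivity), ?_⟩
  rw [← one_div]
  exact div_le_div₀ zero_le_one (by nlinarith) (by positivity) h24

/-- The sawtooth has slope `2^n`, the map `w ↦ w - w²` is 1-Lipschitz on `[0,1]`, and the division
by `4^n` leaves `2^{-n}`. -/
lemma abs_sqApx_sub_sq_sub_le (n : ℕ) {u v : ℝ} (hu : u ∈ Set.Icc (0 : ℝ) 1)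
    (hv : v ∈ Set.Icc (0 : ℝ) 1) :
    |(sqApx n u - u ^ 2) - (sqApx n v - v ^ 2)| ≤ (2 ^ n)⁻¹ * |u - v| := by
  obtain ⟨h0, h1⟩ := tent_iterate_mem n hu
  obtain ⟨h2, h3⟩ := tent_iterate_mem n hv
  have h := abs_tent_iterate_sub_le n u v
  rw [sqApx, sqApx, add_sub_cancel_left, add_sub_cancel_left, ← sub_div, abs_div,
    abs_of_pos (by positivity : (0 : ℝ) < 4 ^ n), div_le_iff₀ (by positivity)]
  have e : (2 ^ n : ℝ)⁻¹ * |u - v| * 4 ^ n = 2 ^ n * |u - v| := by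
    rw [show (4 : ℝ) = 2 * 2 by norm_num, mul_pow]
    field_simp
  rw [e]
  refine le_trans ?_ h
  generalize tent^[n] u = a at *
  generalize tent^[n] v = b at *
  rw [show a - a ^ 2 - (b - b ^ 2) = (a - b) * (1 - a - b) by ring, abs_mul]
  exact mul_le_of_le_one_right (abs_nonneg _) (abs_le.2 ⟨by linarith, by linarith⟩)

/-- If `u + v ≥ 2^{-n}`, the increment `(u + v)(u - v)` of the square dominates the increment of the
error. Otherwise both points lie in the first dyadic interval, where `sqApx n` is the line `x /
2^n`. -/
lemma sqApx_mono (n : ℕ) {u v : ℝ} (hv : 0 ≤ v) (hvu : v ≤ u) (hu : u ≤ 1) :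
    sqApx n v ≤ sqApx n u := by
  have hu' : u ∈ Set.Icc (0 : ℝ) 1 := ⟨hv.trans hvu, hu⟩
  have hv' : v ∈ Set.Icc (0 : ℝ) 1 := ⟨hv, hvu.trans hu⟩
  rcases le_total (2 ^ n : ℝ)⁻¹ (u + v) with h | h
  · have := (abs_le.1 (abs_sqApx_sub_sq_sub_le n hu' hv')).1
    rw [abs_of_nonneg (sub_nonneg.2 hvu)] at this
    nlinarith [mul_le_mul_of_nonneg_right h (sub_nonneg.2 hvu)]
  · rw [sqApx, sqApx, tent_iterate_of_le n (by linarith [hu'.1]) hu',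
      tent_iterate_of_le n (by linarith) hv']
    have e : ∀ x : ℝ, x ^ 2 + (2 ^ n * x - (2 ^ n * x) ^ 2) / 4 ^ n = x / 2 ^ n := by
      intro x
      rw [show (4 : ℝ) ^ n = 2 ^ n * 2 ^ n by rw [← mul_pow]; norm_num]
      field_simp
      ring
    rw [e, e]
    gcongr

lemma sqApx_zero (n : ℕ) : sqApx n 0 = 0 := by
  rw [sqApx, tent_iterate_of_le n (by positivity) (by simp)]
  simp

lemma sqApx_one (n : ℕ) : sqApx n 1 = 1 := by
  induction n with
  | zero => simp [sqApx]
  | succ n ih =>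
    have h1 : tent 1 = 0 := by norm_num [tent]
    have h0 : ∀ k, tent^[k] 0 = 0 := fun k =>
      Function.iterate_fixed (by norm_num [tent]) k
    rw [sqApx_succ, ih, Function.iterate_succ_apply, h1, h0]
    simp

/-- Approximate multiplication on the unit interval. -/
noncomputable def mulApx (n : ℕ) (x y : ℝ) : ℝ := sqApx n ((x + y) / 2) - sqApx n (|x - y| / 2)

section mulApx

variable {n : ℕ} {x y x' y' : ℝ}

lemma half_add_mem (hx : x ∈ Set.Icc (0 : ℝ) 1) (hy : y ∈ Set.Icc (0 : ℝ) 1) :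
    (x + y) / 2 ∈ Set.Icc (0 : ℝ) 1 :=
  ⟨by linarith [hx.1, hy.1], by linarith [hx.2, hy.2]⟩

lemma half_abs_sub_mem (hx : x ∈ Set.Icc (0 : ℝ) 1) (hy : y ∈ Set.Icc (0 : ℝ) 1) :
    |x - y| / 2 ∈ Set.Icc (0 : ℝ) 1 :=
  ⟨by positivity, by
    have : |x - y| ≤ 1 := abs_le.2 ⟨by linarith [hx.1, hy.2], by linarith [hx.2, hy.1]⟩
    linarith⟩

lemma half_abs_sub_le (hx : 0 ≤ x) (hy : 0 ≤ y) : |x - y| / 2 ≤ (x + y) / 2 := by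
  have : |x - y| ≤ x + y := abs_le.2 ⟨by linarith, by linarith⟩
  linarith

/-- Monotonicity of `sqApx` and `|x - y| ≤ x + y` give nonnegativity. The exact range `[0,1]` allows
the output to be fed into further multiplications. -/
lemma mulApx_mem (hx : x ∈ Set.Icc (0 : ℝ) 1) (hy : y ∈ Set.Icc (0 : ℝ) 1) :
    mulApx n x y ∈ Set.Icc (0 : ℝ) 1 := by
  have h1 := half_add_mem hx hy
  have h2 := half_abs_sub_mem hx hy
  refine ⟨sub_nonneg.2 (sqApx_mono n h2.1 (half_abs_sub_le hx.1 hy.1) h1.2), ?_⟩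
  have h3 := sqApx_mono n h1.1 h1.2 le_rfl
  have h4 := sqApx_mono n le_rfl h2.1 h2.2
  rw [sqApx_one] at h3
  rw [sqApx_zero] at h4
  rw [mulApx]
  linarith

/-- The two arguments of `sqApx` coincide, so the cancellation is exact and not merely up to
`2^{-n}`. -/
lemma mulApx_zero_left (hy : 0 ≤ y) : mulApx n 0 y = 0 := by
  simp [mulApx, abs_of_nonneg hy]

lemma mulApx_zero_right (hx : 0 ≤ x) : mulApx n x 0 = 0 := by
  simp [mulApx, abs_of_nonneg hx]

lemma mulApx_sub_mul (n : ℕ) (x y : ℝ) : mulApx n x y - x * y =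
    (sqApx n ((x + y) / 2) - ((x + y) / 2) ^ 2) -
      (sqApx n (|x - y| / 2) - (|x - y| / 2) ^ 2) := by
  rw [mulApx, div_pow |x - y|, sq_abs]
  ring

lemma abs_mulApx_sub_mul_le (hx : x ∈ Set.Icc (0 : ℝ) 1) (hy : y ∈ Set.Icc (0 : ℝ) 1) :
    |mulApx n x y - x * y| ≤ (2 ^ n)⁻¹ := by
  obtain ⟨h1, h2⟩ := sqApx_sub_sq_mem n (half_add_mem hx hy)
  obtain ⟨h3, h4⟩ := sqApx_sub_sq_mem n (half_abs_sub_mem hx hy)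
  rw [mulApx_sub_mul, abs_le]
  constructor <;> linarith

lemma abs_mulApx_sub_mul_sub_le (hx : x ∈ Set.Icc (0 : ℝ) 1) (hy : y ∈ Set.Icc (0 : ℝ) 1)
    (hx' : x' ∈ Set.Icc (0 : ℝ) 1) (hy' : y' ∈ Set.Icc (0 : ℝ) 1) :
    |(mulApx n x y - x * y) - (mulApx n x' y' - x' * y')| ≤
      (2 ^ n)⁻¹ * (|x - x'| + |y - y'|) := by
  have h1 := abs_sqApx_sub_sq_sub_le n (half_add_mem hx hy) (half_add_mem hx' hy')
  have h2 := abs_sqApx_sub_sq_sub_le n (half_abs_sub_mem hx hy) (half_abs_sub_mem hx' hy')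
  have h3 : |(x + y) / 2 - (x' + y') / 2| ≤ (|x - x'| + |y - y'|) / 2 := by
    rw [show (x + y) / 2 - (x' + y') / 2 = ((x - x') + (y - y')) / 2 by ring, abs_div, abs_two]
    gcongr
    exact abs_add_le _ _
  have h4 : |(|x - y| / 2) - |x' - y'| / 2| ≤ (|x - x'| + |y - y'|) / 2 := by
    rw [← sub_div, abs_div, abs_two]
    gcongr
    refine (abs_abs_sub_abs_le _ _).trans ?_
    rw [show x - y - (x' - y') = (x - x') - (y - y') by ring]
    exact abs_sub _ _
  have hp : (0 : ℝ) ≤ (2 ^ n)⁻¹ := by positivity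
  have h5 := mul_le_mul_of_nonneg_left h3 hp
  have h6 := mul_le_mul_of_nonneg_left h4 hp
  rw [mulApx_sub_mul, mulApx_sub_mul]
  generalize (sqApx n ((x + y) / 2) - ((x + y) / 2) ^ 2) = a at *
  generalize (sqApx n ((x' + y') / 2) - ((x' + y') / 2) ^ 2) = a' at *
  generalize (sqApx n (|x - y| / 2) - (|x - y| / 2) ^ 2) = b at *
  generalize (sqApx n (|x' - y'| / 2) - (|x' - y'| / 2) ^ 2) = b' at *
  rw [show a - b - (a' - b') = (a - a') - (b - b') by ring]
  exact (abs_sub _ _).trans (by linarith)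

end mulApx

/-! ### The multiplication network -/

/-- The state of the multiplication network after `j` refinements. -/
noncomputable def mulState (j : ℕ) (u v : ℝ) : Fin 5 → ℝ :=
  ![tent^[j] u / 4 ^ j / 2, max (tent^[j] u / 4 ^ j - (4 ^ j)⁻¹ / 2) 0,
    tent^[j] v / 4 ^ j / 2, max (tent^[j] v / 4 ^ j - (4 ^ j)⁻¹ / 2) 0,
    sqApx j u - sqApx j v]

/-- Dividing the `j`-th iterate by `4^j` turns the factors `2` and `4` of the tent map into the
admissible weights `1/2` and `1`. -/
lemma tent_iterate_succ_div (j : ℕ) (u : ℝ) : tent^[j + 1] u / 4 ^ (j + 1) =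
    tent^[j] u / 4 ^ j / 2 - max (tent^[j] u / 4 ^ j - (4 ^ j)⁻¹ / 2) 0 := by
  rw [Function.iterate_succ_apply', tent]
  generalize tent^[j] u = w
  have : max (w / 4 ^ j - (4 ^ j)⁻¹ / 2) 0 = max (w - 1 / 2) 0 / 4 ^ j := by
    rw [← max_div_div_right (by positivity : (0 : ℝ) ≤ 4 ^ j), zero_div, sub_div]
    congr 2
    field_simp
  rw [this, pow_succ]
  field_simp
  ring

lemma exists_mulState_chain (n : ℕ) : ∀ j : ℕ, ∃ f : (Fin 5 → ℝ) → (Fin 5 → ℝ),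
    ReluChain 5 n (n * 30) f ∧ ∀ u v : ℝ, 0 ≤ v → v ≤ u → u ≤ 1 →
      f (mulState j u v) = mulState (j + n) u v := by
  induction n with
  | zero => exact fun j => ⟨id, .nil _, fun u v _ _ _ => rfl⟩
  | succ n ih =>
    intro j
    obtain ⟨f, hf, hfe⟩ := ih (j + 1)
    have hc : (4 ^ (j + 1) : ℝ)⁻¹ / 2 ∈ Set.Icc (0 : ℝ) 1 := by
      refine ⟨by positivity, ?_⟩
      have : (4 ^ (j + 1) : ℝ)⁻¹ ≤ 1 := inv_le_one_of_one_le₀ (one_le_pow₀ (by norm_num))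
      linarith
    have key := hf.comp (ReluChain.dense (w := 5) (s := 30)
      (!![1/2, -1/2, 0, 0, 0; 1, -1, 0, 0, 0; 0, 0, 1/2, -1/2, 0; 0, 0, 1, -1, 0; -1, 1, 1, -1, 1])
      ![0, (4 ^ (j + 1))⁻¹ / 2, 0, (4 ^ (j + 1))⁻¹ / 2, 0] ?_ ?_ (by simp) (by simp))
    · refine ⟨_, (add_comm 1 n ▸ key).mono le_rfl (by omega), fun u v hv hvu hu => ?_⟩
      rw [show j + (n + 1) = j + 1 + n by ring, ← hfe u v hv hvu hu]
      congr 1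
      have hu' := (tent_iterate_mem (j + 1) ⟨hv.trans hvu, hu⟩).1
      have hv' := (tent_iterate_mem (j + 1) ⟨hv, hvu.trans hu⟩).1
      -- The running difference is nonnegative by monotonicity, so the ReLU leaves the fifth neuron
      -- unchanged.
      have hD := sub_nonneg.2 (sqApx_mono (j + 1) hv hvu hu)
      have eu := tent_iterate_succ_div j u
      have ev := tent_iterate_succ_div j v
      have pu : 0 ≤ tent^[j + 1] u / 4 ^ (j + 1) := by positivity
      have pv : 0 ≤ tent^[j + 1] v / 4 ^ (j + 1) := by positivity
      have su := sqApx_succ j u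
      have sv := sqApx_succ j v
      rw [mulState, mulState]
      generalize tent^[j + 1] u / 4 ^ (j + 1) = U at *
      generalize tent^[j + 1] v / 4 ^ (j + 1) = V at *
      generalize (4 ^ (j + 1) : ℝ)⁻¹ = c at *
      generalize max (tent^[j] u / 4 ^ j - (4 ^ j)⁻¹ / 2) 0 = b at *
      generalize max (tent^[j] v / 4 ^ j - (4 ^ j)⁻¹ / 2) 0 = b' at *
      generalize tent^[j] u / 4 ^ j / 2 = a at *
      generalize tent^[j] v / 4 ^ j / 2 = a' at *
      generalize sqApx (j + 1) u = Su at *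
      generalize sqApx (j + 1) v = Sv at *
      generalize sqApx j u = Su' at *
      generalize sqApx j v = Sv' at *
      subst eu ev su sv
      funext i
      fin_cases i
      all_goals simp [layer, Matrix.mulVec, dotProduct, Fin.sum_univ_succ]
      · rw [max_eq_left (by linarith)]; ring
      · rw [← sub_eq_add_neg]
      · rw [max_eq_left (by linarith)]; ring
      · rw [← sub_eq_add_neg]
      · rw [max_eq_left (by linarith)]; ring
    · intro i k
      fin_cases i <;> fin_cases k <;> norm_num
    · intro i
      fin_cases i <;> simp [abs_of_nonneg, hc.1, hc.2]

/-- A chain that multiplies approximately. -/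
lemma exists_mulApx_chain (n : ℕ) : ∃ f : (Bool × Unit → ℝ) → (Unit → ℝ),
    ReluChain 5 (n + 3) ((n + 3) * 30) f ∧ ∀ z : Bool × Unit → ℝ,
      (∀ p, z p ∈ Set.Icc (0 : ℝ) 1) → f z () = mulApx (n + 1) (z (false, ())) (z (true, ())) := by
  obtain ⟨f, hf, hfe⟩ := exists_mulState_chain n 0
  have h1 := ReluChain.dense (ι := Bool × Unit) (κ := Fin 3) (w := 5) (s := 30)
    (Matrix.of fun i p => if p.1 then ![1/2, -1/2, 1/2] i else ![1/2, 1/2, -1/2] i) (fun _ => 0)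
    (by rintro i ⟨_ | _, _⟩ <;> fin_cases i <;> norm_num [abs_div]) (by simp) (by simp) (by simp)
  have h2 := ReluChain.dense (ι := Fin 3) (κ := Fin 5) (w := 5) (s := 30)
    !![1/2, 0, 0; 1, 0, 0; 0, 1/2, 1/2; 0, 1, 1; 1, -1, -1] ![0, 1/2, 0, 1/2, 0]
    (by intro i j; fin_cases i <;> fin_cases j <;> norm_num)
    (by intro i; fin_cases i <;> norm_num [abs_div]) (by simp) (by simp)
  have h3 := ReluChain.dense (ι := Fin 5) (κ := Unit) (w := 5) (s := 30)
    (Matrix.of fun _ => ![-1, 1, 1, -1, 1]) (fun _ => 0)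
    (by intro i j; fin_cases j <;> norm_num) (by simp) (by simp) (by simp)
  have h := h3.comp (hf.comp (h2.comp h1))
  -- One layer forms the half sum and the two parts of the half difference, one prepares `mulState
  -- 0`, then come `n` refinements. The output layer performs one more refinement, hence `mulApx (n
  -- + 1)`.
  rw [show 1 + 1 + n + 1 = n + 3 by ring, show 30 + 30 + n * 30 + 30 = (n + 3) * 30 by ring] at h
  refine ⟨_, h, fun z hz => ?_⟩
  have hx := hz (false, ())
  have hy := hz (true, ())
  generalize hxe : z (false, ()) = x at *
  generalize hye : z (true, ()) = y at *
  have e1 : layer (Matrix.of fun (i : Fin 3) (p : Bool × Unit) =>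
      if p.1 then ![1/2, -1/2, 1/2] i else ![1/2, 1/2, -1/2] i) (fun _ => 0) z
      = ![(x + y) / 2, max ((x - y) / 2) 0, max ((y - x) / 2) 0] := by
    have h0 : 0 ≤ (x + y) / 2 := (half_add_mem hx hy).1
    funext i
    fin_cases i <;> simp [layer, Matrix.mulVec, dotProduct, Fintype.sum_prod_type, hxe, hye]
    · rw [max_eq_left (by linarith)]; ring
    · congr 1; ring
    · congr 1; ring
  have habs : max ((x - y) / 2) 0 + max ((y - x) / 2) 0 = |x - y| / 2 := by
    rcases le_total x y with hxy | hxy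
    · rw [max_eq_right (by linarith), max_eq_left (by linarith), abs_of_nonpos (by linarith)]; ring
    · rw [max_eq_left (by linarith), max_eq_right (by linarith), abs_of_nonneg (by linarith)]; ring
  have hu := half_add_mem hx hy
  have hv := half_abs_sub_mem hx hy
  have hvu := half_abs_sub_le hx.1 hy.1
  have e2 : layer !![1/2, 0, 0; 1, 0, 0; 0, 1/2, 1/2; 0, 1, 1; 1, -1, -1] ![0, 1/2, 0, 1/2, 0]
      ![(x + y) / 2, max ((x - y) / 2) 0, max ((y - x) / 2) 0]
      = mulState 0 ((x + y) / 2) (|x - y| / 2) := by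
    rw [← habs] at hv hvu ⊢
    generalize max ((x - y) / 2) 0 = a at *
    generalize max ((y - x) / 2) 0 = b at *
    generalize (x + y) / 2 = u at *
    have := hu.1
    have := hv.1
    funext i
    fin_cases i <;>
      simp [layer, Matrix.mulVec, dotProduct, Fin.sum_univ_succ, mulState, sqApx_zero_left]
    · rw [max_eq_left (by linarith)]; ring
    · rw [max_eq_left (by linarith)]; ring
    · rw [max_eq_left (by linarith)]; ring
  rw [e1, e2, hfe _ _ hv.1 hvu hu.2, zero_add]
  have hD := sub_nonneg.2 (sqApx_mono (n + 1) hv.1 hvu hu.2)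
  rw [mulApx]
  generalize (x + y) / 2 = u at *
  generalize |x - y| / 2 = v at *
  rw [sqApx_succ, sqApx_succ, tent_iterate_succ_div, tent_iterate_succ_div] at *
  rw [mulState]
  generalize max (tent^[n] u / 4 ^ n - (4 ^ n)⁻¹ / 2) 0 = b at *
  generalize max (tent^[n] v / 4 ^ n - (4 ^ n)⁻¹ / 2) 0 = b' at *
  generalize tent^[n] u / 4 ^ n / 2 = a at *
  generalize tent^[n] v / 4 ^ n / 2 = a' at *
  simp [layer, Matrix.mulVec, dotProduct, Fin.sum_univ_succ]
  rw [max_eq_left (by linarith)]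
  ring

/-! ### Products of many factors by binary trees -/

/-- The leaves of the complete binary tree of height `d`. -/
def Slot : ℕ → Type
  | 0 => Unit
  | d + 1 => Bool × Slot d

instance Slot.fintype : ∀ d, Fintype (Slot d)
  | 0 => inferInstanceAs (Fintype Unit)
  | d + 1 => letI := Slot.fintype d; inferInstanceAs (Fintype (Bool × Slot d))

lemma card_slot (d : ℕ) : Fintype.card (Slot d) = 2 ^ d := by
  induction d with
  | zero => exact Fintype.card_unit
  | succ d ih => exact (Fintype.card_prod Bool (Slot d)).trans (by rw [ih, pow_succ']; rfl)

/-- The approximate product of the numbers at the leaves. -/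
noncomputable def treeApx (n : ℕ) : ∀ d : ℕ, (Slot d → ℝ) → ℝ
  | 0, z => z ()
  | d + 1, z => mulApx n (treeApx n d fun σ => z (false, σ)) (treeApx n d fun σ => z (true, σ))

lemma prod_slot_succ {d : ℕ} (z : Slot (d + 1) → ℝ) :
    ∏ σ, z σ = (∏ σ : Slot d, z (false, σ)) * ∏ σ : Slot d, z (true, σ) := by
  refine (Fintype.prod_prod_type (f := z)).trans ?_
  rw [Fintype.prod_bool, mul_comm]

lemma sum_slot_succ {d : ℕ} (z : Slot (d + 1) → ℝ) :
    ∑ σ, z σ = (∑ σ : Slot d, z (false, σ)) + ∑ σ : Slot d, z (true, σ) := by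
  refine (Fintype.sum_prod_type (f := z)).trans ?_
  rw [Fintype.sum_bool, add_comm]

lemma treeApx_mem (n d : ℕ) {z : Slot d → ℝ} (hz : ∀ σ, z σ ∈ Set.Icc (0 : ℝ) 1) :
    treeApx n d z ∈ Set.Icc (0 : ℝ) 1 := by
  induction d with
  | zero => exact hz ()
  | succ d ih => exact mulApx_mem (ih fun σ => hz _) (ih fun σ => hz _)

lemma prod_mem_Icc {ι : Type*} {s : Finset ι} {z : ι → ℝ}
    (hz : ∀ σ ∈ s, z σ ∈ Set.Icc (0 : ℝ) 1) : ∏ σ ∈ s, z σ ∈ Set.Icc (0 : ℝ) 1 :=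
  ⟨Finset.prod_nonneg fun σ h => (hz σ h).1,
    Finset.prod_le_one (fun σ h => (hz σ h).1) fun σ h => (hz σ h).2⟩

lemma treeApx_eq_zero (n d : ℕ) {z : Slot d → ℝ} (hz : ∀ σ, z σ ∈ Set.Icc (0 : ℝ) 1)
    (h : ∃ σ, z σ = 0) : treeApx n d z = 0 := by
  induction d with
  | zero => obtain ⟨σ, h⟩ := h; exact h
  | succ d ih =>
    obtain ⟨⟨_ | _, σ⟩, h⟩ := h
    · rw [treeApx, ih (fun _ => hz _) ⟨σ, h⟩]
      exact mulApx_zero_left (treeApx_mem n d fun _ => hz _).1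
    · rw [treeApx, ih (z := fun σ => z (true, σ)) (fun _ => hz _) ⟨σ, h⟩]
      exact mulApx_zero_right (treeApx_mem n d fun _ => hz _).1

/-- Every multiplication contributes `2^{-n}`, and factors in `[0,1]` do not amplify earlier errors.
The tree has `2^d - 1` inner nodes. -/
lemma abs_treeApx_sub_prod_le (n d : ℕ) {z : Slot d → ℝ} (hz : ∀ σ, z σ ∈ Set.Icc (0 : ℝ) 1) :
    |treeApx n d z - ∏ σ, z σ| ≤ (2 ^ d - 1) * (2 ^ n)⁻¹ := by
  induction d with
  | zero =>
    have : ∏ σ : Slot 0, z σ = z () := Fintype.prod_unique (ι := Unit) z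
    simp [this, treeApx]
  | succ d ih =>
    rw [prod_slot_succ, treeApx]
    have h1 := ih (z := fun σ => z (false, σ)) fun _ => hz _
    have h2 := ih (z := fun σ => z (true, σ)) fun _ => hz _
    have m1 := treeApx_mem n d (z := fun σ => z (false, σ)) fun _ => hz _
    have m2 := treeApx_mem n d (z := fun σ => z (true, σ)) fun _ => hz _
    have m3 := prod_mem_Icc (s := Finset.univ) (z := fun σ : Slot d => z (false, σ)) fun _ _ => hz _
    have h3 := abs_mulApx_sub_mul_le (n := n) m1 m2
    generalize treeApx n d (fun σ => z (false, σ)) = a at *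
    generalize treeApx n d (fun σ => z (true, σ)) = b at *
    generalize ∏ σ : Slot d, z (false, σ) = a' at *
    generalize ∏ σ : Slot d, z (true, σ) = b' at *
    have h4 : |(a - a') * b| ≤ (2 ^ d - 1) * (2 ^ n)⁻¹ := by
      rw [abs_mul, abs_of_nonneg m2.1]
      exact (mul_le_of_le_one_right (abs_nonneg _) m2.2).trans h1
    have h5 : |a' * (b - b')| ≤ (2 ^ d - 1) * (2 ^ n)⁻¹ := by
      rw [abs_mul, abs_of_nonneg m3.1]
      exact (mul_le_of_le_one_left (abs_nonneg _) m3.2).trans h2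
    calc |mulApx n a b - a' * b'| = |(mulApx n a b - a * b) + (a - a') * b + a' * (b - b')| := by
          ring_nf
      _ ≤ _ := abs_add_three _ _ _
      _ ≤ (2 ^ n)⁻¹ + (2 ^ d - 1) * (2 ^ n)⁻¹ + (2 ^ d - 1) * (2 ^ n)⁻¹ := by gcongr
      _ = _ := by ring

lemma abs_mul_sub_mul_le {a b a' b' : ℝ} (hb : |b| ≤ 1) (ha' : |a'| ≤ 1) :
    |a * b - a' * b'| ≤ |a - a'| + |b - b'| := by
  rw [show a * b - a' * b' = (a - a') * b + a' * (b - b') by ring]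
  refine (abs_add_le _ _).trans ?_
  rw [abs_mul, abs_mul]
  exact add_le_add (mul_le_of_le_one_right (abs_nonneg _) hb)
    (mul_le_of_le_one_left (abs_nonneg _) ha')

lemma abs_prod_le_one {ι : Type*} {s : Finset ι} {z : ι → ℝ} (hz : ∀ i ∈ s, |z i| ≤ 1) :
    |∏ i ∈ s, z i| ≤ 1 := by
  rw [Finset.abs_prod]
  exact Finset.prod_le_one (fun _ _ => abs_nonneg _) hz

lemma abs_prod_sub_prod_le {ι : Type*} {s : Finset ι} {z z' : ι → ℝ} (hz : ∀ i ∈ s, |z i| ≤ 1)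
    (hz' : ∀ i ∈ s, |z' i| ≤ 1) :
    |∏ i ∈ s, z i - ∏ i ∈ s, z' i| ≤ ∑ i ∈ s, |z i - z' i| := by
  classical
  induction s using Finset.induction_on with
  | empty => simp
  | insert i s hi ih =>
    rw [Finset.prod_insert hi, Finset.prod_insert hi, Finset.sum_insert hi]
    refine (abs_mul_sub_mul_le (abs_prod_le_one fun j hj => hz j (Finset.mem_insert_of_mem hj))
      (hz' i (Finset.mem_insert_self _ _))).trans ?_
    gcongr
    exact ih (fun j hj => hz j (Finset.mem_insert_of_mem hj))
      fun j hj => hz' j (Finset.mem_insert_of_mem hj)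

/-- Induction over the tree, splitting the increment of the error by the product rule. The
hypothesis on `4^d 2^{-n}` makes each subtree 2-Lipschitz in the ℓ¹ distance: one from the exact
product and at most one from its error. -/
lemma abs_treeApx_sub_prod_sub_le (n d : ℕ) (hd : (4 : ℝ) ^ d * (2 ^ n)⁻¹ ≤ 1) {z z' : Slot d → ℝ}
    (hz : ∀ σ, z σ ∈ Set.Icc (0 : ℝ) 1) (hz' : ∀ σ, z' σ ∈ Set.Icc (0 : ℝ) 1) :
    |(treeApx n d z - ∏ σ, z σ) - (treeApx n d z' - ∏ σ, z' σ)| ≤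
      4 ^ d * (2 ^ n)⁻¹ * ∑ σ, |z σ - z' σ| := by
  have hη : (0 : ℝ) < (2 ^ n)⁻¹ := by positivity
  induction d with
  | zero =>
    have : ∀ z : Slot 0 → ℝ, ∏ σ : Slot 0, z σ = z () := Fintype.prod_unique (ι := Unit)
    simp only [this, treeApx, sub_self, abs_zero]
    positivity
  | succ d ih =>
    have hd' : (4 : ℝ) ^ d * (2 ^ n)⁻¹ ≤ 1 := by
      refine le_trans ?_ hd
      gcongr
      · norm_num
      · omega
    have abs01 : ∀ {x : ℝ}, x ∈ Set.Icc (0 : ℝ) 1 → |x| ≤ 1 := fun h =>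
      abs_le.2 ⟨by linarith [h.1], h.2⟩
    have key : ∀ b : Bool, ∃ τ τ' π π' S : ℝ, τ ∈ Set.Icc (0 : ℝ) 1 ∧ τ' ∈ Set.Icc (0 : ℝ) 1 ∧
        π ∈ Set.Icc (0 : ℝ) 1 ∧ π' ∈ Set.Icc (0 : ℝ) 1 ∧
        |τ - π| ≤ (2 ^ d - 1) * (2 ^ n)⁻¹ ∧ |τ' - π'| ≤ (2 ^ d - 1) * (2 ^ n)⁻¹ ∧
        |(τ - π) - (τ' - π')| ≤ 4 ^ d * (2 ^ n)⁻¹ * S ∧ |π - π'| ≤ S ∧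
        τ = treeApx n d (fun σ => z (b, σ)) ∧ τ' = treeApx n d (fun σ => z' (b, σ)) ∧
        π = ∏ σ, z (b, σ) ∧ π' = ∏ σ, z' (b, σ) ∧ S = ∑ σ : Slot d, |z (b, σ) - z' (b, σ)| :=
      fun b => ⟨_, _, _, _, _, treeApx_mem n d fun _ => hz _, treeApx_mem n d fun _ => hz' _,
        prod_mem_Icc fun _ _ => hz _, prod_mem_Icc fun _ _ => hz' _,
        abs_treeApx_sub_prod_le n d fun _ => hz _, abs_treeApx_sub_prod_le n d fun _ => hz' _,
        ih hd' (fun _ => hz _) (fun _ => hz' _),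
        abs_prod_sub_prod_le (fun _ _ => abs01 (hz _)) (fun _ _ => abs01 (hz' _)),
        rfl, rfl, rfl, rfl, rfl⟩
    obtain ⟨a, a', p, p', S, ma, ma', mp, mp', ea, ea', da, dp, h1, h2, h3, h4, h5⟩ := key false
    obtain ⟨b, b', r, r', R, mb, mb', mr, mr', eb, eb', db, dr, k1, k2, k3, k4, k5⟩ := key true
    rw [prod_slot_succ z, prod_slot_succ z', sum_slot_succ, treeApx, treeApx,
      ← h1, ← h2, ← h3, ← h4, ← h5, ← k1, ← k2, ← k3, ← k4, ← k5]
    clear h1 h2 h3 h4 h5 k1 k2 k3 k4 k5 ih key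
    have hS : 0 ≤ S := (abs_nonneg _).trans dp
    have hR : 0 ≤ R := (abs_nonneg _).trans dr
    have h2d : (1 : ℝ) ≤ 2 ^ d := one_le_pow₀ (by norm_num)
    have h4d : (4 : ℝ) ^ d = 2 ^ d * 2 ^ d := by rw [← mul_pow]; norm_num
    have dτ : |a - a'| ≤ 2 * S := by
      calc |a - a'| = |((a - p) - (a' - p')) + (p - p')| := by ring_nf
        _ ≤ _ := abs_add_le _ _
        _ ≤ 1 * S + S := by gcongr; exact da.trans (by gcongr)
        _ = 2 * S := by ring
    have dτ' : |b - b'| ≤ 2 * R := by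
      calc |b - b'| = |((b - r) - (b' - r')) + (r - r')| := by ring_nf
        _ ≤ _ := abs_add_le _ _
        _ ≤ 1 * R + R := by gcongr; exact db.trans (by gcongr)
        _ = 2 * R := by ring
    have hm := abs_mulApx_sub_mul_sub_le (n := n) ma mb ma' mb'
    set η : ℝ := (2 ^ n)⁻¹
    set e : ℝ := (2 ^ d - 1) * η with he
    have he0 : 0 ≤ e := (abs_nonneg _).trans ea
    have t1 : |((a - p) - (a' - p')) * b| ≤ 4 ^ d * η * S := by
      rw [abs_mul]; exact (mul_le_of_le_one_right (abs_nonneg _) (abs01 mb)).trans da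
    have t2 : |(a' - p') * (b - b')| ≤ e * (2 * R) := by
      rw [abs_mul]; gcongr
    have t3 : |(p - p') * (b - r)| ≤ S * e := by
      rw [abs_mul]; gcongr
    have t4 : |p' * ((b - r) - (b' - r'))| ≤ 4 ^ d * η * R := by
      rw [abs_mul]; exact (mul_le_of_le_one_left (abs_nonneg _) (abs01 mp')).trans db
    calc |mulApx n a b - p * r - (mulApx n a' b' - p' * r')|
        = |((mulApx n a b - a * b) - (mulApx n a' b' - a' * b')) + (((a - p) - (a' - p')) * b +
            (a' - p') * (b - b')) + ((p - p') * (b - r) + p' * ((b - r) - (b' - r')))| := by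
          ring_nf
      _ ≤ η * (2 * S + 2 * R) + (4 ^ d * η * S + e * (2 * R)) + (S * e + 4 ^ d * η * R) := by
          refine (abs_add_three _ _ _).trans (add_le_add (add_le_add (hm.trans ?_) ?_) ?_)
          · gcongr
          · exact (abs_add_le _ _).trans (add_le_add t1 t2)
          · exact (abs_add_le _ _).trans (add_le_add t3 t4)
      -- Enlarging `S * e` to `2 * S * e` gives `S` and `R` the same coefficient, and `4^d + 2 · 2^d
      -- ≤ 4^(d+1)` closes the recursion.
      _ ≤ η * (2 * S + 2 * R) + (4 ^ d * η * S + e * (2 * R)) + (2 * S * e + 4 ^ d * η * R) := by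
          gcongr; linarith
      _ = (4 ^ d + 2 * 2 ^ d) * (η * (S + R)) := by rw [he]; ring
      _ ≤ (4 ^ (d + 1)) * (η * (S + R)) := by
          gcongr
          rw [pow_succ, h4d]
          nlinarith
      _ = _ := by ring

lemma exists_treeApx_chain (n d : ℕ) : ∃ f : (Slot d → ℝ) → (Unit → ℝ),
    ReluChain (5 * 2 ^ d / 2) (d * (n + 3)) ((2 ^ d - 1) * ((n + 3) * 30)) f ∧ ∀ z : Slot d → ℝ,
      (∀ σ, z σ ∈ Set.Icc (0 : ℝ) 1) → f z () = treeApx (n + 1) d z := by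
  induction d with
  | zero =>
    refine ⟨id, ?_, fun z _ => rfl⟩
    rw [zero_mul]
    exact ReluChain.nil (κ := Unit) _
  | succ d ih =>
    obtain ⟨f, hf, hfe⟩ := ih
    obtain ⟨g, hg, hge⟩ := exists_mulApx_chain n
    have h2 : 1 ≤ 2 ^ d := Nat.one_le_two_pow
    have hw : 2 * (5 * 2 ^ d / 2) ≤ 5 * 2 ^ (d + 1) / 2 := by rw [pow_succ]; omega
    have h := ReluChain.comp (hg.mono (w' := 5 * 2 ^ (d + 1) / 2) (by rw [pow_succ]; omega) le_rfl)
      ((hf.copies Bool).mono hw le_rfl)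
    -- Stated over `Bool × Slot d`, to which `Slot (d + 1)` unfolds, so that the product structure
    -- is visible.
    have key : ∃ f : (Bool × Slot d → ℝ) → (Unit → ℝ),
        ReluChain (5 * 2 ^ (d + 1) / 2) ((d + 1) * (n + 3)) ((2 ^ (d + 1) - 1) * ((n + 3) * 30)) f ∧
        ∀ z : Bool × Slot d → ℝ, (∀ σ, z σ ∈ Set.Icc (0 : ℝ) 1) →
          f z () = mulApx (n + 1) (treeApx (n + 1) d fun σ => z (false, σ))
            (treeApx (n + 1) d fun σ => z (true, σ)) := by
      refine ⟨fun z => g fun p : Bool × Unit => f (fun i => z (p.1, i)) p.2, ?_, fun z hz => ?_⟩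
      · rw [add_one_mul d]
        refine h.mono le_rfl ?_
        rw [Fintype.card_bool, pow_succ, show 2 ^ d * 2 - 1 = 2 * (2 ^ d - 1) + 1 by omega]
        linarith
      · beta_reduce
        rw [hge, hfe _ fun _ => hz _, hfe _ fun _ => hz _]
        rintro ⟨b, _⟩
        rw [hfe _ fun _ => hz _]
        exact treeApx_mem _ _ fun _ => hz _
    exact key

/-! ### Taylor expansion along the coordinates -/

/-- Induction on the order: the hypothesis for the derivative bounds the derivative of the
remainder, and the mean value inequality integrates it. The top coefficient `A` need only be
`ω`-close to the `n`-th derivative on the segment, which is the form a Hölder condition supplies. -/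
lemma taylor_line {ω A : ℝ} (n : ℕ) : ∀ (φ : ℕ → ℝ → ℝ)
    (_ : ∀ k < n, ∀ s ∈ Set.Icc (0 : ℝ) 1,
      HasDerivWithinAt (φ k) (φ (k + 1) s) (Set.Icc 0 1) s) {a x : ℝ}
    (_ : a ∈ Set.Icc (0 : ℝ) 1) (_ : x ∈ Set.Icc (0 : ℝ) 1)
    (_ : ∀ s ∈ Set.uIcc a x, |φ n s - A| ≤ ω),
    |φ 0 x - (∑ k ∈ Finset.range n, φ k a * ((x - a) ^ k / k.factorial) +
      A * ((x - a) ^ n / n.factorial))| ≤ ω * |x - a| ^ n := by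
  induction n with
  | zero => exact fun φ _ a x _ _ h => by simpa using h x Set.right_mem_uIcc
  | succ n ih =>
    intro φ hφ a x ha hx h
    have hsub : Set.uIcc a x ⊆ Set.Icc 0 1 := Set.uIcc_subset_Icc ha hx
    have key : ∀ s ∈ Set.uIcc a x, |φ 1 s - (∑ k ∈ Finset.range n, φ (k + 1) a *
        ((s - a) ^ k / k.factorial) + A * ((s - a) ^ n / n.factorial))| ≤ ω * |x - a| ^ n := by
      intro s hs
      have hω : 0 ≤ ω := (abs_nonneg _).trans (h a Set.left_mem_uIcc)
      refine (ih (fun k => φ (k + 1)) (fun k hk => hφ (k + 1) (by omega)) ha (hsub hs)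
        fun r hr => h r (Set.uIcc_subset_uIcc_left hs hr)).trans ?_
      have : |s - a| ≤ |x - a| := Set.abs_sub_left_of_mem_uIcc hs
      gcongr
    have hder : ∀ s ∈ Set.uIcc a x, HasDerivWithinAt
        (fun s => φ 0 s - (∑ k ∈ Finset.range (n + 1), φ k a * ((s - a) ^ k / k.factorial) +
          A * ((s - a) ^ (n + 1) / (n + 1).factorial)))
        (φ 1 s - (∑ k ∈ Finset.range n, φ (k + 1) a * ((s - a) ^ k / k.factorial) +
          A * ((s - a) ^ n / n.factorial))) (Set.uIcc a x) s := by
      intro s hs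
      have hp : ∀ (c : ℝ) (k : ℕ), HasDerivWithinAt
          (fun s => c * ((s - a) ^ (k + 1) / (k + 1).factorial))
          (c * ((s - a) ^ k / k.factorial)) (Set.uIcc a x) s := by
        intro c k
        have h1 := ((((hasDerivAt_id s).sub_const a).pow (k + 1)).div_const
          ((k + 1).factorial : ℝ)).const_mul c
        refine (h1.congr_deriv ?_).hasDerivWithinAt
        rw [Nat.factorial_succ]
        push_cast
        field_simp
        simp
      refine ((hφ 0 (Nat.succ_pos n) s (hsub hs)).mono hsub).sub (HasDerivWithinAt.add ?_ (hp A n))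
      simp only [Finset.sum_range_succ' _ n, pow_zero, Nat.factorial_zero]
      exact (HasDerivWithinAt.fun_sum fun k _ => hp (φ (k + 1) a) k).add_const _
    have := Convex.norm_image_sub_le_of_norm_hasDerivWithin_le hder key (convex_uIcc a x)
      Set.left_mem_uIcc Set.right_mem_uIcc
    rw [Real.norm_eq_abs, Real.norm_eq_abs, Finset.sum_range_succ' _ n] at this
    rw [Finset.sum_range_succ' _ n, pow_succ |x - a|, ← mul_assoc]
    simpa [Finset.sum_range_succ' _ n] using this

/-! ### Coordinate derivatives and Taylor expansion on the cube -/

variable {t : ℕ}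

lemma update_mem_unitCube {y : Fin t → ℝ} (hy : y ∈ unitCube t) (i : Fin t) {s : ℝ}
    (hs : s ∈ Set.Icc (0 : ℝ) 1) : Function.update y i s ∈ unitCube t := by
  constructor <;> intro j <;> by_cases h : j = i
  · subst h; simpa using hs.1
  · simpa [h] using hy.1 j
  · subst h; simpa using hs.2
  · simpa [h] using hy.2 j

lemma uniqueDiffOn_unitCube (t : ℕ) : UniqueDiffOn ℝ (unitCube t) := by
  rw [unitCube, ← Set.pi_univ_Icc]
  exact UniqueDiffOn.pi fun i _ => uniqueDiffOn_Icc zero_lt_one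

/-- The admissible steps in direction `i` contain the nondegenerate interval `[-y_i, 1 - y_i]`. The
line derivative is therefore unique, also on the boundary. -/
lemma partialDeriv_eq_fderivWithin {g : (Fin t → ℝ) → ℝ} {y : Fin t → ℝ} (hy : y ∈ unitCube t)
    (hg : DifferentiableWithinAt ℝ g (unitCube t) y) (i : Fin t) :
    partialDeriv (unitCube t) i g y = fderivWithin ℝ g (unitCube t) y (Pi.single i 1) := by
  refine (hg.hasFDerivWithinAt.hasLineDerivWithinAt (Pi.single i 1)).derivWithin ?_
  have h1 := Set.mem_Icc.2 ⟨hy.1 i, hy.2 i⟩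
  refine (uniqueDiffOn_Icc (by linarith : -y i < 1 - y i) 0 ?_).mono ?_
  · simpa using h1
  · intro r hr
    have : y + r • Pi.single i 1 = Function.update y i (y i + r) := by
      ext j
      by_cases h : j = i
      · subst h; simp
      · simp [h]
    rw [Set.mem_preimage, this]
    exact update_mem_unitCube hy i ⟨by linarith [hr.1], by linarith [hr.2]⟩

lemma contDiffOn_partialDeriv {g : (Fin t → ℝ) → ℝ} {n : ℕ}
    (hg : ContDiffOn ℝ (n + 1 : ℕ) g (unitCube t)) (i : Fin t) :
    ContDiffOn ℝ n (partialDeriv (unitCube t) i g) (unitCube t) := by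
  refine ContDiffOn.congr ((hg.fderivWithin (uniqueDiffOn_unitCube t) (m := n) (by simp)).clm_apply
    contDiffOn_const) fun y hy => partialDeriv_eq_fderivWithin hy ?_ i
  exact hg.differentiableOn (by simp) y hy

lemma contDiffOn_partialDeriv_iterate {n k : ℕ} : ∀ {g : (Fin t → ℝ) → ℝ}
    (_ : ContDiffOn ℝ (n + k : ℕ) g (unitCube t)) (i : Fin t),
    ContDiffOn ℝ n ((partialDeriv (unitCube t) i)^[k] g) (unitCube t) := by
  induction k with
  | zero => exact fun hg i => hg
  | succ k ih => exact fun hg i => ih (contDiffOn_partialDeriv hg i) i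

lemma hasDerivWithinAt_partialDeriv {g : (Fin t → ℝ) → ℝ}
    (hg : DifferentiableOn ℝ g (unitCube t)) {y : Fin t → ℝ} (hy : y ∈ unitCube t) (i : Fin t)
    {s : ℝ} (hs : s ∈ Set.Icc (0 : ℝ) 1) :
    HasDerivWithinAt (fun s => g (Function.update y i s))
      (partialDeriv (unitCube t) i g (Function.update y i s)) (Set.Icc 0 1) s := by
  have hm := update_mem_unitCube hy i hs
  rw [partialDeriv_eq_fderivWithin hm (hg _ hm)]
  exact (hg _ hm).hasFDerivWithinAt.comp_hasDerivWithinAt s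
    (hasDerivAt_update y i s).hasDerivWithinAt fun r hr => update_mem_unitCube hy i hr

/-- The derivative `∂^α` with respect to the coordinates in a list. -/
noncomputable def listDeriv (l : List (Fin t)) (α : Fin t → ℕ) (g : (Fin t → ℝ) → ℝ) :
    (Fin t → ℝ) → ℝ :=
  l.foldr (fun i g => (partialDeriv (unitCube t) i)^[α i] g) g

lemma listDeriv_congr {l : List (Fin t)} {α α' : Fin t → ℕ} (h : ∀ i ∈ l, α i = α' i)
    (g : (Fin t → ℝ) → ℝ) : listDeriv l α g = listDeriv l α' g := by
  induction l with
  | nil => rfl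
  | cons i l ih =>
    have := ih fun j hj => h j (List.mem_cons_of_mem _ hj)
    simp only [listDeriv, List.foldr_cons] at this ⊢
    rw [this, h i List.mem_cons_self]

lemma contDiffOn_listDeriv {g : (Fin t → ℝ) → ℝ} (l : List (Fin t)) (α : Fin t → ℕ) :
    ∀ {n : ℕ}, ContDiffOn ℝ (n + (l.map α).sum : ℕ) g (unitCube t) →
      ContDiffOn ℝ n (listDeriv l α g) (unitCube t) := by
  induction l with
  | nil => exact fun h => h
  | cons i l ih =>
    intro n h
    refine contDiffOn_partialDeriv_iterate (ih ?_) i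
    rwa [List.map_cons, List.sum_cons, ← add_assoc] at h

/-- The multi-index `α + k e_i`. -/
def bump (α : Fin t → ℕ) (i : Fin t) (k : ℕ) : Fin t → ℕ := α + Pi.single i k

@[simp] lemma bump_self (α : Fin t → ℕ) (i : Fin t) (k : ℕ) : bump α i k i = α i + k := by
  simp [bump]

@[simp] lemma bump_of_ne (α : Fin t → ℕ) {i j : Fin t} (h : j ≠ i) (k : ℕ) :
    bump α i k j = α j := by
  simp [bump, h]

@[simp] lemma bump_zero (α : Fin t → ℕ) (i : Fin t) : bump α i 0 = α := by simp [bump]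

lemma sum_piAntidiag_insert {s : Finset (Fin t)} {i : Fin t} (hi : i ∉ s) (n : ℕ)
    (F : (Fin t → ℕ) → ℝ) :
    ∑ α ∈ Finset.piAntidiag (insert i s) n, F α =
      ∑ j ∈ Finset.range (n + 1), ∑ α ∈ Finset.piAntidiag s j, F (bump α i (n - j)) := by
  have he : ∀ k : ℕ, (fun j => if j = i then k else 0) = (Pi.single i k : Fin t → ℕ) :=
    fun k => funext fun j => by rw [Pi.single_apply]
  rw [← Finset.cons_eq_insert _ _ hi, Finset.piAntidiag_cons, Finset.sum_disjiUnion,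
    ← Finset.Nat.sum_antidiagonal_eq_sum_range_succ
      (fun j k => ∑ α ∈ Finset.piAntidiag s j, F (bump α i k)) n,
    ← Finset.Nat.sum_antidiagonal_swap]
  refine Finset.sum_congr rfl fun p _ => ?_
  simp [Finset.sum_map, he, bump]

lemma sum_range_piAntidiag_insert {s : Finset (Fin t)} {i : Fin t} (hi : i ∉ s) (n : ℕ)
    (F : (Fin t → ℕ) → ℝ) :
    ∑ k ∈ Finset.range (n + 1), ∑ α ∈ Finset.piAntidiag (insert i s) k, F α =
      ∑ j ∈ Finset.range (n + 1), ∑ α ∈ Finset.piAntidiag s j, ∑ k ∈ Finset.range (n - j + 1),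
        F (bump α i k) := by
  simp only [sum_piAntidiag_insert hi]
  rw [Finset.sum_range_diag_flip (n + 1)
    fun j k => ∑ α ∈ Finset.piAntidiag s j, F (bump α i k)]
  refine Finset.sum_congr rfl fun j hj => ?_
  rw [Finset.sum_comm, Nat.sub_add_comm (by simpa [Nat.lt_succ_iff] using hj)]

/-- Move from `a` to `x` one coordinate at a time. With `y` obtained from `a` by changing the head
coordinate `i`, expand `g` at `y` in the remaining coordinates, then expand each coefficient of
order `j` along `i` from `a` to order `n - j`. Since `∂_i` is outermost in `listDeriv`, no
derivatives have to be commuted. Free top coefficients `c` with tolerances `ω` keep the induction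
closed. -/
lemma taylor_list : ∀ (l : List (Fin t)) (_ : l.Nodup) {n : ℕ} {g : (Fin t → ℝ) → ℝ}
    (_ : ContDiffOn ℝ n g (unitCube t)) {a x : Fin t → ℝ} (_ : a ∈ unitCube t)
    (_ : x ∈ unitCube t) (_ : ∀ j ∉ l, x j = a j) {r : ℝ} (_ : ∀ j, |x j - a j| ≤ r)
    (c ω : (Fin t → ℕ) → ℝ)
    (_ : ∀ k < n, ∀ α ∈ Finset.piAntidiag l.toFinset k, c α = listDeriv l α g a)
    (_ : ∀ α ∈ Finset.piAntidiag l.toFinset n, ∀ z ∈ Set.uIcc a x,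
      |listDeriv l α g z - c α| ≤ ω α),
    |g x - ∑ k ∈ Finset.range (n + 1), ∑ α ∈ Finset.piAntidiag l.toFinset k,
      c α * ∏ j ∈ l.toFinset, ((x j - a j) ^ α j / (α j).factorial)| ≤
        (∑ α ∈ Finset.piAntidiag l.toFinset n, ω α) * r ^ n := by
  intro l
  induction l with
  | nil =>
    intro _ n g _ a x _ _ hoff r hr c ω hc hω
    have hxa : x = a := funext fun j => hoff j (by simp)
    subst hxa
    rw [Finset.sum_range_succ']
    simp only [List.toFinset_nil, Finset.piAntidiag_empty] at hω hc ⊢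
    rcases Nat.eq_zero_or_pos n with rfl | hn
    · simpa [listDeriv] using hω 0
    · have := hc 0 hn 0 (by simp)
      simp [this, listDeriv, hn.ne']
  | cons i l ih =>
    intro hl n g hg a x ha hx hoff r hr c ω hc hω
    obtain ⟨hil, hl'⟩ := List.nodup_cons.1 hl
    have hil' : i ∉ l.toFinset := by simpa using hil
    have hr0 : 0 ≤ r := (abs_nonneg _).trans (hr i)
    have hai : a i ∈ Set.Icc (0 : ℝ) 1 := ⟨ha.1 i, ha.2 i⟩
    have hxi : x i ∈ Set.Icc (0 : ℝ) 1 := ⟨hx.1 i, hx.2 i⟩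
    rw [List.toFinset_cons] at hc hω ⊢
    set s := l.toFinset with hs
    set y := Function.update a i (x i) with hy
    have hyc : y ∈ unitCube t := update_mem_unitCube ha i hxi
    have hupd : ∀ r ∈ Set.uIcc (a i) (x i), Function.update a i r ∈ Set.uIcc a x := by
      intro r hr
      rw [← Set.pi_univ_uIcc]
      intro j _
      by_cases h : j = i
      · subst h; simpa using hr
      · simp [h]
    have hyx : Set.uIcc y x ⊆ Set.uIcc a x :=
      Set.uIcc_subset_uIcc_right (hupd _ Set.right_mem_uIcc)
    have hsum0 : ∀ {k : ℕ} {α : Fin t → ℕ}, α ∈ Finset.piAntidiag s k → α i = 0 := by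
      intro k α hα
      by_contra h
      exact hil' ((Finset.mem_piAntidiag.1 hα).2 i h)
    have hmem : ∀ {j k : ℕ} {α : Fin t → ℕ}, α ∈ Finset.piAntidiag s j →
        bump α i k ∈ Finset.piAntidiag (insert i s) (j + k) := by
      intro j k α hα
      rw [Finset.mem_piAntidiag] at hα ⊢
      rw [Finset.sum_insert hil']
      have h0 := hsum0 (Finset.mem_piAntidiag.2 hα)
      have h1 : ∑ x ∈ s, (bump α i k) x = j := by
        rw [← hα.1]
        refine Finset.sum_congr rfl fun x hx => ?_
        have : x ≠ i := fun h => hil' (h ▸ hx)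
        simp [this]
      refine ⟨by rw [h1]; simp [h0, add_comm], fun p hp => ?_⟩
      by_cases h : p = i
      · simp [h]
      · exact Finset.mem_insert_of_mem (hα.2 p (by simpa [h] using hp))
    have hD : ∀ {j : ℕ} (k : ℕ) {α : Fin t → ℕ}, α ∈ Finset.piAntidiag s j →
        listDeriv (i :: l) (bump α i k) g =
          (partialDeriv (unitCube t) i)^[k] (listDeriv l α g) := by
      intro j k α hα
      have h1 : listDeriv l (bump α i k) g = listDeriv l α g :=
        listDeriv_congr (fun p hp => by
          have : p ≠ i := fun h => hil (h ▸ hp)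
          simp [this]) g
      have h2 : (bump α i k) i = k := by simp [hsum0 hα]
      rw [listDeriv, List.foldr_cons, ← listDeriv, h1, h2]
    -- Coefficients of full order `n` are already those wanted at `a`. The lower ones are
    -- derivatives at `y` and remain to be expanded along `i`.
    set c' : (Fin t → ℕ) → ℝ := fun α => if ∑ j ∈ s, α j = n then c α else listDeriv l α g y with hc'
    have step1 := ih hl' hg hyc hx
      (fun j hj => by
        by_cases h : j = i
        · subst h; simp [hy]
        · rw [hy, Function.update_of_ne h]; exact hoff j (by simp [h, hj])) (r := r)
      (fun j => by
        by_cases h : j = i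
        · subst h; simpa [hy] using hr0
        · rw [hy, Function.update_of_ne h]; exact hr j) c' ω
      (fun k hk α hα => by
        rw [hc']
        exact if_neg (by rw [(Finset.mem_piAntidiag.1 hα).1]; exact hk.ne))
      (fun α hα z hz => by
        have h1 : c' α = c α := if_pos (Finset.mem_piAntidiag.1 hα).1
        have h2 := hω _ (hmem (k := 0) hα) z (hyx hz)
        rw [hD 0 hα] at h2
        simpa [h1] using h2)
    -- For `j = n` nothing is expanded, hence the error zero. Counting `ω` there would duplicate the
    -- contribution of `step1`.
    have step2 : ∀ j ∈ Finset.range (n + 1), ∀ α ∈ Finset.piAntidiag s j,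
        |c' α - ∑ k ∈ Finset.range (n - j + 1), c (bump α i k) *
          ((x i - a i) ^ k / k.factorial)| ≤
            (if j = n then 0 else ω (bump α i (n - j))) * r ^ (n - j) := by
      intro j hj α hα
      have hjn : j ≤ n := by simpa [Nat.lt_succ_iff] using hj
      rcases hjn.eq_or_lt with rfl | hlt
      · have h1 : c' α = c α := if_pos (Finset.mem_piAntidiag.1 hα).1
        simp [h1]
      · have h1 : c' α = listDeriv l α g y :=
          if_neg (by rw [(Finset.mem_piAntidiag.1 hα).1]; exact hlt.ne)
        have hsum : (l.map α).sum = j := by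
          rw [← (Finset.mem_piAntidiag.1 hα).1, hs, List.sum_toFinset _ hl']
        have hcd : ContDiffOn ℝ (n - j : ℕ) (listDeriv l α g) (unitCube t) :=
          contDiffOn_listDeriv l α (by rwa [hsum, Nat.sub_add_cancel hjn])
        have h2 := taylor_line (n - j) (A := c (bump α i (n - j)))
          (ω := ω (bump α i (n - j)))
          (fun k s => (partialDeriv (unitCube t) i)^[k] (listDeriv l α g) (Function.update a i s))
          (fun k hk s hs => by
            have h3 : ContDiffOn ℝ (1 : ℕ) ((partialDeriv (unitCube t) i)^[k] (listDeriv l α g))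
                (unitCube t) :=
              contDiffOn_partialDeriv_iterate (hcd.of_le (by norm_cast; omega)) i
            have := hasDerivWithinAt_partialDeriv (h3.differentiableOn (by simp)) ha i hs
            rwa [← Function.iterate_succ_apply' (partialDeriv (unitCube t) i)] at this)
          hai hxi
          (fun r hr => by
            rw [← hD _ hα]
            refine hω _ ?_ _ (hupd r hr)
            have := hmem (k := n - j) hα
            rwa [Nat.add_sub_cancel' hjn] at this)
        rw [if_neg hlt.ne, h1, Finset.sum_range_succ]
        refine le_trans (le_of_eq_of_le ?_ h2) ?_
        · congr 3
          refine Finset.sum_congr rfl fun k hk => ?_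
          have hk' := Finset.mem_range.1 hk
          rw [Function.update_eq_self, ← hD _ hα, hc (j + k) (by omega) _ (hmem hα)]
        · have h4 : 0 ≤ ω (bump α i (n - j)) := by
            refine (abs_nonneg _).trans (hω _ ?_ a Set.left_mem_uIcc)
            have := hmem (k := n - j) hα
            rwa [Nat.add_sub_cancel' hjn] at this
          gcongr
          exact hr i
    rw [sum_range_piAntidiag_insert hil', sum_piAntidiag_insert hil']
    have e1 : ∀ j ∈ Finset.range (n + 1), ∀ α ∈ Finset.piAntidiag s j,
        ∑ k ∈ Finset.range (n - j + 1), c (bump α i k) *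
          ∏ p ∈ insert i s, ((x p - a p) ^ (bump α i k) p /
            ((bump α i k) p).factorial) =
        (∑ k ∈ Finset.range (n - j + 1), c (bump α i k) *
          ((x i - a i) ^ k / k.factorial)) *
            ∏ p ∈ s, ((x p - y p) ^ α p / (α p).factorial) := by
      intro j hj α hα
      rw [Finset.sum_mul]
      refine Finset.sum_congr rfl fun k _ => ?_
      rw [Finset.prod_insert hil', ← mul_assoc]
      congr 1
      · simp [hsum0 hα]
      · refine Finset.prod_congr rfl fun p hp => ?_
        have : p ≠ i := fun h => hil' (h ▸ hp)
        simp [this, hy]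
    have e2 : |∑ j ∈ Finset.range (n + 1), ∑ α ∈ Finset.piAntidiag s j,
        (c' α * ∏ p ∈ s, ((x p - y p) ^ α p / (α p).factorial) -
        (∑ k ∈ Finset.range (n - j + 1), c (bump α i k) *
          ((x i - a i) ^ k / k.factorial)) * ∏ p ∈ s, ((x p - y p) ^ α p / (α p).factorial))| ≤
        ∑ j ∈ Finset.range n, ∑ α ∈ Finset.piAntidiag s j,
          ω (bump α i (n - j)) * r ^ n := by
      have hprod : ∀ j, ∀ α ∈ Finset.piAntidiag s j,
          |∏ p ∈ s, ((x p - y p) ^ α p / (α p).factorial)| ≤ r ^ j := by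
        intro j α hα
        rw [← (Finset.mem_piAntidiag.1 hα).1, ← Finset.prod_pow_eq_pow_sum, Finset.abs_prod]
        refine Finset.prod_le_prod (fun _ _ => abs_nonneg _) fun p hp => ?_
        have hpi : p ≠ i := fun h => hil' (h ▸ hp)
        rw [abs_div, abs_pow, Nat.abs_cast, hy, Function.update_of_ne hpi]
        refine (div_le_self (by positivity) (by exact_mod_cast Nat.factorial_pos _)).trans ?_
        gcongr
        exact hr p
      have h5 : ∀ j ∈ Finset.range (n + 1), ∀ α ∈ Finset.piAntidiag s j,
          |c' α * ∏ p ∈ s, ((x p - y p) ^ α p / (α p).factorial) -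
          (∑ k ∈ Finset.range (n - j + 1), c (bump α i k) *
          ((x i - a i) ^ k / k.factorial)) * ∏ p ∈ s, ((x p - y p) ^ α p / (α p).factorial)| ≤
          (if j = n then 0 else ω (bump α i (n - j))) * r ^ n := by
        intro j hj α hα
        have hjn : j ≤ n := by simpa [Nat.lt_succ_iff] using hj
        rw [← sub_mul, abs_mul]
        calc _ ≤ ((if j = n then 0 else ω (bump α i (n - j))) * r ^ (n - j)) * r ^ j :=
              mul_le_mul (step2 j hj α hα) (hprod j α hα) (abs_nonneg _)
                ((abs_nonneg _).trans (step2 j hj α hα))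
          _ = _ := by rw [mul_assoc, ← pow_add, Nat.sub_add_cancel hjn]
      refine (Finset.abs_sum_le_sum_abs _ _).trans ((Finset.sum_le_sum fun j hj =>
        (Finset.abs_sum_le_sum_abs _ _).trans (Finset.sum_le_sum fun α hα => h5 j hj α hα)).trans ?_)
      rw [Finset.sum_range_succ]
      simp only [if_true, zero_mul, Finset.sum_const_zero, add_zero]
      refine (Finset.sum_congr rfl fun j hj => ?_).le
      simp [(Finset.mem_range.1 hj).ne]
    rw [Finset.sum_congr rfl fun j hj => Finset.sum_congr rfl fun α hα => e1 j hj α hα]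
    simp only [Finset.sum_sub_distrib] at e2
    set T1 := ∑ j ∈ Finset.range (n + 1), ∑ α ∈ Finset.piAntidiag s j,
        c' α * ∏ p ∈ s, ((x p - y p) ^ α p / (α p).factorial)
    calc _ = |(g x - T1) + (T1 - _)| := by rw [sub_add_sub_cancel]
      _ ≤ _ := (abs_add_le _ _).trans (add_le_add step1 e2)
      _ = _ := by
        rw [Finset.sum_range_succ, add_mul, Finset.sum_mul, add_comm]
        simp [Finset.sum_mul]

/-! ### Local polynomial approximation of Hölder functions -/

/-- The multi-indices of order at most `q`. -/
def monoIdx (t q : ℕ) : Finset (Fin t → ℕ) :=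
  (Fintype.piFinset fun _ => Finset.range (q + 1)).filter fun α => ∑ j, α j ≤ q

lemma mem_monoIdx {q : ℕ} {α : Fin t → ℕ} : α ∈ monoIdx t q ↔ ∑ j, α j ≤ q := by
  simp only [monoIdx, Finset.mem_filter, Fintype.mem_piFinset, Finset.mem_range,
    and_iff_right_iff_imp, Nat.lt_succ_iff]
  exact fun h j => (Finset.single_le_sum (fun _ _ => Nat.zero_le _) (Finset.mem_univ j)).trans h

lemma card_monoIdx_le (t q : ℕ) : (monoIdx t q).card ≤ (q + 1) ^ t :=
  (Finset.card_filter_le _ _).trans (by simp)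

lemma sum_monoIdx (q : ℕ) (F : (Fin t → ℕ) → ℝ) : ∑ α ∈ monoIdx t q, F α =
    ∑ k ∈ Finset.range (q + 1), ∑ α ∈ Finset.piAntidiag Finset.univ k, F α := by
  rw [← Finset.sum_fiberwise_of_maps_to (t := Finset.range (q + 1)) (g := fun α : Fin t → ℕ => ∑ j, α j)
    fun α hα => Finset.mem_range.2 (Nat.lt_succ_of_le (mem_monoIdx.1 hα))]
  refine Finset.sum_congr rfl fun k hk => Finset.sum_congr ?_ fun _ _ => rfl
  ext α
  have := Finset.mem_range.1 hk
  simp only [Finset.mem_filter, mem_monoIdx, Finset.mem_piAntidiag]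
  constructor
  · rintro ⟨_, h⟩; exact ⟨h, by simp⟩
  · rintro ⟨h, _⟩; exact ⟨(le_of_eq h).trans (by omega), h⟩

lemma two_pow_le_two_mul_factorial (k : ℕ) : 2 ^ k ≤ 2 * k.factorial := by
  induction k with
  | zero => simp
  | succ k ih =>
    rcases k.eq_zero_or_pos with rfl | hk
    · simp
    · rw [pow_succ, Nat.factorial_succ]
      nlinarith [Nat.factorial_pos k]

/-- The binomial theorem in each coordinate: as `|a_j| ≤ 1`, the coefficients in one variable sum to
at most `2^k / k!`, which never exceeds `2`. -/
lemma exists_shifted_monomial {q : ℕ} {α : Fin t → ℕ} (hα : ∑ j, α j ≤ q) {a : Fin t → ℝ}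
    (ha : a ∈ unitCube t) : ∃ c : (Fin t → ℕ) → ℝ, ∑ γ ∈ monoIdx t q, |c γ| ≤ 2 ^ t ∧
      ∀ x : Fin t → ℝ, ∑ γ ∈ monoIdx t q, c γ * ∏ j, x j ^ γ j =
        ∏ j, ((x j - a j) ^ α j / (α j).factorial) := by
  classical
  set S := Fintype.piFinset fun j => Finset.range (α j + 1) with hS
  have hsub : S ⊆ monoIdx t q := by
    intro γ hγ
    rw [mem_monoIdx]
    refine (Finset.sum_le_sum fun j _ => ?_).trans hα
    simpa [Nat.lt_succ_iff] using Fintype.mem_piFinset.1 hγ j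
  set d : Fin t → ℕ → ℝ := fun j k =>
    (-a j) ^ (α j - k) * (α j).choose k / (α j).factorial with hd
  refine ⟨fun γ => if γ ∈ S then ∏ j, d j (γ j) else 0, ?_, fun x => ?_⟩
  · simp only [apply_ite abs, abs_zero]
    rw [Finset.sum_ite_mem, Finset.inter_eq_right.2 hsub]
    simp only [Finset.abs_prod]
    rw [hS, ← Finset.prod_univ_sum (fun j => Finset.range (α j + 1)) fun j k => |d j k|]
    refine (Finset.prod_le_prod (fun j _ => Finset.sum_nonneg fun _ _ => abs_nonneg _)
      fun j _ => ?_).trans (by simp : ∏ _j : Fin t, (2 : ℝ) ≤ 2 ^ t)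
    have hf : (0 : ℝ) < (α j).factorial := by exact_mod_cast Nat.factorial_pos _
    calc ∑ k ∈ Finset.range (α j + 1), |d j k|
        ≤ ∑ k ∈ Finset.range (α j + 1), ((α j).choose k : ℝ) / (α j).factorial := by
          refine Finset.sum_le_sum fun k _ => ?_
          rw [hd, abs_div, abs_mul, abs_pow, abs_neg, Nat.abs_cast, Nat.abs_cast]
          gcongr
          refine mul_le_of_le_one_left (by positivity) (pow_le_one₀ (abs_nonneg _) ?_)
          exact abs_le.2 ⟨by linarith [ha.1 j, show (0 : Fin t → ℝ) j = 0 from rfl], ha.2 j⟩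
      _ = 2 ^ α j / (α j).factorial := by
          rw [← Finset.sum_div]
          congr 1
          exact_mod_cast Nat.sum_range_choose (α j)
      _ ≤ 2 := by
          rw [div_le_iff₀ hf]
          exact_mod_cast two_pow_le_two_mul_factorial (α j)
  · simp only [ite_mul, zero_mul]
    rw [Finset.sum_ite_mem, Finset.inter_eq_right.2 hsub]
    simp only [← Finset.prod_mul_distrib]
    rw [hS, ← Finset.prod_univ_sum (fun j => Finset.range (α j + 1)) fun j k => d j k * x j ^ k]
    refine Finset.prod_congr rfl fun j _ => ?_
    rw [sub_eq_add_neg, add_pow, Finset.sum_div]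
    refine Finset.sum_congr rfl fun k _ => ?_
    rw [hd]
    ring

lemma strictFloor_add_one {β : ℝ} (hβ : 0 < β) : strictFloor β + 1 = ⌈β⌉₊ :=
  Nat.sub_add_cancel (Nat.ceil_pos.2 hβ)

lemma strictFloor_lt {β : ℝ} (hβ : 0 < β) : (strictFloor β : ℝ) < β := by
  have h1 := Nat.ceil_lt_add_one hβ.le
  rw [← strictFloor_add_one hβ] at h1
  push_cast at h1
  linarith

lemma sum_abs_multiDeriv_le {β K : ℝ} (hK : 0 < K) {f : (Fin t → ℝ) → ℝ}
    (hf : f ∈ holderBall (unitCube t) β K) {a : Fin t → ℝ} (ha : a ∈ unitCube t) :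
    ∑ α ∈ monoIdx t (strictFloor β), |multiDeriv (unitCube t) α f a| ≤ K := by
  rw [sum_monoIdx, ← ENNReal.ofReal_le_ofReal_iff hK.le]
  refine le_trans ?_ ((le_add_right le_rfl).trans hf.2)
  rw [ENNReal.ofReal_sum_of_nonneg fun _ _ => Finset.sum_nonneg fun _ _ => abs_nonneg _]
  refine Finset.sum_le_sum fun k _ => ?_
  rw [ENNReal.ofReal_sum_of_nonneg fun _ _ => abs_nonneg _]
  exact Finset.sum_le_sum fun α _ =>
    le_iSup₂ (f := fun x (_ : x ∈ unitCube t) => ENNReal.ofReal |multiDeriv (unitCube t) α f x|) a ha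

lemma exists_holder_constants {β K : ℝ} (hK : 0 < K) {f : (Fin t → ℝ) → ℝ}
    (hf : f ∈ holderBall (unitCube t) β K) : ∃ H : (Fin t → ℕ) → ℝ,
      ∑ α ∈ Finset.piAntidiag Finset.univ (strictFloor β), H α ≤ K ∧
      ∀ α ∈ Finset.piAntidiag Finset.univ (strictFloor β), ∀ x ∈ unitCube t, ∀ y ∈ unitCube t,
        |multiDeriv (unitCube t) α f x - multiDeriv (unitCube t) α f y| ≤
          H α * ‖x - y‖ ^ (β - strictFloor β) := by
  set S := fun α => holderSeminorm (unitCube t) (β - strictFloor β) (multiDeriv (unitCube t) α f)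
  have hsum : ∑ α ∈ Finset.piAntidiag Finset.univ (strictFloor β), S α ≤ ENNReal.ofReal K :=
    (le_add_left le_rfl).trans hf.2
  have hfin : ∀ α ∈ Finset.piAntidiag Finset.univ (strictFloor β), S α ≠ ⊤ := fun α hα =>
    ((Finset.single_le_sum (fun _ _ => zero_le) hα).trans hsum).trans_lt
      ENNReal.ofReal_lt_top |>.ne
  refine ⟨fun α => (S α).toReal, ?_, fun α hα x hx y hy => ?_⟩
  · rw [← ENNReal.toReal_sum hfin]
    exact ENNReal.toReal_le_of_le_ofReal hK.le hsum
  · rcases eq_or_ne x y with rfl | hxy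
    · rw [sub_self, abs_zero]
      positivity
    · have hp : 0 < ‖x - y‖ ^ (β - strictFloor β) :=
        Real.rpow_pos_of_pos (norm_pos_iff.2 (sub_ne_zero.2 hxy)) _
      rw [← div_le_iff₀ hp, ← ENNReal.ofReal_le_iff_le_toReal (hfin α hα)]
      refine le_trans ?_ (le_iSup₂ (f := fun x (_ : x ∈ unitCube t) =>
        ⨆ y ∈ unitCube t, ⨆ _ : x ≠ y, ENNReal.ofReal (|multiDeriv (unitCube t) α f x -
          multiDeriv (unitCube t) α f y| / ‖x - y‖ ^ (β - strictFloor β))) x hx)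
      refine le_trans ?_ (le_iSup₂ (f := fun y (_ : y ∈ unitCube t) =>
        ⨆ _ : x ≠ y, ENNReal.ofReal (|multiDeriv (unitCube t) α f x -
          multiDeriv (unitCube t) α f y| / ‖x - y‖ ^ (β - strictFloor β))) y hy)
      exact le_iSup (fun _ : x ≠ y => ENNReal.ofReal (|multiDeriv (unitCube t) α f x -
          multiDeriv (unitCube t) α f y| / ‖x - y‖ ^ (β - strictFloor β))) hxy

/-- Near every point of the cube, a Hölder function is approximated by a polynomial with
controlled coefficients. -/
lemma exists_local_polynomial {β K : ℝ} (hβ : 0 < β) (hK : 0 < K) {f : (Fin t → ℝ) → ℝ}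
    (hf : f ∈ holderBall (unitCube t) β K) {a : Fin t → ℝ} (ha : a ∈ unitCube t) :
    ∃ c : (Fin t → ℕ) → ℝ, ∑ γ ∈ monoIdx t (strictFloor β), |c γ| ≤ K * 2 ^ t ∧
      ∀ x ∈ unitCube t, |∑ γ ∈ monoIdx t (strictFloor β), c γ * ∏ j, x j ^ γ j - f x| ≤
        K * ‖x - a‖ ^ β := by
  set q := strictFloor β
  have hq : (q : ℝ) < β := strictFloor_lt hβ
  have key : ∀ α : monoIdx t q, ∃ c : (Fin t → ℕ) → ℝ, ∑ γ ∈ monoIdx t q, |c γ| ≤ 2 ^ t ∧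
      ∀ x : Fin t → ℝ, ∑ γ ∈ monoIdx t q, c γ * ∏ j, x j ^ γ j =
        ∏ j, ((x j - a j) ^ α.1 j / (α.1 j).factorial) :=
    fun α => exists_shifted_monomial (mem_monoIdx.1 α.2) ha
  choose c hc1 hc2 using key
  set D : (Fin t → ℕ) → ℝ := fun α => multiDeriv (unitCube t) α f a with hD
  refine ⟨fun γ => ∑ α : monoIdx t q, D α * c α γ, ?_, fun x hx => ?_⟩
  · calc ∑ γ ∈ monoIdx t q, |∑ α : monoIdx t q, D α * c α γ|
        ≤ ∑ γ ∈ monoIdx t q, ∑ α : monoIdx t q, |D α| * |c α γ| :=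
          Finset.sum_le_sum fun γ _ => (Finset.abs_sum_le_sum_abs _ _).trans
            (Finset.sum_le_sum fun α _ => (abs_mul _ _).le)
      _ = ∑ α : monoIdx t q, |D α| * ∑ γ ∈ monoIdx t q, |c α γ| := by
          rw [Finset.sum_comm]; simp only [Finset.mul_sum]
      _ ≤ ∑ α : monoIdx t q, |D α| * 2 ^ t :=
          Finset.sum_le_sum fun α _ => mul_le_mul_of_nonneg_left (hc1 α) (abs_nonneg _)
      _ = (∑ α ∈ monoIdx t q, |D α|) * 2 ^ t := by
          rw [← Finset.sum_mul, Finset.sum_coe_sort (monoIdx t q) fun α => |D α|]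
      _ ≤ K * 2 ^ t := by
          gcongr
          exact sum_abs_multiDeriv_le hK hf ha
  · have e : ∑ γ ∈ monoIdx t q, (∑ α : monoIdx t q, D α * c α γ) * ∏ j, x j ^ γ j =
        ∑ α ∈ monoIdx t q, D α * ∏ j, ((x j - a j) ^ α j / (α j).factorial) := by
      simp only [Finset.sum_mul]
      rw [Finset.sum_comm, ← Finset.sum_coe_sort (monoIdx t q)
        fun α => D α * ∏ j, ((x j - a j) ^ α j / (α j).factorial)]
      refine Finset.sum_congr rfl fun α _ => ?_
      rw [← hc2 α x, Finset.mul_sum]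
      exact Finset.sum_congr rfl fun γ _ => mul_assoc _ _ _
    obtain ⟨H, hH1, hH2⟩ := exists_holder_constants hK hf
    have hfin : (List.finRange t).toFinset = Finset.univ := by ext; simp
    have hz : ∀ z ∈ Set.uIcc a x, ‖z - a‖ ≤ ‖x - a‖ := by
      intro z hz
      rw [← Set.pi_univ_uIcc] at hz
      refine (pi_norm_le_iff_of_nonneg (norm_nonneg _)).2 fun j => ?_
      exact (Set.abs_sub_left_of_mem_uIcc (hz j trivial)).trans (norm_le_pi_norm (x - a) j)
    have hT := taylor_list (List.finRange t) (List.nodup_finRange t) hf.1 ha hx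
      (fun j hj => absurd (List.mem_finRange j) hj) (r := ‖x - a‖)
      (fun j => norm_le_pi_norm (x - a) j) D (fun α => H α * ‖x - a‖ ^ (β - q))
      (fun _ _ _ _ => rfl)
      (fun α hα z hzu => by
        rw [hfin] at hα
        have hzc : z ∈ unitCube t := Set.uIcc_subset_Icc ha hx hzu
        have h1 := hH2 α hα z hzc a ha
        have h2 := hH2 α hα x hx a ha
        -- For `z ≠ a` the Hölder inequality at `z` shows `0 ≤ H α`, so the power can be enlarged.
        -- At `z = a` this sign is not available, but the left side vanishes.
        rcases (norm_nonneg (z - a)).eq_or_lt with h0 | h0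
        · have : z = a := sub_eq_zero.1 (norm_eq_zero.1 h0.symm)
          subst this
          have h3 : |listDeriv (List.finRange t) α f z - D α| = 0 := by
            rw [abs_eq_zero]; exact sub_self _
          rw [h3]
          exact (abs_nonneg _).trans h2
        · refine h1.trans ?_
          have hp : 0 < ‖z - a‖ ^ (β - q) := Real.rpow_pos_of_pos h0 _
          have hH0 : 0 ≤ H α := nonneg_of_mul_nonneg_left ((abs_nonneg _).trans h1) hp
          exact mul_le_mul_of_nonneg_left
            (Real.rpow_le_rpow (norm_nonneg _) (hz z hzu) (by linarith)) hH0)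
    rw [hfin, ← sum_monoIdx q fun α => D α * ∏ j, ((x j - a j) ^ α j / (α j).factorial)] at hT
    rw [e, abs_sub_comm]
    refine hT.trans ?_
    rw [← Finset.sum_mul, mul_assoc, ← Real.rpow_natCast,
      ← Real.rpow_add_of_nonneg (norm_nonneg _) (by linarith) (by positivity), sub_add_cancel]
    gcongr

/-! ### Partition of unity by products of hat functions -/

/-- The hat function of height `1 / M` around the grid point `k / M`. -/
noncomputable def hat (M : ℕ) (k : Fin (M + 1)) (s : ℝ) : ℝ := max (1 / M - |s - k / M|) 0

/-- The grid point with index `l`. -/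
noncomputable def node {M : ℕ} (l : Fin t → Fin (M + 1)) : Fin t → ℝ := fun j => l j / M

/-- The product of hat functions around the grid point with index `l`. -/
noncomputable def prodHat {M : ℕ} (l : Fin t → Fin (M + 1)) (x : Fin t → ℝ) : ℝ :=
  ∏ j, hat M (l j) (x j)

section

variable {M : ℕ}

lemma node_mem (hM : 1 ≤ M) (l : Fin t → Fin (M + 1)) : node l ∈ unitCube t := by
  have hM' : (0 : ℝ) < M := by exact_mod_cast hM
  refine ⟨fun j => by simp only [node, Pi.zero_apply]; positivity, fun j => ?_⟩
  rw [node, Pi.one_apply, div_le_one hM']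
  exact_mod_cast Nat.lt_succ_iff.1 (l j).2

lemma hat_mem (hM : 1 ≤ M) (k : Fin (M + 1)) (s : ℝ) : hat M k s ∈ Set.Icc (0 : ℝ) 1 := by
  have hM' : (1 : ℝ) ≤ M := by exact_mod_cast hM
  refine ⟨le_max_right _ _, max_le ?_ zero_le_one⟩
  have : (1 : ℝ) / M ≤ 1 := by rw [div_le_one (by linarith)]; exact hM'
  linarith [abs_nonneg (s - k / M)]

lemma abs_hat_sub_le (k : Fin (M + 1)) (s r : ℝ) : |hat M k s - hat M k r| ≤ |s - r| := by
  refine (abs_max_sub_max_le_abs _ _ _).trans ?_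
  rw [show 1 / (M : ℝ) - |s - k / M| - (1 / M - |r - k / M|) = |r - k / M| - |s - k / M| by ring]
  refine (abs_abs_sub_abs_le _ _).trans ?_
  rw [sub_sub_sub_cancel_right, abs_sub_comm]

lemma mul_hat (hM : 1 ≤ M) (k : Fin (M + 1)) (s : ℝ) :
    M * hat M k s = max (1 - |M * s - k|) 0 := by
  have hM' : (0 : ℝ) < M := by exact_mod_cast hM
  rw [hat, mul_max_of_nonneg _ _ hM'.le, mul_zero, mul_sub, mul_one_div_cancel hM'.ne']
  congr 3
  rw [← abs_of_pos hM', ← abs_mul, abs_of_pos hM', mul_sub, mul_div_cancel₀ _ hM'.ne']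

lemma abs_sub_lt_of_hat_ne_zero {k : Fin (M + 1)} {s : ℝ} (h : hat M k s ≠ 0) :
    |s - k / M| < 1 / M := by
  by_contra h'
  exact h (max_eq_right (by linarith [not_lt.1 h']))

/-- A unit hat is the difference of the consecutive unit ramps `d k` and `d (k + 1)`. The sum
telescopes to `d 0 - d (M + 1)`, which equals `1 - 0` for `0 ≤ y ≤ M`. -/
lemma mul_sum_hat (hM : 1 ≤ M) {s : ℝ} (hs : s ∈ Set.Icc (0 : ℝ) 1) :
    ∑ k : Fin (M + 1), M * hat M k s = 1 := by
  have hM' : (0 : ℝ) < M := by exact_mod_cast hM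
  set y := M * s with hy
  have hy0 : 0 ≤ y := mul_nonneg hM'.le hs.1
  have hy1 : y ≤ M := mul_le_of_le_one_right hM'.le hs.2
  set d : ℕ → ℝ := fun k => max (y - k + 1) 0 - max (y - k) 0 with hd
  have h1 : ∀ k : ℕ, max (1 - |y - k|) 0 = d k - d (k + 1) := by
    intro k
    simp only [hd]
    push_cast
    rw [show y - ((k : ℝ) + 1) + 1 = y - k by ring, show y - ((k : ℝ) + 1) = (y - k) - 1 by ring]
    generalize y - k = z
    rcases le_total z 0 with h | h
    · rw [abs_of_nonpos h, max_eq_right h, max_eq_right (by linarith : z - 1 ≤ 0)]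
      rw [sub_neg_eq_add, add_comm]; ring
    · rw [abs_of_nonneg h, max_eq_left h, max_eq_left (by linarith : 0 ≤ z + 1)]
      rcases le_total z 1 with h' | h'
      · rw [max_eq_left (by linarith), max_eq_right (by linarith)]; ring
      · rw [max_eq_right (by linarith), max_eq_left (by linarith)]; ring
  simp only [mul_hat hM, ← hy]
  rw [Fin.sum_univ_eq_sum_range (fun k : ℕ => max (1 - |y - k|) 0) (M + 1)]
  simp only [h1]
  rw [Finset.sum_range_sub', hd]
  push_cast
  rw [max_eq_left (by linarith), max_eq_left (by linarith), max_eq_right (by linarith),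
    max_eq_right (by linarith)]
  ring

lemma prodHat_mem (hM : 1 ≤ M) (l : Fin t → Fin (M + 1)) (x : Fin t → ℝ) :
    prodHat l x ∈ Set.Icc (0 : ℝ) 1 := prod_mem_Icc fun _ _ => hat_mem hM _ _

lemma pow_mul_prodHat (l : Fin t → Fin (M + 1)) (x : Fin t → ℝ) :
    M ^ t * prodHat l x = ∏ j, (M * hat M (l j) (x j)) := by
  rw [Finset.prod_mul_distrib, prodHat]
  simp

lemma sum_pow_mul_prodHat (hM : 1 ≤ M) {x : Fin t → ℝ} (hx : x ∈ unitCube t) :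
    ∑ l : Fin t → Fin (M + 1), M ^ t * prodHat l x = 1 := by
  simp only [pow_mul_prodHat]
  rw [← Fintype.piFinset_univ,
    ← Finset.prod_univ_sum (fun _ => Finset.univ) fun j k => (M : ℝ) * hat M k (x j)]
  exact Finset.prod_eq_one fun j _ => mul_sum_hat hM ⟨hx.1 j, hx.2 j⟩

open Classical in
/-- The indices of the grid points whose hat functions do not vanish at `x`. -/
noncomputable def active (M : ℕ) (x : Fin t → ℝ) : Finset (Fin t → Fin (M + 1)) :=
  Finset.univ.filter fun l => ∀ j, hat M (l j) (x j) ≠ 0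

lemma mem_active {x : Fin t → ℝ} {l : Fin t → Fin (M + 1)} :
    l ∈ active M x ↔ ∀ j, hat M (l j) (x j) ≠ 0 := by
  simp [active]

lemma exists_hat_eq_zero {x : Fin t → ℝ} {l : Fin t → Fin (M + 1)} (h : l ∉ active M x) :
    ∃ j, hat M (l j) (x j) = 0 := by
  simpa [mem_active] using h

lemma prodHat_eq_zero {x : Fin t → ℝ} {l : Fin t → Fin (M + 1)} (h : l ∉ active M x) :
    prodHat l x = 0 := by
  obtain ⟨j, hj⟩ := exists_hat_eq_zero h
  exact Finset.prod_eq_zero (Finset.mem_univ j) hj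

lemma norm_sub_node_le {x : Fin t → ℝ} {l : Fin t → Fin (M + 1)} (h : l ∈ active M x) :
    ‖x - node l‖ ≤ 1 / M :=
  (pi_norm_le_iff_of_nonneg (by positivity)).2 fun j =>
    (abs_sub_lt_of_hat_ne_zero (mem_active.1 h j)).le

/-- In each coordinate only the indices `⌊M x_j⌋` and `⌊M x_j⌋ + 1` can carry a nonzero hat. -/
lemma card_active_le (hM : 1 ≤ M) (x : Fin t → ℝ) : (active M x).card ≤ 2 ^ t := by
  classical
  have hM' : (0 : ℝ) < M := by exact_mod_cast hM
  have h1 : active M x = Fintype.piFinset fun j =>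
      Finset.univ.filter fun k => hat M k (x j) ≠ 0 := by
    ext l; simp [mem_active]
  rw [h1, Fintype.card_piFinset]
  refine (Finset.prod_le_prod' fun j _ => ?_).trans (by simp : ∏ _j : Fin t, 2 ≤ 2 ^ t)
  refine (Finset.card_le_card_of_injOn (t := {⌊M * x j⌋, ⌊M * x j⌋ + 1})
    (fun k : Fin (M + 1) => (k : ℤ)) (fun k hk => ?_) fun a _ b _ h => ?_).trans Finset.card_le_two
  · have h2 := abs_sub_lt_of_hat_ne_zero (by simpa using hk)
    rw [lt_div_iff₀ hM', ← abs_of_pos hM', ← abs_mul, abs_of_pos hM', sub_mul,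
      div_mul_cancel₀ _ hM'.ne', abs_lt, mul_comm] at h2
    have h3 := Int.floor_le (M * x j)
    have h4 := Int.lt_floor_add_one (M * x j)
    have h5 : ⌊M * x j⌋ < (k : ℤ) + 1 := by exact_mod_cast (by push_cast; linarith :
      ((⌊M * x j⌋ : ℤ) : ℝ) < (((k : ℤ) + 1 : ℤ) : ℝ))
    have h6 : (k : ℤ) < ⌊M * x j⌋ + 2 := by exact_mod_cast (by push_cast; linarith :
      (((k : ℤ)) : ℝ) < ((⌊M * x j⌋ + 2 : ℤ) : ℝ))
    simp only [Finset.coe_insert, Finset.coe_singleton, Set.mem_insert_iff,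
      Set.mem_singleton_iff]
    omega
  · have h' : ((a : ℕ) : ℤ) = (b : ℕ) := h
    exact Fin.ext (by exact_mod_cast h')

lemma abs_sum_le_of_inactive (hM : 1 ≤ M) {E : (Fin t → Fin (M + 1)) → ℝ} {x : Fin t → ℝ} {ε : ℝ}
    (h0 : ∀ l ∉ active M x, E l = 0) (hE : ∀ l ∈ active M x, |E l| ≤ ε) (hε : 0 ≤ ε) :
    |∑ l, E l| ≤ 2 ^ t * ε := by
  rw [← Finset.sum_subset (Finset.subset_univ (active M x)) fun l _ hl => h0 l hl]
  refine (Finset.abs_sum_le_sum_abs _ _).trans ((Finset.sum_le_card_nsmul _ _ _ hE).trans ?_)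
  rw [nsmul_eq_mul]
  gcongr
  exact_mod_cast card_active_le hM x

lemma abs_sum_le_of_inactive₂ (hM : 1 ≤ M) {E : (Fin t → Fin (M + 1)) → ℝ} {x y : Fin t → ℝ}
    {ε : ℝ} (h0 : ∀ l, l ∉ active M x → l ∉ active M y → E l = 0)
    (hE : ∀ l, l ∈ active M x ∨ l ∈ active M y → |E l| ≤ ε) (hε : 0 ≤ ε) :
    |∑ l, E l| ≤ 2 * 2 ^ t * ε := by
  classical
  rw [← Finset.sum_subset (Finset.subset_univ (active M x ∪ active M y)) fun l _ hl => by
    simp only [Finset.mem_union, not_or] at hl; exact h0 l hl.1 hl.2]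
  refine (Finset.abs_sum_le_sum_abs _ _).trans ((Finset.sum_le_card_nsmul _ _ _
    fun l hl => hE l (Finset.mem_union.1 hl)).trans ?_)
  rw [nsmul_eq_mul]
  gcongr
  have h1 := Finset.card_union_le (active M x) (active M y)
  have h2 := card_active_le hM x
  have h3 := card_active_le hM y
  exact_mod_cast (by omega : _ ≤ 2 * 2 ^ t)

lemma abs_pow_mul_prodHat_sub_le (hM : 1 ≤ M) (l : Fin t → Fin (M + 1)) (x y : Fin t → ℝ) :
    |M ^ t * prodHat l x - M ^ t * prodHat l y| ≤ t * M * ‖x - y‖ := by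
  have hM' : (0 : ℝ) < M := by exact_mod_cast hM
  have h1 : ∀ z : Fin t → ℝ, ∀ j ∈ Finset.univ, |M * hat M (l j) (z j)| ≤ 1 := by
    intro z j _
    rw [mul_hat hM, abs_of_nonneg (le_max_right _ _)]
    exact max_le (by linarith [abs_nonneg (M * z j - l j)]) zero_le_one
  rw [pow_mul_prodHat, pow_mul_prodHat]
  refine (abs_prod_sub_prod_le (h1 x) (h1 y)).trans ((Finset.sum_le_sum (g := fun _ => M * ‖x - y‖)
    fun j _ => ?_).trans (by simp [mul_assoc]))
  rw [← mul_sub, abs_mul, abs_of_pos hM']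
  gcongr
  exact (abs_hat_sub_le _ _ _).trans (norm_le_pi_norm (x - y) j)

variable {β K C Λ : ℝ} {f : (Fin t → ℝ) → ℝ} {p : (Fin t → Fin (M + 1)) → (Fin t → ℝ) → ℝ}

/-- The local polynomials are glued to a global approximation. -/
lemma abs_sum_prodHat_mul_sub_le (hM : 1 ≤ M) (hβ : 0 < β) (hK : 0 < K)
    (hp : ∀ l, ∀ x ∈ unitCube t, |p l x - f x| ≤ K * ‖x - node l‖ ^ β) {x : Fin t → ℝ}
    (hx : x ∈ unitCube t) :
    |∑ l, M ^ t * prodHat l x * p l x - f x| ≤ K * (1 / M) ^ β := by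
  have e : ∑ l, M ^ t * prodHat l x * p l x - f x =
      ∑ l, M ^ t * prodHat l x * (p l x - f x) := by
    simp only [mul_sub, Finset.sum_sub_distrib]
    rw [← Finset.sum_mul, sum_pow_mul_prodHat hM hx, one_mul]
  have h0 : ∀ l, 0 ≤ (M : ℝ) ^ t * prodHat l x := fun l =>
    mul_nonneg (by positivity) (prodHat_mem hM l x).1
  rw [e]
  calc _ ≤ ∑ l, |M ^ t * prodHat l x * (p l x - f x)| := Finset.abs_sum_le_sum_abs _ _
    _ ≤ ∑ l, M ^ t * prodHat l x * (K * (1 / M) ^ β) := by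
        refine Finset.sum_le_sum fun l _ => ?_
        rw [abs_mul, abs_of_nonneg (h0 l)]
        by_cases hl : l ∈ active M x
        · refine mul_le_mul_of_nonneg_left ((hp l x hx).trans ?_) (h0 l)
          gcongr
          exact norm_sub_node_le hl
        · simp [prodHat_eq_zero hl]
    _ = _ := by rw [← Finset.sum_mul, sum_pow_mul_prodHat hM hx, one_mul]

lemma one_add_inv_rpow_le {β : ℝ} (hβ : 0 < β) : (1 + 1 / β) ^ β ≤ 3 := by
  have h1 : 1 + 1 / β ≤ Real.exp (1 / β) := by
    rw [add_comm]; exact Real.add_one_le_exp _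
  calc (1 + 1 / β) ^ β ≤ Real.exp (1 / β) ^ β := by gcongr
    _ = Real.exp 1 := by rw [← Real.exp_mul, one_div_mul_cancel hβ.ne']
    _ ≤ 3 := by linarith [Real.exp_one_lt_d9]

/-- The glued approximation is Lipschitz. -/
lemma abs_sum_prodHat_mul_sub_sum_le (hM : 1 ≤ M) (hβ : 1 ≤ β) (hK : 0 < K)
    (hp : ∀ l, ∀ x ∈ unitCube t, |p l x - f x| ≤ K * ‖x - node l‖ ^ β)
    (hpL : ∀ l, ∀ x ∈ unitCube t, ∀ y ∈ unitCube t, |p l x - p l y| ≤ Λ * ‖x - y‖)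
    (hfL : ∀ x ∈ unitCube t, ∀ y ∈ unitCube t, |f x - f y| ≤ (K + Λ) * ‖x - y‖)
    (hC1 : 6 * t * 2 ^ t * K + Λ ≤ C) (hC2 : (2 * β + 1) * K + Λ ≤ C) {x y : Fin t → ℝ}
    (hx : x ∈ unitCube t) (hy : y ∈ unitCube t) :
    |∑ l, M ^ t * prodHat l x * p l x - ∑ l, M ^ t * prodHat l y * p l y| ≤ C * ‖x - y‖ := by
  have hM' : (1 : ℝ) ≤ M := by exact_mod_cast hM
  have hM0 : (0 : ℝ) < M := by linarith
  have hβ0 : 0 < β := by linarith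
  have hMβ : ((1 : ℝ) / M) ^ β ≤ 1 / M := by
    conv_rhs => rw [← Real.rpow_one (1 / (M : ℝ))]
    exact Real.rpow_le_rpow_of_exponent_ge (by positivity) (by rw [div_le_one hM0]; exact hM') hβ
  -- The threshold `1/(βM)` costs only `(1 + 1/β)^β ≤ 3` when the bound at `x` is applied to nodes
  -- active at `y`. Beyond it, `1/M ≤ β ‖x - y‖` absorbs the approximation error.
  rcases le_total ‖x - y‖ (1 / (β * M)) with h | h
  · have hxy : ∀ l, l ∈ active M x ∨ l ∈ active M y → ‖x - node l‖ ≤ (1 + 1 / β) * (1 / M) := by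
      have e1 : 1 / (β * M) = 1 / β * (1 / M) := by rw [one_div_mul_one_div]
      rintro l (hl | hl)
      · have h1 := norm_sub_node_le hl
        have : 0 ≤ 1 / β * (1 / M) := by positivity
        linarith
      · have h1 := norm_sub_node_le hl
        have h2 := norm_sub_le_norm_sub_add_norm_sub x y (node l)
        linarith
    have hpf : ∀ l, l ∈ active M x ∨ l ∈ active M y → |p l x - f x| ≤ 3 * K * (1 / M) := by
      intro l hl
      calc |p l x - f x| ≤ K * ‖x - node l‖ ^ β := hp l x hx
        _ ≤ K * ((1 + 1 / β) * (1 / M)) ^ β := by gcongr; exact hxy l hl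
        _ = K * ((1 + 1 / β) ^ β * (1 / M) ^ β) := by
            rw [Real.mul_rpow (by positivity) (by positivity)]
        _ ≤ K * (3 * (1 / M)) := by gcongr; exact one_add_inv_rpow_le hβ0
        _ = _ := by ring
    -- The weights sum to one at both points, so `f x` can be subtracted for free. The factor `p l x
    -- - f x` of order `1/M` then cancels the slope of the weights.
    have e : ∑ l, M ^ t * prodHat l x * p l x - ∑ l, M ^ t * prodHat l y * p l y =
        ∑ l, (M ^ t * prodHat l x - M ^ t * prodHat l y) * (p l x - f x) +
          ∑ l, M ^ t * prodHat l y * (p l x - p l y) := by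
      have h1 := congrArg (· * f x) (sum_pow_mul_prodHat hM hx)
      have h2 := congrArg (· * f x) (sum_pow_mul_prodHat hM hy)
      simp only [Finset.sum_mul] at h1 h2
      simp only [mul_sub, sub_mul, Finset.sum_sub_distrib]
      linarith
    have b1 : |∑ l, (M ^ t * prodHat l x - M ^ t * prodHat l y) * (p l x - f x)| ≤
        2 * 2 ^ t * (3 * t * K * ‖x - y‖) := by
      refine abs_sum_le_of_inactive₂ hM (x := x) (y := y) (fun l h1 h2 => ?_) (fun l hl => ?_)
        (by positivity)
      · simp [prodHat_eq_zero h1, prodHat_eq_zero h2]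
      · rw [abs_mul]
        calc _ ≤ (t * M * ‖x - y‖) * (3 * K * (1 / M)) :=
              mul_le_mul (abs_pow_mul_prodHat_sub_le hM l x y) (hpf l hl) (abs_nonneg _)
                (by positivity)
          _ = _ := by field_simp
    have b2 : |∑ l, M ^ t * prodHat l y * (p l x - p l y)| ≤ Λ * ‖x - y‖ := by
      have h0 : ∀ l, 0 ≤ (M : ℝ) ^ t * prodHat l y := fun l =>
        mul_nonneg (by positivity) (prodHat_mem hM l y).1
      calc _ ≤ ∑ l, |M ^ t * prodHat l y * (p l x - p l y)| := Finset.abs_sum_le_sum_abs _ _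
        _ ≤ ∑ l, M ^ t * prodHat l y * (Λ * ‖x - y‖) := by
            refine Finset.sum_le_sum fun l _ => ?_
            rw [abs_mul, abs_of_nonneg (h0 l)]
            exact mul_le_mul_of_nonneg_left (hpL l x hx y hy) (h0 l)
        _ = _ := by rw [← Finset.sum_mul, sum_pow_mul_prodHat hM hy, one_mul]
    rw [e]
    calc _ ≤ _ := abs_add_le _ _
      _ ≤ 2 * 2 ^ t * (3 * t * K * ‖x - y‖) + Λ * ‖x - y‖ := add_le_add b1 b2
      _ = (6 * t * 2 ^ t * K + Λ) * ‖x - y‖ := by ring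
      _ ≤ _ := by gcongr
  · have h1 := abs_sum_prodHat_mul_sub_le hM hβ0 hK hp hx
    have h2 := abs_sum_prodHat_mul_sub_le hM hβ0 hK hp hy
    have h3 : 1 / (M : ℝ) ≤ β * ‖x - y‖ := by
      rw [div_le_iff₀ (by positivity)] at h
      rw [div_le_iff₀ hM0]
      linarith
    have h4 : K * (1 / M) ^ β ≤ K * (β * ‖x - y‖) := by gcongr; exact hMβ.trans h3
    rw [abs_sub_comm] at h2
    calc _ = |(∑ l, M ^ t * prodHat l x * p l x - f x) + (f x - f y) +
          (f y - ∑ l, M ^ t * prodHat l y * p l y)| := by ring_nf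
      _ ≤ _ := abs_add_three _ _ _
      _ ≤ K * (β * ‖x - y‖) + (K + Λ) * ‖x - y‖ + K * (β * ‖x - y‖) :=
          add_le_add (add_le_add (h1.trans h4) (hfL x hx y hy)) (h2.trans h4)
      _ = ((2 * β + 1) * K + Λ) * ‖x - y‖ := by ring
      _ ≤ _ := by gcongr

end

/-! ### The approximating network -/

/-- A monomial as a product over sufficiently many slots. -/
lemma exists_slots {S : Type} [Fintype S] (γ : Fin t → ℕ) (hγ : ∑ j, γ j ≤ Fintype.card S) :
    ∃ u : S → Option (Fin t), (∀ z : Fin t → ℝ, ∏ σ, (u σ).elim 1 z = ∏ j, z j ^ γ j) ∧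
      ∀ z : Fin t → ℝ, ∑ σ, (u σ).elim 0 z = ∑ j, γ j * z j := by
  classical
  obtain ⟨e⟩ : Nonempty ((Σ j, Fin (γ j)) ↪ S) :=
    Function.Embedding.nonempty_of_card_le (by simpa using hγ)
  -- Unoccupied slots hold `none`, which counts as `1` in products and as `0` in sums.
  set u : S → Option (Fin t) := Function.extend e (fun p => some p.1) fun _ => none with hu
  have hcard : ∀ j, (Finset.univ.filter fun σ => u σ = some j).card = γ j := by
    intro j
    have : (Finset.univ.filter fun σ => u σ = some j) =
        Finset.univ.map ((Function.Embedding.sigmaMk j).trans e) := by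
      ext σ
      simp only [Finset.mem_filter, Finset.mem_univ, true_and, Finset.mem_map,
        Function.Embedding.trans_apply, Function.Embedding.sigmaMk_apply]
      constructor
      · intro h
        by_cases hσ : ∃ p, e p = σ
        · obtain ⟨⟨j', k⟩, rfl⟩ := hσ
          rw [hu, e.injective.extend_apply] at h
          obtain rfl : j' = j := by simpa using h
          exact ⟨k, rfl⟩
        · rw [hu, Function.extend_apply' _ _ _ hσ] at h
          simp at h
      · rintro ⟨k, rfl⟩
        rw [hu, e.injective.extend_apply]
    rw [this, Finset.card_map, Finset.card_univ, Fintype.card_fin]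
  refine ⟨u, fun z => ?_, fun z => ?_⟩
  · rw [← Finset.prod_fiberwise Finset.univ u, Fintype.prod_option]
    have h1 : ∏ σ ∈ Finset.univ.filter (fun σ => u σ = none), (u σ).elim 1 z = 1 :=
      Finset.prod_eq_one fun σ hσ => by rw [(Finset.mem_filter.1 hσ).2]; rfl
    rw [h1, one_mul]
    refine Finset.prod_congr rfl fun j _ => ?_
    rw [Finset.prod_congr rfl fun σ hσ => by rw [(Finset.mem_filter.1 hσ).2]]
    rw [Finset.prod_const, hcard]
    rfl
  · rw [← Finset.sum_fiberwise Finset.univ u, Fintype.sum_option]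
    have h1 : ∑ σ ∈ Finset.univ.filter (fun σ => u σ = none), (u σ).elim 0 z = 0 :=
      Finset.sum_eq_zero fun σ hσ => by rw [(Finset.mem_filter.1 hσ).2]; rfl
    rw [h1, zero_add]
    refine Finset.sum_congr rfl fun j _ => ?_
    rw [Finset.sum_congr rfl fun σ hσ => by rw [(Finset.mem_filter.1 hσ).2]]
    rw [Finset.sum_const, hcard, nsmul_eq_mul]
    rfl

/-- A chain that multiplies by a natural number. -/
lemma exists_amplifier_chain {w : ℕ} (k : ℕ) (hw : 2 * k ≤ w) (hw' : 2 ≤ w) :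
    ∃ f : (Bool → ℝ) → (Bool → ℝ), ReluChain w 2 (10 * k + 2) f ∧
      ∀ x : Bool → ℝ, (∀ b, 0 ≤ x b) → ∀ b, f x b = k * x b := by
  -- A factor `k` is not an admissible weight: each entry is copied `k` times and the copies are
  -- added.
  have h1 := ReluChain.dense (ι := Bool) (κ := Bool × Fin k) (w := w)
    (Matrix.of fun p b => if p.1 = b then 1 else 0) (fun _ => 0)
    (by intro p b; simp only [Matrix.of_apply]; split_ifs <;> simp) (by simp) (by simpa using hw)
    le_rfl
  have h2 := ReluChain.dense (ι := Bool × Fin k) (κ := Bool) (w := w)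
    (Matrix.of fun b p => if p.1 = b then 1 else 0) (fun _ => 0)
    (by intro p b; simp only [Matrix.of_apply]; split_ifs <;> simp) (by simp) (by simpa using hw')
    le_rfl
  refine ⟨_, (h2.comp h1).mono le_rfl ?_, fun x hx b => ?_⟩
  · simp only [Fintype.card_prod, Fintype.card_bool, Fintype.card_fin]
    omega
  · have e1 : layer (Matrix.of fun (p : Bool × Fin k) b => if p.1 = b then 1 else 0)
        (fun _ => 0) x = fun p => x p.1 := by
      funext p
      simp [layer, Matrix.mulVec, dotProduct, hx, ite_mul]
    rw [e1]
    have : 0 ≤ (k : ℝ) * x b := mul_nonneg (by positivity) (hx b)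
    simp [layer, Matrix.mulVec, dotProduct, Fintype.sum_prod_type, ite_mul]
    exact this

lemma exists_delayed_tree_chain (n : ℕ) {d D w : ℕ} (hd : d ≤ D) (hw : 5 * 2 ^ d ≤ 2 * w)
    (hw' : 1 ≤ w) : ∃ f : (Slot d → ℝ) → (Unit → ℝ),
      ReluChain w (D * (n + 3)) ((2 ^ d - 1) * ((n + 3) * 30) + D * (n + 3)) f ∧
      ∀ z : Slot d → ℝ, (∀ σ, z σ ∈ Set.Icc (0 : ℝ) 1) → f z () = treeApx (n + 1) d z := by
  obtain ⟨f, hf, hfe⟩ := exists_treeApx_chain n d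
  have h := (reluChain_delay (ι := Unit) (w := w) (by simpa using hw')
    ((D - d) * (n + 3))).comp (hf.mono (by omega) le_rfl)
  rw [← add_mul, Nat.add_sub_cancel' hd, Fintype.card_unit, mul_one] at h
  refine ⟨_, h.mono le_rfl (by gcongr; omega), fun z hz => ?_⟩
  have : f z = fun _ => treeApx (n + 1) d z := funext fun _ => hfe z hz
  rw [this, delay_eq]
  exact fun _ => (treeApx_mem _ _ hz).1

lemma exists_hat_chain (n : ℕ) {M d D w : ℕ} (hM : 1 ≤ M) (hd : d ≤ D) (hw : 5 * 2 ^ d ≤ 2 * w)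
    (u : Slot d → Option (Fin t)) : ∃ f : (Fin t × Bool → ℝ) → (Unit → ℝ),
      ReluChain w (1 + D * (n + 3))
        (2 ^ d * (2 * t + 1) + ((2 ^ d - 1) * ((n + 3) * 30) + D * (n + 3))) f ∧
      ∀ z : Fin t × Bool → ℝ, (∀ p, 0 ≤ z p) → f z () = treeApx (n + 1) d
        (fun σ => (u σ).elim 1 fun j => max (1 / M - (z (j, true) + z (j, false))) 0) := by
  classical
  have h2d : 1 ≤ 2 ^ d := Nat.one_le_two_pow
  obtain ⟨f, hf, hfe⟩ := exists_delayed_tree_chain n (w := w) hd hw (by omega)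
  have hM' : (1 : ℝ) ≤ M := by exact_mod_cast hM
  have hM1 : (M : ℝ)⁻¹ ≤ 1 := inv_le_one_of_one_le₀ hM'
  set W : Matrix (Slot d) (Fin t × Bool) ℝ := Matrix.of fun σ p => if u σ = some p.1 then -1 else 0
  -- The shift `-1/M` puts the top of the hat at `1/M`. At an empty slot the row of `W` is zero and
  -- the shift `-1` yields the constant `1`.
  set v : Slot d → ℝ := fun σ => if u σ = none then -1 else -(M : ℝ)⁻¹
  have h1 := ReluChain.dense (w := w) (s := 2 ^ d * (2 * t + 1)) W v
    (by intro σ p; simp only [W, Matrix.of_apply]; split_ifs <;> simp)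
    (by
      intro σ; simp only [v]; split_ifs
      · simp
      · rw [abs_neg, abs_of_nonneg (by positivity)]; exact hM1)
    (by rw [card_slot]; omega) (by simp [card_slot, mul_comm])
  refine ⟨_, hf.comp h1, fun z hz => ?_⟩
  have e1 : layer W v z =
      fun σ => (u σ).elim 1 fun j => max (1 / M - (z (j, true) + z (j, false))) 0 := by
    funext σ
    simp only [layer, Matrix.mulVec, dotProduct, W, v, Matrix.of_apply, ite_mul, zero_mul,
      Fintype.sum_prod_type]
    cases h : u σ with
    | none => simp
    | some j =>
      simp only [Option.some.injEq, reduceCtorEq, if_false, Option.elim_some]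
      rw [Finset.sum_eq_single j (fun b _ hb => by simp [hb.symm]) (by simp)]
      simp only [if_true, Fintype.sum_bool]
      congr 1
      ring
  rw [e1]
  refine hfe _ fun σ => ?_
  cases u σ with
  | none => simp
  | some j =>
    refine ⟨le_max_right _ _, max_le ?_ zero_le_one⟩
    have := hz (j, true)
    have := hz (j, false)
    rw [one_div]
    linarith

lemma exists_mono_chain (n : ℕ) {d D w : ℕ} (hd : d ≤ D) (hw : 5 * 2 ^ d ≤ 2 * w) :
    ∃ f : (Slot d → ℝ) → (Unit → ℝ),
      ReluChain w (1 + D * (n + 3)) (2 ^ d + ((2 ^ d - 1) * ((n + 3) * 30) + D * (n + 3))) f ∧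
      ∀ z : Slot d → ℝ, (∀ σ, z σ ∈ Set.Icc (0 : ℝ) 1) → f z () = treeApx (n + 1) d z := by
  have h2d : 1 ≤ 2 ^ d := Nat.one_le_two_pow
  obtain ⟨f, hf, hfe⟩ := exists_delayed_tree_chain n (w := w) hd hw (by omega)
  -- An idle layer, matching the layer in which `exists_hat_chain` forms the hats.
  have h1 := reluChain_delay (ι := Slot d) (w := w) (by rw [card_slot]; omega) 1
  rw [one_mul, card_slot] at h1
  refine ⟨_, hf.comp h1, fun z hz => ?_⟩
  rw [delay_eq 1 fun σ => (hz σ).1, hfe z hz]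

/-- The approximate product of hat functions around a grid point. -/
noncomputable def hatApx {M : ℕ} (n d : ℕ) (u : Slot d → Option (Fin t))
    (l : Fin t → Fin (M + 1)) (x : Fin t → ℝ) : ℝ :=
  treeApx n d fun σ => (u σ).elim 1 fun j => hat M (l j) (x j)

/-- The approximate monomial with the factors listed in `v`. -/
noncomputable def monoApx (n d : ℕ) (v : Slot d → Option (Fin t)) (x : Fin t → ℝ) : ℝ :=
  treeApx n d fun σ => (v σ).elim 1 x

lemma elim_mem_Icc {z : Fin t → ℝ} (hz : ∀ j, z j ∈ Set.Icc (0 : ℝ) 1) (o : Option (Fin t)) :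
    o.elim 1 z ∈ Set.Icc (0 : ℝ) 1 := by
  cases o with
  | none => simp
  | some j => exact hz j

lemma hatApx_mem {M : ℕ} (hM : 1 ≤ M) (n d : ℕ) (u : Slot d → Option (Fin t))
    (l : Fin t → Fin (M + 1)) (x : Fin t → ℝ) : hatApx n d u l x ∈ Set.Icc (0 : ℝ) 1 :=
  treeApx_mem n d fun σ => elim_mem_Icc (fun _ => hat_mem hM _ _) (u σ)

lemma monoApx_mem (n d : ℕ) (v : Slot d → Option (Fin t)) {x : Fin t → ℝ} (hx : x ∈ unitCube t) :
    monoApx n d v x ∈ Set.Icc (0 : ℝ) 1 :=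
  treeApx_mem n d fun σ => elim_mem_Icc (fun j => ⟨hx.1 j, hx.2 j⟩) (v σ)

/-- The sign encoded by a truth value. -/
def sgn (b : Bool) : ℝ := if b then 1 else -1

lemma abs_sgn (b : Bool) : |sgn b| = 1 := by cases b <;> simp [sgn]

section

variable {M dt dq : ℕ} {Γ : Type} [Fintype Γ]

/-- The chain computing the positive and negative parts of the local polynomials next to the
approximate hat functions. -/
lemma exists_front_chain (n : ℕ) {D w₁ w₂ w : ℕ} (hM : 1 ≤ M) (hdt : dt ≤ D) (hdq : dq ≤ D)
    (hw₁ : 5 * 2 ^ dt ≤ 2 * w₁) (hw₁' : 2 * t ≤ w₁) (hw₂ : 5 * 2 ^ dq ≤ 2 * w₂)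
    (hw : (M + 1) ^ t * w₁ + Fintype.card Γ * w₂ ≤ w) (hw' : 4 * (M + 1) ^ t ≤ w)
    (u : Slot dt → Option (Fin t)) (v : Γ → Slot dq → Option (Fin t))
    (c : (Fin t → Fin (M + 1)) → Γ → ℝ) (hc : ∀ l γ, |c l γ| ≤ 1) :
    ∃ f : (Fin t → ℝ) → ((((Fin t → Fin (M + 1)) × Bool) × (Bool × Unit)) → ℝ),
      ReluChain w (3 + D * (n + 3))
        (((M + 1) ^ t * (2 * t) + Fintype.card Γ * 2 ^ dq) * (t + 1) +
          ((M + 1) ^ t *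
            (2 ^ dt * (2 * t + 1) + ((2 ^ dt - 1) * ((n + 3) * 30) + D * (n + 3))) +
          Fintype.card Γ * (2 ^ dq + ((2 ^ dq - 1) * ((n + 3) * 30) + D * (n + 3)))) +
          2 * (M + 1) ^ t * (Fintype.card Γ + 1)) f ∧
      ∀ x ∈ unitCube t, ∀ l b,
        f x ((l, b), (false, ())) = max (sgn b * ∑ γ, c l γ * monoApx (n + 1) dq (v γ) x) 0 ∧
        f x ((l, b), (true, ())) = hatApx (n + 1) dt u l x := by
  classical
  have hM' : (0 : ℝ) < M := by exact_mod_cast hM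
  obtain ⟨fH, hfH, hfHe⟩ := exists_hat_chain n hM hdt hw₁ u
  obtain ⟨fG, hfG, hfGe⟩ := exists_mono_chain n hdq hw₂
  have hcard : Fintype.card (Fin t → Fin (M + 1)) = (M + 1) ^ t := by simp
  have hpar := ((hfH.copies (Fin t → Fin (M + 1))).parallel (hfG.copies Γ)).mono
    (w' := w) (by rw [hcard]; exact hw) le_rfl
  rw [hcard] at hpar
  -- The first layer supplies the positive and negative parts of `x_j - l_j/M`, whose sum is the
  -- absolute value in the hat, and the factors of all monomials.
  set W₁ : Matrix (((Fin t → Fin (M + 1)) × (Fin t × Bool)) ⊕ (Γ × Slot dq)) (Fin t) ℝ :=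
    Matrix.of fun i j => Sum.elim (fun p => if p.2.1 = j then sgn p.2.2 else 0)
      (fun r => if v r.1 r.2 = some j then 1 else 0) i with hW₁
  set v₁ : (((Fin t → Fin (M + 1)) × (Fin t × Bool)) ⊕ (Γ × Slot dq)) → ℝ :=
    Sum.elim (fun p => sgn p.2.2 * node p.1 p.2.1)
      (fun r => if v r.1 r.2 = none then -1 else 0) with hv₁
  have hfirst := ReluChain.dense (w := w)
    (s := ((M + 1) ^ t * (2 * t) + Fintype.card Γ * 2 ^ dq) * (t + 1)) W₁ v₁
    (by
      rintro (p | r) j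
      · simp only [hW₁, Matrix.of_apply, Sum.elim_inl]; split_ifs <;> simp [abs_sgn]
      · simp only [hW₁, Matrix.of_apply, Sum.elim_inr]; split_ifs <;> simp)
    (by
      rintro (p | r)
      · have h := node_mem hM p.1
        simp only [hv₁, Sum.elim_inl, abs_mul, abs_sgn, one_mul]
        rw [abs_of_nonneg (h.1 _)]
        exact h.2 _
      · simp only [hv₁, Sum.elim_inr]; split_ifs <;> simp)
    (by
      simp only [Fintype.card_sum, Fintype.card_prod, hcard, Fintype.card_fin, Fintype.card_bool,
        card_slot]
      refine le_trans ?_ hw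
      gcongr
      · omega
      · omega)
    (by
      simp only [Fintype.card_sum, Fintype.card_prod, hcard, Fintype.card_fin, Fintype.card_bool,
        card_slot]
      rw [mul_comm t 2])
  have hfirst_eval : ∀ x ∈ unitCube t, layer W₁ v₁ x = Sum.elim
      (fun p => max (sgn p.2.2 * (x p.2.1 - node p.1 p.2.1)) 0)
      (fun r => (v r.1 r.2).elim 1 x) := by
    intro x hx
    funext i
    rcases i with p | r
    · simp [layer, Matrix.mulVec, dotProduct, hW₁, hv₁, ite_mul, mul_sub]
    · simp only [layer, Matrix.mulVec, dotProduct, hW₁, hv₁, Matrix.of_apply, Sum.elim_inr]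
      cases v r.1 r.2 with
      | none => simp
      | some j => simpa [ite_mul] using hx.1 j
  set W₃ : Matrix (((Fin t → Fin (M + 1)) × Bool) × (Bool × Unit))
      (((Fin t → Fin (M + 1)) × Unit) ⊕ (Γ × Unit)) ℝ :=
    Matrix.of fun i j => if i.2.1 then Sum.elim (fun p => if i.1.1 = p.1 then 1 else 0) (fun _ => 0) j
      else Sum.elim (fun _ => 0) (fun r => sgn i.1.2 * c i.1.1 r.1) j with hW₃
  -- A dense count would be quadratic in `(M+1)^t`. Rows that forward a hat product have one nonzero
  -- entry, and rows that form a polynomial read only the monomials shared by all grid points.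
  have hnnz : nnz W₃ ≤ 2 * (M + 1) ^ t * (Fintype.card Γ + 1) := by
    have h1 : ∀ (l : Fin t → Fin (M + 1)) (b : Bool), nnzVec (W₃ ((l, b), (true, ()))) = 1 := by
      intro l b
      simp only [nnzVec, hW₃, Matrix.of_apply, if_true, Fintype.sum_sum_type, Sum.elim_inl,
        Sum.elim_inr, apply_ite nz, nz_one, nz_zero, Fintype.sum_prod_type]
      simp only [Finset.univ_unique, Finset.sum_singleton, Finset.sum_const_zero, add_zero]
      rw [Finset.sum_ite_eq]
      simp
    have h2 : ∀ (l : Fin t → Fin (M + 1)) (b : Bool),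
        nnzVec (W₃ ((l, b), (false, ()))) ≤ Fintype.card Γ := by
      intro l b
      simp only [nnzVec, hW₃, Fintype.sum_sum_type, Fintype.sum_prod_type, Matrix.of_apply]
      simp only [Bool.false_eq_true, if_false, Sum.elim_inl, nz_zero, Finset.sum_const_zero,
        zero_add, Sum.elim_inr, Finset.univ_unique, Finset.sum_singleton]
      exact nnzVec_le_card (fun γ => sgn b * c l γ)
    have h3 : nnz W₃ = ∑ p : (Fin t → Fin (M + 1)) × Bool, (nnzVec (W₃ (p, (true, ()))) +
        nnzVec (W₃ (p, (false, ())))) := by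
      rw [nnz, Fintype.sum_prod_type]
      refine Finset.sum_congr rfl fun p _ => ?_
      rw [Fintype.sum_prod_type, Fintype.sum_bool]
      simp
    rw [h3]
    refine (Finset.sum_le_card_nsmul _ _ (Fintype.card Γ + 1) fun p _ => ?_).trans ?_
    · obtain ⟨l, b⟩ := p
      rw [h1, add_comm]
      exact Nat.add_le_add_right (h2 l b) 1
    · rw [Finset.card_univ, Fintype.card_prod, hcard, Fintype.card_bool, smul_eq_mul, mul_comm 2]
  have hlast := ReluChain.single (w := w) (s := 2 * (M + 1) ^ t * (Fintype.card Γ + 1))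
    W₃ (fun _ => 0)
    (by
      rintro ⟨⟨l, b⟩, ⟨_ | _, _⟩⟩ (p | r)
      · simp [hW₃]
      · simpa [hW₃, abs_mul, abs_sgn] using hc l r.1
      · simp only [hW₃, Matrix.of_apply, if_true, Sum.elim_inl]; split_ifs <;> simp
      · simp [hW₃])
    (by simp)
    (by
      simp only [Fintype.card_prod, hcard, Fintype.card_bool, Fintype.card_unit]
      omega)
    (by rw [nnzVec_zero]; exact hnnz)
  have h := hlast.comp (hpar.comp hfirst)
  rw [show 1 + (1 + D * (n + 3)) + 1 = 3 + D * (n + 3) by ring] at h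
  refine ⟨_, h, fun x hx l b => ?_⟩
  beta_reduce
  rw [hfirst_eval x hx]
  simp only [Sum.elim_inl, Sum.elim_inr]
  have eG : ∀ γ : Γ, fG (fun i => (v γ i).elim 1 x) () = monoApx (n + 1) dq (v γ) x :=
    fun γ => hfGe _ fun σ => elim_mem_Icc (fun j => ⟨hx.1 j, hx.2 j⟩) _
  have eH : ∀ l : Fin t → Fin (M + 1),
      fH (fun i => max (sgn i.2 * (x i.1 - node l i.1)) 0) () = hatApx (n + 1) dt u l x := by
    intro l
    rw [hfHe _ fun p => le_max_right _ _, hatApx]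
    congr 2
    funext σ
    congr 1
    funext j
    rw [hat]
    congr 2
    simp only [sgn, if_true, Bool.false_eq_true, if_false, node]
    rcases le_total (x j) (l j / M) with h | h
    · rw [max_eq_right (by linarith), max_eq_left (by linarith), abs_of_nonpos (by linarith)]; ring
    · rw [max_eq_left (by linarith), max_eq_right (by linarith), abs_of_nonneg (by linarith)]; ring
  constructor
  · simp [layer, Matrix.mulVec, dotProduct, hW₃, Fintype.sum_prod_type, eG, Finset.mul_sum, mul_assoc]
  · have := (hatApx_mem hM (n + 1) dt u l x).1
    simp [layer, Matrix.mulVec, dotProduct, hW₃, Fintype.sum_prod_type, eH, ite_mul, this]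

/-- The chain computing the positive and the negative part of the rescaled approximation. -/
lemma exists_approx_chain (n B : ℕ) {D w₁ w₂ w : ℕ} (hM : 1 ≤ M) (hdt : dt ≤ D) (hdq : dq ≤ D)
    (hw₁ : 5 * 2 ^ dt ≤ 2 * w₁) (hw₁' : 2 * t ≤ w₁) (hw₂ : 5 * 2 ^ dq ≤ 2 * w₂)
    (hw : (M + 1) ^ t * w₁ + Fintype.card Γ * w₂ ≤ w) (hw' : 10 * (M + 1) ^ t ≤ w)
    (hB : 2 * B ≤ w)
    (u : Slot dt → Option (Fin t)) (v : Γ → Slot dq → Option (Fin t))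
    (c : (Fin t → Fin (M + 1)) → Γ → ℝ) (hc : ∀ l γ, |c l γ| ≤ 1)
    (hc' : ∀ l, ∑ γ, |c l γ| ≤ 1) :
    ∃ f : (Fin t → ℝ) → (Bool → ℝ),
      ReluChain w (8 + (n + 3) * (1 + D))
        (((M + 1) ^ t * (2 * t) + Fintype.card Γ * 2 ^ dq) * (t + 1) +
          ((M + 1) ^ t *
            (2 ^ dt * (2 * t + 1) + ((2 ^ dt - 1) * ((n + 3) * 30) + D * (n + 3))) +
          Fintype.card Γ * (2 ^ dq + ((2 ^ dq - 1) * ((n + 3) * 30) + D * (n + 3)))) +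
          2 * (M + 1) ^ t * (Fintype.card Γ + 1) + 2 * (M + 1) ^ t * ((n + 3) * 30) +
          2 * (M + 1) ^ t + (10 * (M + 1) ^ t + 2) + (10 * B + 2)) f ∧
      ∀ x ∈ unitCube t, ∀ b, f x b = B * (M ^ t * ∑ l : Fin t → Fin (M + 1), mulApx (n + 1)
        (max (sgn b * ∑ γ, c l γ * monoApx (n + 1) dq (v γ) x) 0) (hatApx (n + 1) dt u l x)) := by
  classical
  have hMp : 1 ≤ (M + 1) ^ t := Nat.one_le_pow _ _ (Nat.succ_pos _)
  have hMM : M ^ t ≤ (M + 1) ^ t := Nat.pow_le_pow_left (Nat.le_succ M) t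
  have hcard : Fintype.card (Fin t → Fin (M + 1)) = (M + 1) ^ t := by simp
  obtain ⟨f₁, h₁, e₁⟩ := exists_front_chain n hM hdt hdq hw₁ hw₁' hw₂ hw (by omega) u v c hc
  obtain ⟨f₂, h₂, e₂⟩ := exists_mulApx_chain n
  have hcopies := (h₂.copies ((Fin t → Fin (M + 1)) × Bool)).mono (w' := w)
    (s' := 2 * (M + 1) ^ t * ((n + 3) * 30))
    (by rw [Fintype.card_prod, hcard, Fintype.card_bool]; omega)
    (by rw [Fintype.card_prod, hcard, Fintype.card_bool, mul_comm 2])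
  set W : Matrix Bool (((Fin t → Fin (M + 1)) × Bool) × Unit) ℝ :=
    Matrix.of fun b p => if b = p.1.2 then 1 else 0 with hW
  have hsum := ReluChain.single (w := w) (s := 2 * (M + 1) ^ t) W (fun _ => 0)
    (by intro b p; simp only [hW, Matrix.of_apply]; split_ifs <;> simp) (by simp)
    (by rw [Fintype.card_bool]; omega)
    (by
      rw [nnzVec_zero, add_zero, nnz]
      refine le_of_eq ?_
      simp only [nnzVec, hW, Matrix.of_apply, Fintype.sum_prod_type, apply_ite nz, nz_one, nz_zero,
        Finset.univ_unique, Finset.sum_singleton, Finset.sum_ite_eq, Finset.mem_univ, if_true,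
        Finset.sum_const, Finset.card_univ, hcard, Fintype.card_bool]
      simp)
  obtain ⟨f₃, h₃, e₃⟩ := exists_amplifier_chain (w := w) (M ^ t) (by omega) (by omega)
  obtain ⟨f₄, h₄, e₄⟩ := exists_amplifier_chain (w := w) B hB (by omega)
  have h := h₄.comp (h₃.comp (hsum.comp (hcopies.comp h₁)))
  rw [show 3 + D * (n + 3) + (n + 3) + 1 + 2 + 2 = 8 + (n + 3) * (1 + D) by ring] at h
  refine ⟨_, h.mono le_rfl (by omega), fun x hx b => ?_⟩
  -- The normalization `hc'` keeps the polynomials in `[-1,1]`, so the multiplication chain receives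
  -- inputs in its range `[0,1]`.
  have hin : ∀ (l : Fin t → Fin (M + 1)) (b : Bool) (p : Bool × Unit),
      f₁ x ((l, b), p) ∈ Set.Icc (0 : ℝ) 1 := by
    rintro l b ⟨_ | _, _⟩
    · rw [(e₁ x hx l b).1]
      refine ⟨le_max_right _ _, max_le ((le_abs_self _).trans ?_) zero_le_one⟩
      rw [abs_mul, abs_sgn, one_mul]
      refine (Finset.abs_sum_le_sum_abs _ _).trans ((Finset.sum_le_sum fun γ _ => ?_).trans (hc' l))
      have := monoApx_mem (n + 1) dq (v γ) hx
      rw [abs_mul, abs_of_nonneg this.1]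
      exact mul_le_of_le_one_right (abs_nonneg _) this.2
    · rw [(e₁ x hx l b).2]
      exact hatApx_mem hM _ _ _ _ _
  have hval : ∀ (l : Fin t → Fin (M + 1)) (b : Bool), f₂ (fun i => f₁ x ((l, b), i)) () =
      mulApx (n + 1) (max (sgn b * ∑ γ, c l γ * monoApx (n + 1) dq (v γ) x) 0)
        (hatApx (n + 1) dt u l x) := by
    intro l b
    rw [e₂ _ (hin l b), (e₁ x hx l b).1, (e₁ x hx l b).2]
  have hpos : ∀ (l : Fin t → Fin (M + 1)) (b : Bool), 0 ≤ mulApx (n + 1)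
      (max (sgn b * ∑ γ, c l γ * monoApx (n + 1) dq (v γ) x) 0) (hatApx (n + 1) dt u l x) := by
    intro l b
    have h1 := hin l b (false, ())
    have h2 := hin l b (true, ())
    rw [(e₁ x hx l b).1] at h1
    rw [(e₁ x hx l b).2] at h2
    exact (mulApx_mem h1 h2).1
  have esum : layer W (fun _ => 0) (fun p : ((Fin t → Fin (M + 1)) × Bool) × Unit =>
      f₂ (fun i => f₁ x (p.1, i)) p.2) = fun b => ∑ l : Fin t → Fin (M + 1), mulApx (n + 1)
        (max (sgn b * ∑ γ, c l γ * monoApx (n + 1) dq (v γ) x) 0)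
        (hatApx (n + 1) dt u l x) := by
    funext b
    simp only [layer, Matrix.mulVec, dotProduct, hW, Matrix.of_apply, Fintype.sum_prod_type,
      ite_mul, one_mul, zero_mul, Finset.univ_unique, Finset.sum_singleton, Finset.sum_ite_eq,
      Finset.mem_univ, if_true, sub_zero]
    rw [max_eq_left]
    · exact Finset.sum_congr rfl fun l _ => hval l b
    · exact Finset.sum_nonneg fun l _ => (hval l b).symm ▸ hpos l b
  have e5 : ∀ b, f₃ (fun b => ∑ l : Fin t → Fin (M + 1), mulApx (n + 1)
        (max (sgn b * ∑ γ, c l γ * monoApx (n + 1) dq (v γ) x) 0)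
        (hatApx (n + 1) dt u l x)) b = (M : ℝ) ^ t * ∑ l : Fin t → Fin (M + 1), mulApx (n + 1)
        (max (sgn b * ∑ γ, c l γ * monoApx (n + 1) dq (v γ) x) 0)
        (hatApx (n + 1) dt u l x) := by
    intro b
    rw [e₃ _ (fun b => Finset.sum_nonneg fun l _ => hpos l b)]
    push_cast
    rfl
  rw [esum, e₄, e5]
  intro b
  rw [e5]
  exact mul_nonneg (by positivity) (Finset.sum_nonneg fun l _ => hpos l b)

end

/-! ### Error analysis -/

/-- The slot assignment `u` lists every coordinate `j` with multiplicity `γ j`. -/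
structure Lists {S : Type} [Fintype S] (u : S → Option (Fin t)) (γ : Fin t → ℕ) : Prop where
  prod_eq : ∀ z : Fin t → ℝ, ∏ σ, (u σ).elim 1 z = ∏ j, z j ^ γ j
  sum_eq : ∀ z : Fin t → ℝ, ∑ σ, (u σ).elim 0 z = ∑ j, γ j * z j

lemma abs_elim_sub_elim (o : Option (Fin t)) (z z' : Fin t → ℝ) :
    |o.elim 1 z - o.elim 1 z'| = o.elim 0 fun j => |z j - z' j| := by
  cases o <;> simp

section slots

variable {n d r : ℕ} {γ : Fin t → ℕ} {v : Slot d → Option (Fin t)} {z z' : Fin t → ℝ} {Δ : ℝ}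

lemma abs_tree_elim_sub_le (hv : Lists v γ) (hz : ∀ j, z j ∈ Set.Icc (0 : ℝ) 1) :
    |treeApx n d (fun σ => (v σ).elim 1 z) - ∏ j, z j ^ γ j| ≤ 2 ^ d * (2 ^ n)⁻¹ := by
  rw [← hv.prod_eq]
  refine (abs_treeApx_sub_prod_le n d fun σ => elim_mem_Icc hz (v σ)).trans ?_
  gcongr
  linarith

lemma sum_abs_elim_sub_le {S : Type} [Fintype S] {v : S → Option (Fin t)} (hv : Lists v γ)
    (hr : ∑ j, γ j ≤ r) (hΔ : ∀ j, |z j - z' j| ≤ Δ) (hΔ0 : 0 ≤ Δ) : ∑ σ, |(v σ).elim 1 z - (v σ).elim 1 z'| ≤ r * Δ := by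
  simp only [abs_elim_sub_elim]
  rw [hv.sum_eq]
  calc ∑ j, (γ j : ℝ) * |z j - z' j| ≤ ∑ j, (γ j : ℝ) * Δ := by gcongr; exact hΔ _
    _ = (∑ j, γ j : ℕ) * Δ := by rw [← Finset.sum_mul]; push_cast; rfl
    _ ≤ r * Δ := by gcongr

lemma abs_prod_pow_sub_le (hr : ∑ j, γ j ≤ r)
    (hz : ∀ j, z j ∈ Set.Icc (0 : ℝ) 1) (hz' : ∀ j, z' j ∈ Set.Icc (0 : ℝ) 1)
    (hΔ : ∀ j, |z j - z' j| ≤ Δ) (hΔ0 : 0 ≤ Δ) :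
    |∏ j, z j ^ γ j - ∏ j, z' j ^ γ j| ≤ r * Δ := by
  obtain ⟨v, hv₁, hv₂⟩ := exists_slots (S := Fin r) γ (by simpa using hr)
  rw [← hv₁, ← hv₁]
  have h01 : ∀ {x : ℝ}, x ∈ Set.Icc (0 : ℝ) 1 → |x| ≤ 1 := fun h =>
    abs_le.2 ⟨by linarith [h.1], h.2⟩
  exact (abs_prod_sub_prod_le (fun σ _ => h01 (elim_mem_Icc hz _))
    fun σ _ => h01 (elim_mem_Icc hz' _)).trans (sum_abs_elim_sub_le ⟨hv₁, hv₂⟩ hr hΔ hΔ0)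

lemma abs_tree_elim_sub_sub_le (hd : (4 : ℝ) ^ d * (2 ^ n)⁻¹ ≤ 1) (hv : Lists v γ)
    (hr : ∑ j, γ j ≤ r) (hz : ∀ j, z j ∈ Set.Icc (0 : ℝ) 1) (hz' : ∀ j, z' j ∈ Set.Icc (0 : ℝ) 1)
    (hΔ : ∀ j, |z j - z' j| ≤ Δ) (hΔ0 : 0 ≤ Δ) :
    |(treeApx n d (fun σ => (v σ).elim 1 z) - ∏ j, z j ^ γ j) -
      (treeApx n d (fun σ => (v σ).elim 1 z') - ∏ j, z' j ^ γ j)| ≤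
        4 ^ d * (2 ^ n)⁻¹ * (r * Δ) := by
  rw [← hv.prod_eq, ← hv.prod_eq]
  refine (abs_treeApx_sub_prod_sub_le n d hd (fun σ => elim_mem_Icc hz (v σ))
    fun σ => elim_mem_Icc hz' (v σ)).trans ?_
  gcongr
  exact sum_abs_elim_sub_le hv hr hΔ hΔ0

lemma abs_tree_elim_sub_tree_elim_le (hd : (4 : ℝ) ^ d * (2 ^ n)⁻¹ ≤ 1) (hv : Lists v γ)
    (hr : ∑ j, γ j ≤ r) (hz : ∀ j, z j ∈ Set.Icc (0 : ℝ) 1) (hz' : ∀ j, z' j ∈ Set.Icc (0 : ℝ) 1)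
    (hΔ : ∀ j, |z j - z' j| ≤ Δ) (hΔ0 : 0 ≤ Δ) :
    |treeApx n d (fun σ => (v σ).elim 1 z) - treeApx n d (fun σ => (v σ).elim 1 z')| ≤
      2 * (r * Δ) := by
  have h1 := abs_tree_elim_sub_sub_le hd hv hr hz hz' hΔ hΔ0
  have h2 := abs_prod_pow_sub_le hr hz hz' hΔ hΔ0
  have h3 := mul_le_mul_of_nonneg_right hd (by positivity : 0 ≤ r * Δ)
  rw [abs_le] at *
  constructor <;> linarith [h1.1, h1.2, h2.1, h2.2]

end slots

/-- The error of the approximate product of a signed number and a hat function. -/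
noncomputable def splitErr (n : ℕ) (p b a h : ℝ) : ℝ :=
  mulApx n (max p 0) b - mulApx n (max (-p) 0) b - a * h

lemma max_mem_Icc {p : ℝ} (hp : |p| ≤ 1) : max p 0 ∈ Set.Icc (0 : ℝ) 1 :=
  ⟨le_max_right _ _, max_le ((le_abs_self p).trans hp) zero_le_one⟩

/-- Separates the two errors of `mulApx` from the errors of the polynomial and of the hat product,
so that each can be bounded in size and in increment. -/
lemma splitErr_eq (n : ℕ) (p b a h : ℝ) : splitErr n p b a h =
    (mulApx n (max p 0) b - max p 0 * b) - (mulApx n (max (-p) 0) b - max (-p) 0 * b) +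
      (p - a) * b + a * (b - h) := by
  have : max p 0 - max (-p) 0 = p := by
    rcases le_total p 0 with h | h
    · rw [max_eq_right h, max_eq_left (by linarith)]; ring
    · rw [max_eq_left h, max_eq_right (by linarith)]; ring
  rw [splitErr]
  linear_combination b * this

lemma abs_splitErr_le (n : ℕ) {p b a h : ℝ} (hp : |p| ≤ 1) (hb : b ∈ Set.Icc (0 : ℝ) 1)
    (ha : |a| ≤ 1) : |splitErr n p b a h| ≤ 2 * (2 ^ n)⁻¹ + |p - a| + |b - h| := by
  have h1 := abs_mulApx_sub_mul_le (n := n) (max_mem_Icc hp) hb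
  have h2 := abs_mulApx_sub_mul_le (n := n) (max_mem_Icc (p := -p) (by rwa [abs_neg])) hb
  have h3 : |(p - a) * b| ≤ |p - a| := by
    rw [abs_mul, abs_of_nonneg hb.1]; exact mul_le_of_le_one_right (abs_nonneg _) hb.2
  have h4 : |a * (b - h)| ≤ |b - h| := by
    rw [abs_mul]; exact mul_le_of_le_one_left (abs_nonneg _) ha
  rw [splitErr_eq]
  have h5 := abs_sub (mulApx n (max p 0) b - max p 0 * b)
    (mulApx n (max (-p) 0) b - max (-p) 0 * b)
  exact (abs_add_three _ _ _).trans (by linarith)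

lemma abs_splitErr_sub_le (n : ℕ) {p b a h p' b' a' h' : ℝ} (hp : |p| ≤ 1)
    (hb : b ∈ Set.Icc (0 : ℝ) 1) (hp' : |p'| ≤ 1) (hb' : b' ∈ Set.Icc (0 : ℝ) 1) (ha' : |a'| ≤ 1) :
    |splitErr n p b a h - splitErr n p' b' a' h'| ≤ 2 * (2 ^ n)⁻¹ * (|p - p'| + |b - b'|) +
      (|(p - a) - (p' - a')| + |p' - a'| * |b - b'|) +
      (|a - a'| * |b - h| + |(b - h) - (b' - h')|) := by
  have h1 := abs_mulApx_sub_mul_sub_le (n := n) (max_mem_Icc hp) hb (max_mem_Icc hp') hb'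
  have h2 := abs_mulApx_sub_mul_sub_le (n := n) (max_mem_Icc (p := -p) (by rwa [abs_neg])) hb
    (max_mem_Icc (p := -p') (by rwa [abs_neg])) hb'
  have m1 : |max p 0 - max p' 0| ≤ |p - p'| := abs_max_sub_max_le_abs _ _ _
  have m2 : |max (-p) 0 - max (-p') 0| ≤ |p - p'| :=
    (abs_max_sub_max_le_abs _ _ _).trans (by rw [neg_sub_neg, abs_sub_comm])
  have hη : (0 : ℝ) ≤ (2 ^ n)⁻¹ := by positivity
  have k1 := mul_le_mul_of_nonneg_left m1 hη
  have k2 := mul_le_mul_of_nonneg_left m2 hη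
  have h3 : |((p - a) - (p' - a')) * b| ≤ |(p - a) - (p' - a')| := by
    rw [abs_mul, abs_of_nonneg hb.1]; exact mul_le_of_le_one_right (abs_nonneg _) hb.2
  have h4 : |a' * ((b - h) - (b' - h'))| ≤ |(b - h) - (b' - h')| := by
    rw [abs_mul]; exact mul_le_of_le_one_left (abs_nonneg _) ha'
  have h5 : |(p' - a') * (b - b')| = |p' - a'| * |b - b'| := abs_mul _ _
  have h6 : |(a - a') * (b - h)| = |a - a'| * |b - h| := abs_mul _ _
  rw [splitErr_eq, splitErr_eq]
  generalize mulApx n (max p 0) b - max p 0 * b = e₁ at *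
  generalize mulApx n (max p' 0) b' - max p' 0 * b' = e₁' at *
  generalize mulApx n (max (-p) 0) b - max (-p) 0 * b = e₂ at *
  generalize mulApx n (max (-p') 0) b' - max (-p') 0 * b' = e₂' at *
  calc _ = |((e₁ - e₁') - (e₂ - e₂')) + (((p - a) - (p' - a')) * b + (p' - a') * (b - b')) +
        ((a - a') * (b - h) + a' * ((b - h) - (b' - h')))| := by ring_nf
    _ ≤ _ := abs_add_three _ _ _
    _ ≤ _ := by
      have := abs_sub (e₁ - e₁') (e₂ - e₂')
      have := abs_add_le (((p - a) - (p' - a')) * b) ((p' - a') * (b - b'))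
      have := abs_add_le ((a - a') * (b - h)) (a' * ((b - h) - (b' - h')))
      linarith

/-- A linear combination with absolutely summable coefficients inherits bounds. -/
lemma abs_sum_mul_le {ι : Type*} {s : Finset ι} {c F : ι → ℝ} {A ε : ℝ}
    (hc : ∑ i ∈ s, |c i| ≤ A) (hF : ∀ i ∈ s, |F i| ≤ ε) (hε : 0 ≤ ε) :
    |∑ i ∈ s, c i * F i| ≤ A * ε := by
  calc |∑ i ∈ s, c i * F i| ≤ ∑ i ∈ s, |c i * F i| := Finset.abs_sum_le_sum_abs _ _
    _ ≤ ∑ i ∈ s, |c i| * ε := Finset.sum_le_sum fun i hi => by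
        rw [abs_mul]; exact mul_le_mul_of_nonneg_left (hF i hi) (abs_nonneg _)
    _ = (∑ i ∈ s, |c i|) * ε := by rw [Finset.sum_mul]
    _ ≤ _ := by gcongr

section

variable {M dt dq q n : ℕ} {u : Slot dt → Option (Fin t)}
  {v : monoIdx t q → Slot dq → Option (Fin t)} {c : monoIdx t q → ℝ}
  {l : Fin t → Fin (M + 1)} {x y : Fin t → ℝ}

/-- The error of a single local term. -/
noncomputable def localErr (n : ℕ) (u : Slot dt → Option (Fin t))
    (v : monoIdx t q → Slot dq → Option (Fin t)) (c : monoIdx t q → ℝ)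
    (l : Fin t → Fin (M + 1)) (x : Fin t → ℝ) : ℝ :=
  splitErr n (∑ γ, c γ * monoApx n dq (v γ) x) (hatApx n dt u l x)
    (∑ γ, c γ * ∏ j, x j ^ γ.1 j) (prodHat l x)

lemma prodHat_eq_prod_pow (l : Fin t → Fin (M + 1)) (x : Fin t → ℝ) :
    prodHat l x = ∏ j, hat M (l j) (x j) ^ ((fun _ => 1 : Fin t → ℕ) j) := by
  simp [prodHat]

lemma mem_Icc_of_mem_unitCube (hx : x ∈ unitCube t) (j : Fin t) : x j ∈ Set.Icc (0 : ℝ) 1 :=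
  ⟨hx.1 j, hx.2 j⟩

lemma abs_monomial_le (γ : Fin t → ℕ) (hx : x ∈ unitCube t) : |∏ j, x j ^ γ j| ≤ 1 :=
  abs_prod_le_one fun j _ => by
    rw [abs_pow]
    exact pow_le_one₀ (abs_nonneg _) (abs_le.2 ⟨by linarith [(mem_Icc_of_mem_unitCube hx j).1],
      (mem_Icc_of_mem_unitCube hx j).2⟩)

lemma abs_poly_le (hc : ∑ γ, |c γ| ≤ 1) (hx : x ∈ unitCube t) :
    |∑ γ, c γ * ∏ j, x j ^ γ.1 j| ≤ 1 :=
  (abs_sum_mul_le hc (fun γ _ => abs_monomial_le γ.1 hx) zero_le_one).trans (by simp)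

lemma abs_polyApx_le (hc : ∑ γ, |c γ| ≤ 1) (hx : x ∈ unitCube t) :
    |∑ γ, c γ * monoApx n dq (v γ) x| ≤ 1 :=
  (abs_sum_mul_le hc (fun γ _ => by
    have := monoApx_mem n dq (v γ) hx
    rw [abs_of_nonneg this.1]; exact this.2) zero_le_one).trans (by simp)

/-- A vanishing hat occupies some slot of the tree, and `treeApx` is exactly zero when a leaf is
zero. -/
lemma localErr_eq_zero (hu : Lists u fun _ => 1) (hM : 1 ≤ M)
    (hl : l ∉ active M x) : localErr n u v c l x = 0 := by
  have h1 : hatApx n dt u l x = 0 := by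
    refine treeApx_eq_zero n dt (fun σ => elim_mem_Icc (fun _ => hat_mem hM _ _) (u σ)) ?_
    have h2 := hu.prod_eq fun j => hat M (l j) (x j)
    rw [← prodHat_eq_prod_pow, prodHat_eq_zero hl, Finset.prod_eq_zero_iff] at h2
    obtain ⟨σ, _, hσ⟩ := h2
    exact ⟨σ, hσ⟩
  rw [localErr, splitErr, h1, prodHat_eq_zero hl, mulApx_zero_right (le_max_right _ _),
    mulApx_zero_right (le_max_right _ _)]
  simp

lemma abs_hatApx_sub_prodHat_le (hu : Lists u fun _ => 1) (hM : 1 ≤ M) :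
    |hatApx n dt u l x - prodHat l x| ≤ 2 ^ dt * (2 ^ n)⁻¹ := by
  rw [prodHat_eq_prod_pow]
  exact abs_tree_elim_sub_le hu fun _ => hat_mem hM _ _

lemma abs_polyApx_sub_poly_le (hv : ∀ γ, Lists (v γ) γ.1) (hc : ∑ γ, |c γ| ≤ 1)
    (hx : x ∈ unitCube t) : |∑ γ, c γ * monoApx n dq (v γ) x - ∑ γ, c γ * ∏ j, x j ^ γ.1 j| ≤
      2 ^ dq * (2 ^ n)⁻¹ := by
  rw [← Finset.sum_sub_distrib]
  simp only [← mul_sub]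
  exact (abs_sum_mul_le hc (fun γ _ => abs_tree_elim_sub_le (hv γ)
    (mem_Icc_of_mem_unitCube hx)) (by positivity)).trans (by rw [one_mul])

lemma abs_localErr_le (hu : Lists u fun _ => 1) (hv : ∀ γ, Lists (v γ) γ.1) (hM : 1 ≤ M)
    (hc : ∑ γ, |c γ| ≤ 1) (hx : x ∈ unitCube t) :
    |localErr n u v c l x| ≤ (2 + 2 ^ dq + 2 ^ dt) * (2 ^ n)⁻¹ := by
  have h1 := abs_splitErr_le n (h := prodHat l x) (abs_polyApx_le (n := n) (v := v) hc hx)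
    (hatApx_mem hM n dt u l x) (abs_poly_le hc hx)
  have h2 := abs_hatApx_sub_prodHat_le (n := n) (l := l) (x := x) hu hM
  have h3 := abs_polyApx_sub_poly_le (n := n) hv hc hx
  rw [localErr]
  linarith

/-- Bounding every term of `abs_splitErr_sub_le` by a multiple of `A T 2^{-n} ‖x - y‖` gives `2 + (1
+ 2) + (1 + 1) = 7` of them. -/
lemma abs_localErr_sub_le {A T : ℝ} (hu : Lists u fun _ => 1) (hv : ∀ γ, Lists (v γ) γ.1)
    (hM : 1 ≤ M) (hc : ∑ γ, |c γ| ≤ 1) (hA : 4 ≤ A) (hdt : 4 ^ dt ≤ A) (hdq : 4 ^ dq ≤ A)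
    (hAn : A * (2 ^ n)⁻¹ ≤ 1) (hqT : q ≤ T) (htT : t ≤ T)
    (hx : x ∈ unitCube t) (hy : y ∈ unitCube t) :
    |localErr n u v c l x - localErr n u v c l y| ≤ 7 * A * T * (2 ^ n)⁻¹ * ‖x - y‖ := by
  set η : ℝ := (2 ^ n)⁻¹ with hη
  set Δ := ‖x - y‖
  have hη0 : 0 ≤ η := by positivity
  have hΔ0 : 0 ≤ Δ := norm_nonneg _
  have hT0 : 0 ≤ T := (Nat.cast_nonneg q).trans hqT
  have hdt1 : (4 : ℝ) ^ dt * η ≤ 1 := le_trans (by gcongr) hAn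
  have hdq1 : (4 : ℝ) ^ dq * η ≤ 1 := le_trans (by gcongr) hAn
  have h2t : (2 : ℝ) ^ dt ≤ A := le_trans (by gcongr; norm_num) hdt
  have h2q : (2 : ℝ) ^ dq ≤ A := le_trans (by gcongr; norm_num) hdq
  have hX := mem_Icc_of_mem_unitCube hx
  have hY := mem_Icc_of_mem_unitCube hy
  have hΔ : ∀ j, |x j - y j| ≤ Δ := norm_le_pi_norm (x - y)
  have hhΔ : ∀ j, |hat M (l j) (x j) - hat M (l j) (y j)| ≤ Δ := fun j =>
    (abs_hat_sub_le _ _ _).trans (hΔ j)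
  have hH : ∀ (x : Fin t → ℝ) j, hat M (l j) (x j) ∈ Set.Icc (0 : ℝ) 1 := fun _ _ => hat_mem hM _ _
  have hγ : ∀ γ : monoIdx t q, ∑ j, γ.1 j ≤ q := fun γ => mem_monoIdx.1 γ.2
  have h1t : ∑ j : Fin t, 1 ≤ t := by simp
  have b1 : |hatApx n dt u l x - hatApx n dt u l y| ≤ 2 * (t * Δ) :=
    abs_tree_elim_sub_tree_elim_le hdt1 hu h1t (hH x) (hH y) hhΔ hΔ0
  have b2 : |(hatApx n dt u l x - prodHat l x) - (hatApx n dt u l y - prodHat l y)| ≤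
      4 ^ dt * η * (t * Δ) := by
    rw [prodHat_eq_prod_pow, prodHat_eq_prod_pow]
    exact abs_tree_elim_sub_sub_le hdt1 hu h1t (hH x) (hH y) hhΔ hΔ0
  have p1 : |∑ γ, c γ * monoApx n dq (v γ) x - ∑ γ, c γ * monoApx n dq (v γ) y| ≤
      2 * (q * Δ) := by
    rw [← Finset.sum_sub_distrib]
    simp only [← mul_sub]
    exact (abs_sum_mul_le hc (fun γ _ => abs_tree_elim_sub_tree_elim_le hdq1 (hv γ) (hγ γ) hX hY
      hΔ hΔ0) (by positivity)).trans (by rw [one_mul])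
  have p2 : |(∑ γ, c γ * monoApx n dq (v γ) x - ∑ γ, c γ * ∏ j, x j ^ γ.1 j) -
      (∑ γ, c γ * monoApx n dq (v γ) y - ∑ γ, c γ * ∏ j, y j ^ γ.1 j)| ≤
        4 ^ dq * η * (q * Δ) := by
    simp only [← Finset.sum_sub_distrib, ← mul_sub]
    exact (abs_sum_mul_le hc (fun γ _ => abs_tree_elim_sub_sub_le hdq1 (hv γ) (hγ γ) hX hY
      hΔ hΔ0) (by positivity)).trans (by rw [one_mul])
  have a1 : |∑ γ, c γ * ∏ j, x j ^ γ.1 j - ∑ γ, c γ * ∏ j, y j ^ γ.1 j| ≤ q * Δ := by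
    rw [← Finset.sum_sub_distrib]
    simp only [← mul_sub]
    exact (abs_sum_mul_le hc (fun γ _ => abs_prod_pow_sub_le (hγ γ) hX hY
      hΔ hΔ0) (by positivity)).trans (by rw [one_mul])
  have p3 := abs_polyApx_sub_poly_le (n := n) hv hc hy
  have b3 := abs_hatApx_sub_prodHat_le (n := n) (l := l) (x := x) hu hM
  have key := abs_splitErr_sub_le n (h := prodHat l x) (h' := prodHat l y)
    (a := ∑ γ, c γ * ∏ j, x j ^ γ.1 j)
    (abs_polyApx_le (n := n) (v := v) hc hx) (hatApx_mem hM n dt u l x)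
    (abs_polyApx_le (n := n) (v := v) hc hy) (hatApx_mem hM n dt u l y) (abs_poly_le hc hy)
  rw [localErr, localErr]
  refine key.trans ?_
  have hqΔ : q * Δ ≤ T * Δ := by gcongr
  have htΔ : t * Δ ≤ T * Δ := by gcongr
  have hTΔ : 0 ≤ T * Δ := by positivity
  have e1 : 2 * η * (2 * (q * Δ) + 2 * (t * Δ)) ≤ 2 * A * η * (T * Δ) := by
    calc _ ≤ 2 * η * (2 * (T * Δ) + 2 * (T * Δ)) := by gcongr
      _ = 2 * 4 * η * (T * Δ) := by ring
      _ ≤ _ := by gcongr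
  calc _ ≤ 2 * η * (2 * (q * Δ) + 2 * (t * Δ)) +
        (4 ^ dq * η * (q * Δ) + 2 ^ dq * η * (2 * (t * Δ))) +
        (q * Δ * (2 ^ dt * η) + 4 ^ dt * η * (t * Δ)) := by gcongr
    _ ≤ 2 * A * η * (T * Δ) + (A * η * (T * Δ) + A * η * (2 * (T * Δ))) +
        (T * Δ * (A * η) + A * η * (T * Δ)) := by gcongr
    _ = _ := by ring

end

/-! ### Choice of the parameters -/

/-- Take `M + 1 = ⌊N^{1/t}⌋`. Then `N^{1/t} < M + 2 ≤ 3M`, and `N ≥ 2^t` ensures `M ≥ 1`. -/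
lemma exists_grid {N : ℕ} (ht : 1 ≤ t) (hN : 2 ^ t ≤ N) :
    ∃ M : ℕ, 1 ≤ M ∧ (M + 1) ^ t ≤ N ∧ ∀ β : ℝ, 0 < β →
      (1 / (M : ℝ)) ^ β ≤ 3 ^ β * (N : ℝ) ^ (-(β / t)) := by
  have ht' : (0 : ℝ) < t := by exact_mod_cast ht
  have hN0 : (0 : ℝ) < N := by exact_mod_cast (Nat.two_pow_pos t).trans_le hN
  set r : ℝ := (N : ℝ) ^ (1 / (t : ℝ)) with hr
  have hr0 : 0 < r := Real.rpow_pos_of_pos hN0 _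
  have hrt : r ^ t = N := by
    rw [← Real.rpow_natCast, hr, ← Real.rpow_mul hN0.le, one_div_mul_cancel ht'.ne', Real.rpow_one]
  have h2 : 2 ≤ ⌊r⌋₊ := by
    refine Nat.le_floor ?_
    refine (pow_le_pow_iff_left₀ (by norm_num) hr0.le (by omega : t ≠ 0)).1 ?_
    rw [hrt]
    exact_mod_cast hN
  obtain ⟨M, hM⟩ : ∃ M, ⌊r⌋₊ = M + 1 := ⟨⌊r⌋₊ - 1, by omega⟩
  have hM1 : 1 ≤ M := by omega
  have hM1' : (1 : ℝ) ≤ M := by exact_mod_cast hM1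
  refine ⟨M, hM1, ?_, fun β hβ => ?_⟩
  · have h3 : ((M + 1 : ℕ) : ℝ) ≤ r := by rw [← hM]; exact Nat.floor_le hr0.le
    have h4 : ((M + 1 : ℕ) : ℝ) ^ t ≤ N := by rw [← hrt]; gcongr
    exact_mod_cast h4
  · have h3 : r ≤ 3 * M := by
      have := Nat.lt_floor_add_one r
      rw [hM] at this
      push_cast at this
      linarith
    have h4 : (N : ℝ) ^ (-(β / t)) = (1 / r) ^ β := by
      rw [one_div, Real.inv_rpow hr0.le, hr, ← Real.rpow_mul hN0.le, ← Real.rpow_neg hN0.le]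
      congr 1
      ring
    rw [h4, ← Real.mul_rpow (by norm_num) (by positivity)]
    refine Real.rpow_le_rpow (by positivity) ?_ hβ.le
    rw [mul_one_div, div_le_div_iff₀ (by linarith) hr0]
    linarith

lemma two_pow_clog_lt {r : ℕ} (hr : 1 ≤ r) : 2 ^ Nat.clog 2 r < 2 * r := by
  rcases hr.eq_or_lt with rfl | h
  · simp
  · have h1 := Nat.pow_pred_clog_lt_self (b := 2) (by norm_num) h
    have h2 : 0 < Nat.clog 2 r := Nat.clog_pos (by norm_num) h
    obtain ⟨k, hk⟩ : ∃ k, Nat.clog 2 r = k + 1 := ⟨_, (Nat.succ_pred_eq_of_pos h2).symm⟩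
    rw [hk] at h1 ⊢
    rw [Nat.pred_succ] at h1
    rw [pow_succ]
    omega

lemma two_pow_clog_le (r : ℕ) : 2 ^ Nat.clog 2 r ≤ 2 * r + 1 := by
  rcases Nat.eq_zero_or_pos r with rfl | h
  · simp
  · have := two_pow_clog_lt h
    omega

lemma four_pow_clog_le (r : ℕ) : (4 : ℝ) ^ Nat.clog 2 r ≤ 4 * (1 + (r : ℝ) ^ 2) := by
  have e : (4 : ℝ) ^ Nat.clog 2 r = (2 ^ Nat.clog 2 r) ^ 2 := by
    rw [← pow_mul, mul_comm, pow_mul]; norm_num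
  rw [e]
  rcases Nat.eq_zero_or_pos r with rfl | h
  · norm_num
  · have h1 : (2 : ℝ) ^ Nat.clog 2 r ≤ 2 * r := by exact_mod_cast (two_pow_clog_lt h).le
    calc _ ≤ (2 * (r : ℝ)) ^ 2 := by gcongr
      _ ≤ _ := by linarith

lemma clog_le_ceil_logb {r : ℕ} {x : ℝ} (hr : r ≤ x) (hx : 0 < x) :
    Nat.clog 2 r ≤ ⌈Real.logb 2 x⌉₊ := by
  rw [Nat.clog_le_iff_le_pow (by norm_num)]
  have h1 : x ≤ 2 ^ ((⌈Real.logb 2 x⌉₊ : ℕ) : ℝ) :=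
    (Real.logb_le_iff_le_rpow (by norm_num) hx).1 (Nat.le_ceil _)
  rw [Real.rpow_natCast] at h1
  exact_mod_cast hr.trans h1

lemma ceil_logb_le {x : ℝ} (hx : 1 ≤ x) : (⌈Real.logb 2 x⌉₊ : ℝ) ≤ x + 1 := by
  have h1 : Real.logb 2 x ≤ x := by
    rw [Real.logb_le_iff_le_rpow (by norm_num) (by linarith)]
    have := one_add_mul_self_le_rpow_one_add (s := 1) (by norm_num) hx
    norm_num at this
    linarith
  have := Nat.ceil_lt_add_one (Real.logb_nonneg (b := 2) (by norm_num) hx)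
  linarith

/-- The number of active parameters. -/
lemma param_count_le {P G B N a b a' b' D m : ℕ} {R : ℝ} (ht : 1 ≤ t) (htR : (t : ℝ) + 1 ≤ R)
    (hP : P ≤ N) (hG : G ≤ N) (hB : B ≤ N) (hN : 1 ≤ N) (hGR : (G : ℝ) ≤ R ^ t)
    (ha : (a : ℝ) ≤ 2 * R) (hb : (b : ℝ) ≤ 2 * R) (ha' : a' ≤ a) (hb' : b' ≤ b)
    (hD : (D : ℝ) ≤ R) :
    (((P * (2 * t) + G * b) * (t + 1) +
          (P * (a * (2 * t + 1) + (a' * ((m + 5) * 30) + D * (m + 5))) +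
          G * (b + (b' * ((m + 5) * 30) + D * (m + 5)))) +
          2 * P * (G + 1) + 2 * P * ((m + 5) * 30) +
          2 * P + (10 * P + 2) + (10 * B + 2) + 2 : ℕ) : ℝ) ≤
      141 * R ^ (3 + t) * N * ((m : ℝ) + 6) := by
  have ht' : (1 : ℝ) ≤ t := by exact_mod_cast ht
  have hR2 : 2 ≤ R := by linarith
  have hP' : (P : ℝ) ≤ N := by exact_mod_cast hP
  have hG' : (G : ℝ) ≤ N := by exact_mod_cast hG
  have hB' : (B : ℝ) ≤ N := by exact_mod_cast hB
  have hN' : (1 : ℝ) ≤ N := by exact_mod_cast hN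
  have ha2 : (a' : ℝ) ≤ 2 * R := le_trans (by exact_mod_cast ha') ha
  have hb2 : (b' : ℝ) ≤ 2 * R := le_trans (by exact_mod_cast hb') hb
  have hm : (0 : ℝ) ≤ m := m.cast_nonneg
  set μ : ℝ := (m : ℝ) + 6 with hμ
  have hμ6 : 6 ≤ μ := by linarith
  have hmμ : (m : ℝ) + 5 ≤ μ := by linarith
  set Q : ℝ := R ^ (3 + t) with hQ
  have hQt : R ^ t ≤ Q := pow_le_pow_right₀ (by linarith) (by omega)
  have hQ2 : R ^ 2 ≤ Q := pow_le_pow_right₀ (by linarith) (by omega)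
  have hRR : 2 * R ≤ R ^ 2 := by rw [pow_two]; gcongr
  have hRQ : R ≤ Q / 2 := by linarith
  have h1Q : 1 ≤ Q / 4 := by linarith
  have hμQ : 6 * Q ≤ μ * Q := by gcongr
  push_cast
  calc _ ≤ ((N : ℝ) * (2 * R) + N * (2 * R)) * R +
          (N * (2 * R * (2 * R) + (2 * R * (μ * 30) + R * μ)) +
            N * (2 * R + (2 * R * (μ * 30) + R * μ))) +
          2 * N * (R ^ t + 1) + 2 * N * (μ * 30) + 2 * N + (10 * N + 2 * N) + (10 * N + 2 * N) +
          2 * N := by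
        gcongr <;> linarith
    _ = N * (8 * R ^ 2 + 2 * R + 122 * (μ * R) + 2 * R ^ t + 60 * μ + 30) := by ring
    _ ≤ N * (8 * Q + 2 * (Q / 2) + 122 * (μ * (Q / 2)) + 2 * Q + 60 * (μ * (Q / 4)) +
          30 * (Q / 4)) := by
        gcongr
        · exact le_mul_of_one_le_right (by linarith) h1Q
        · linarith
    _ ≤ N * (141 * (μ * Q)) := by
        gcongr
        linarith
    _ = _ := by ring

/-! ### The approximation theorem -/

/-- The network that approximates a sum of polynomials weighted by products of hat functions. -/
lemma exists_network (n B : ℕ) {M dt dq q D w₁ w₂ w : ℕ} (hM : 1 ≤ M) (hdt : dt ≤ D) (hdq : dq ≤ D)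
    (hw₁ : 5 * 2 ^ dt ≤ 2 * w₁) (hw₁' : 2 * t ≤ w₁) (hw₂ : 5 * 2 ^ dq ≤ 2 * w₂)
    (hw : (M + 1) ^ t * w₁ + (monoIdx t q).card * w₂ ≤ w) (hw' : 10 * (M + 1) ^ t ≤ w)
    (hB : 2 * B ≤ w)
    (u : Slot dt → Option (Fin t)) (v : monoIdx t q → Slot dq → Option (Fin t))
    (c : (Fin t → Fin (M + 1)) → monoIdx t q → ℝ) (hc : ∀ l, ∑ γ, |c l γ| ≤ 1) :
    ∃ Φ : Net t (List.replicate (8 + (n + 3) * (1 + D)) w) 1, Φ.Bounded ∧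
      Φ.active ≤ ((M + 1) ^ t * (2 * t) + (monoIdx t q).card * 2 ^ dq) * (t + 1) +
          ((M + 1) ^ t *
            (2 ^ dt * (2 * t + 1) + ((2 ^ dt - 1) * ((n + 3) * 30) + D * (n + 3))) +
          (monoIdx t q).card * (2 ^ dq + ((2 ^ dq - 1) * ((n + 3) * 30) + D * (n + 3)))) +
          2 * (M + 1) ^ t * ((monoIdx t q).card + 1) + 2 * (M + 1) ^ t * ((n + 3) * 30) +
          2 * (M + 1) ^ t + (10 * (M + 1) ^ t + 2) + (10 * B + 2) + 2 ∧
      ∀ x ∈ unitCube t, Φ.eval x 0 =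
        ∑ l, M ^ t * prodHat l x * (∑ γ, B * c l γ * ∏ j, x j ^ γ.1 j) +
          B * M ^ t * ∑ l, localErr (n + 1) u v (c l) l x := by
  have hc1 : ∀ l γ, |c l γ| ≤ 1 := fun l γ =>
    (Finset.single_le_sum (f := fun γ => |c l γ|) (fun _ _ => abs_nonneg _)
      (Finset.mem_univ γ)).trans (hc l)
  obtain ⟨f, hf, hfe⟩ := exists_approx_chain n B hM hdt hdq hw₁ hw₁' hw₂
    (by rwa [Fintype.card_coe]) hw' hB u v c hc1 hc
  rw [Fintype.card_coe] at hf
  -- The linear output layer subtracts the negative part from the positive part.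
  obtain ⟨Φ, hΦ, hact, heval⟩ := hf.exists_net (Matrix.of fun (_ : Fin 1) b => sgn b)
    (fun _ b => (abs_sgn b).le) t (Function.Embedding.refl _)
  refine ⟨Φ, hΦ, hact.trans (Nat.add_le_add_left ((nnz_le_card _).trans (by simp)) _),
    fun x hx => ?_⟩
  rw [heval]
  simp only [Matrix.mulVec, dotProduct, Matrix.of_apply, Fintype.sum_bool,
    Function.Embedding.refl_apply, hfe x hx]
  simp only [sgn, if_true, Bool.false_eq_true, if_false, one_mul, neg_mul]
  simp only [← sub_eq_add_neg, localErr, splitErr, mul_assoc, Finset.mul_sum, Finset.sum_mul,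
    ← Finset.sum_sub_distrib, ← Finset.sum_add_distrib]
  refine Finset.sum_congr rfl fun l _ => ?_
  simp only [Finset.mul_sum, mul_sub]
  have e : ∑ γ, (M : ℝ) ^ t * (prodHat l x * (B * (c l γ * ∏ j, x j ^ γ.1 j))) =
      ∑ γ, (B : ℝ) * (M ^ t * (c l γ * ((∏ j, x j ^ γ.1 j) * prodHat l x))) :=
    Finset.sum_congr rfl fun γ _ => by ring
  rw [e]
  ring

/-! ### Size and Lipschitz bounds for Hölder functions and polynomials -/

lemma listDeriv_zero (l : List (Fin t)) (g : (Fin t → ℝ) → ℝ) : listDeriv l 0 g = g := by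
  induction l with
  | nil => rfl
  | cons i l ih => exact ih

variable {β K : ℝ} {f : (Fin t → ℝ) → ℝ} {x y : Fin t → ℝ}

lemma abs_le_of_mem_holderBall (hK : 0 < K) (hf : f ∈ holderBall (unitCube t) β K)
    (hx : x ∈ unitCube t) : |f x| ≤ K := by
  have h1 := Finset.single_le_sum (f := fun α => |multiDeriv (unitCube t) α f x|)
    (fun _ _ => abs_nonneg _) (mem_monoIdx (q := strictFloor β).2 (by simp : ∑ j, (0 : Fin t → ℕ) j ≤ _))
  have h2 : multiDeriv (unitCube t) 0 f = f := listDeriv_zero _ f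
  rw [h2] at h1
  exact h1.trans (sum_abs_multiDeriv_le hK hf hx)

lemma norm_sub_le_one_of_mem_unitCube (hx : x ∈ unitCube t) (hy : y ∈ unitCube t) :
    ‖x - y‖ ≤ 1 := by
  refine (pi_norm_le_iff_of_nonneg zero_le_one).2 fun j => ?_
  rw [Pi.sub_apply, Real.norm_eq_abs, abs_le]
  have h1 := mem_Icc_of_mem_unitCube hx j
  have h2 := mem_Icc_of_mem_unitCube hy j
  constructor <;> linarith [h1.1, h1.2, h2.1, h2.2]

/-- Polynomials with bounded coefficients are Lipschitz on the cube. -/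
lemma abs_sum_monomials_sub_le {A : ℝ} {c : (Fin t → ℕ) → ℝ} (hβ : 0 < β) (hA : 0 ≤ A)
    (hc : ∑ γ ∈ monoIdx t (strictFloor β), |c γ| ≤ A) (hx : x ∈ unitCube t)
    (hy : y ∈ unitCube t) :
    |∑ γ ∈ monoIdx t (strictFloor β), c γ * ∏ j, x j ^ γ j -
      ∑ γ ∈ monoIdx t (strictFloor β), c γ * ∏ j, y j ^ γ j| ≤ β * A * ‖x - y‖ := by
  rw [← Finset.sum_sub_distrib]
  simp only [← mul_sub]
  refine (abs_sum_mul_le hc (fun γ hγ => abs_prod_pow_sub_le (mem_monoIdx.1 hγ)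
    (mem_Icc_of_mem_unitCube hx) (mem_Icc_of_mem_unitCube hy) (norm_le_pi_norm (x - y))
    (norm_nonneg _)) (by positivity)).trans ?_
  rw [mul_comm β, mul_assoc]
  gcongr
  exact (strictFloor_lt hβ).le

/-- Compare with the local polynomial at `y`: it agrees with `f` at `y`, differs from it at `x` by
at most `K ‖x - y‖^β ≤ K ‖x - y‖`, and is Lipschitz. -/
lemma abs_sub_le_of_mem_holderBall (hβ : 1 ≤ β) (hK : 0 < K)
    (hf : f ∈ holderBall (unitCube t) β K) (hx : x ∈ unitCube t) (hy : y ∈ unitCube t) :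
    |f x - f y| ≤ (K + β * (K * 2 ^ t)) * ‖x - y‖ := by
  have hβ0 : 0 < β := by linarith
  obtain ⟨c, hc, hcf⟩ := exists_local_polynomial hβ0 hK hf hy
  have h1 := hcf x hx
  have h2 := hcf y hy
  rw [sub_self, norm_zero, Real.zero_rpow hβ0.ne', mul_zero] at h2
  have h3 := abs_sum_monomials_sub_le hβ0 (by positivity) hc hx hy
  have h4 : K * ‖x - y‖ ^ β ≤ K * ‖x - y‖ := by
    refine mul_le_mul_of_nonneg_left ?_ hK.le
    conv_rhs => rw [← Real.rpow_one ‖x - y‖]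
    exact Real.rpow_le_rpow_of_exponent_ge' (norm_nonneg _)
      (norm_sub_le_one_of_mem_unitCube hx hy) zero_le_one hβ
  rw [abs_le] at *
  constructor <;> linarith [h1.1, h1.2, h2.1, h2.2, h3.1, h3.2]

lemma seven_mul_two_pow_le (ht : 1 ≤ t) : 7 * (2 : ℝ) ^ t ≤ 6 * Real.exp t := by
  have he := Real.exp_one_gt_d9
  induction t, ht using Nat.le_induction with
  | base => norm_num; linarith
  | succ t _ ih =>
    rw [pow_succ, Nat.cast_succ, Real.exp_add]
    have := mul_le_mul_of_nonneg_left (by linarith : 2 ≤ Real.exp 1) (Real.exp_pos t).le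
    linarith

lemma exp_le_three_pow (t : ℕ) : Real.exp t ≤ 3 ^ t := by
  rw [← mul_one (t : ℝ), Real.exp_nat_mul]
  gcongr
  linarith [Real.exp_one_lt_d9]

lemma lipschitz_constants_le (ht : 1 ≤ t) (hβ : 1 ≤ β) (hK : 0 < K) :
    6 * t * 2 ^ t * K + β * (K * 2 ^ t) ≤ 6 * (t * β * (K * Real.exp t)) ∧
      (2 * β + 1) * K + β * (K * 2 ^ t) ≤ 6 * (t * β * (K * Real.exp t)) := by
  have ht' : (1 : ℝ) ≤ t := by exact_mod_cast ht
  have hβ0 : 0 ≤ β := by linarith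
  have h2t : (2 : ℝ) ≤ 2 ^ t := le_self_pow₀ (by norm_num) (by omega)
  have h1 : t * β * K * (7 * 2 ^ t) ≤ t * β * K * (6 * Real.exp t) := by
    exact mul_le_mul_of_nonneg_left (seven_mul_two_pow_le ht) (by positivity)
  have h2 : t * (K * 2 ^ t) ≤ t * β * (K * 2 ^ t) := by
    gcongr
    exact le_mul_of_one_le_right (by linarith) hβ
  have h3 : β * (K * 2 ^ t) ≤ t * β * (K * 2 ^ t) := by
    gcongr
    exact le_mul_of_one_le_left hβ0 ht'
  have h4 : K ≤ β * K := le_mul_of_one_le_left hK.le hβ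
  have h5 : β * K * 2 ≤ β * K * 2 ^ t := by gcongr
  constructor <;> linarith

set_option maxHeartbeats 800000 in
/-- The approximation when the network error is not trivially large. -/
lemma exists_approx_network (ht : 1 ≤ t) (hβ : 0 < β) (hK : 0 < K)
    (hf : f ∈ holderBall (unitCube t) β K) {m N : ℕ} (hN₁ : (β + 1) ^ t ≤ N)
    (hN₂ : (K + 1) * Real.exp t ≤ N)
    (hsmall : 2 * ((1 + (t : ℝ) ^ 2 + β ^ 2) * 6 ^ t * N * (2 : ℝ)⁻¹ ^ m) ≤ 1) :
    ∃ Φ : Net t (List.replicate (depth t β m) (width t β N)) 1, Φ.Bounded ∧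
      (Φ.active : ℝ) ≤ 141 * ((t : ℝ) + β + 1) ^ (3 + t) * N * ((m : ℝ) + 6) ∧
      (∀ x ∈ unitCube t, |Φ.eval x 0 - f x| ≤
        (2 * K + 1) * (1 + (t : ℝ) ^ 2 + β ^ 2) * 6 ^ t * N * (2 : ℝ)⁻¹ ^ m +
          K * (3 : ℝ) ^ β * (N : ℝ) ^ (-(β / t))) ∧
      (1 ≤ β → 1 ≤ K → ∀ x ∈ unitCube t, ∀ y ∈ unitCube t,
        |Φ.eval x 0 - Φ.eval y 0| ≤ 9 * (t * β * (K * Real.exp t)) * ‖x - y‖) := by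
  have ht' : (1 : ℝ) ≤ t := by exact_mod_cast ht
  set q := strictFloor β with hq
  have hqβ : (q : ℝ) < β := strictFloor_lt hβ
  have hq1 : q + 1 = ⌈β⌉₊ := strictFloor_add_one hβ
  set ρ : ℝ := 1 + (t : ℝ) ^ 2 + β ^ 2 with hρ
  have hρ1 : 1 ≤ ρ := by linarith [sq_nonneg (t : ℝ), sq_nonneg β]
  set θ : ℝ := (2 : ℝ)⁻¹ ^ m with hθ
  have hθ0 : 0 < θ := by positivity
  set E : ℝ := Real.exp t with hE
  have hEp : 0 < E := Real.exp_pos _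
  have h7 : 7 * (2 : ℝ) ^ t ≤ 6 * E := seven_mul_two_pow_le ht
  have h2t : (2 : ℝ) ≤ 2 ^ t := le_self_pow₀ (by norm_num) (by omega)
  have hKE : K * (2 : ℝ) ^ t ≤ K * E := by gcongr; linarith
  have h2N : 2 ^ t ≤ N := by
    have : (2 : ℝ) ^ t ≤ N := by linarith [mul_pos hK hEp]
    exact_mod_cast this
  have hN1 : 1 ≤ N := (Nat.one_le_two_pow).trans h2N
  have hN1' : (1 : ℝ) ≤ N := by exact_mod_cast hN1
  obtain ⟨M, hM, hMN, hMβ⟩ := exists_grid ht h2N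
  have hMN' : (M : ℝ) ^ t ≤ N := by
    exact_mod_cast (Nat.pow_le_pow_left (Nat.le_succ M) t).trans hMN
  -- The coefficients of a local polynomial have ℓ¹ norm at most `K 2^t ≤ K e^t`, so division by `B`
  -- normalizes them. The condition `(K + 1) e^t ≤ N` lets `B` copies fit into the width.
  set B : ℕ := ⌈K * E⌉₊ with hB
  have hBl : K * E ≤ B := Nat.le_ceil _
  have hBu : (B : ℝ) ≤ K * E + 1 := (Nat.ceil_lt_add_one (by positivity)).le
  have hB0 : (0 : ℝ) < B := lt_of_lt_of_le (by positivity) hBl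
  have hBN : B ≤ N := by
    have : (B : ℝ) ≤ N := by linarith
    exact_mod_cast this
  set G := (monoIdx t q).card with hG
  have hGq : G ≤ (q + 1) ^ t := card_monoIdx_le t q
  have hGq' : (G : ℝ) ≤ (q + 1 : ℝ) ^ t := by exact_mod_cast hGq
  have hGβ : (G : ℝ) ≤ (β + 1) ^ t := hGq'.trans (by gcongr)
  have hGN : G ≤ N := by exact_mod_cast hGβ.trans hN₁
  set D := ⌈Real.logb 2 (max (t : ℝ) β)⌉₊ with hD
  have hmax : (1 : ℝ) ≤ max (t : ℝ) β := ht'.trans (le_max_left _ _)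
  set dt := Nat.clog 2 t with hdt
  set dq := Nat.clog 2 q with hdq
  have hdtD : dt ≤ D := clog_le_ceil_logb (le_max_left _ _) (by linarith)
  have hdqD : dq ≤ D := clog_le_ceil_logb (hqβ.le.trans (le_max_right _ _)) (by linarith)
  have hdt2 : 2 ^ dt < 2 * t := two_pow_clog_lt ht
  have hdq2 : 2 ^ dq ≤ 2 * q + 1 := two_pow_clog_le q
  have hdt2' : (2 : ℝ) ^ dt ≤ 2 * t := by exact_mod_cast hdt2.le
  have hdq2' : (2 : ℝ) ^ dq ≤ 2 * q + 1 := by exact_mod_cast hdq2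
  obtain ⟨u, hu⟩ : ∃ u : Slot dt → Option (Fin t), Lists u fun _ => 1 := by
    obtain ⟨u, hu⟩ := exists_slots (S := Slot dt) (fun _ : Fin t => 1)
      (by rw [card_slot]; simpa using Nat.le_pow_clog (by norm_num) t)
    exact ⟨u, hu.1, hu.2⟩
  have hv : ∀ γ : monoIdx t q, ∃ v : Slot dq → Option (Fin t), Lists v γ.1 := fun γ => by
    obtain ⟨v, hv⟩ := exists_slots (S := Slot dq) γ.1
      (by rw [card_slot]; exact (mem_monoIdx.1 γ.2).trans (Nat.le_pow_clog (by norm_num) q))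
    exact ⟨v, hv.1, hv.2⟩
  choose v hv using hv
  choose c₀ hc₀ hcf using fun l : Fin t → Fin (M + 1) =>
    exists_local_polynomial hβ hK hf (node_mem hM l)
  set c : (Fin t → Fin (M + 1)) → monoIdx t q → ℝ := fun l γ => c₀ l γ.1 / B with hcdef
  have hc : ∀ l, ∑ γ, |c l γ| ≤ 1 := by
    intro l
    simp only [hcdef, abs_div, abs_of_pos hB0]
    rw [← Finset.sum_div, div_le_one hB0, Finset.sum_coe_sort (monoIdx t q) fun γ => |c₀ l γ|]
    exact (hc₀ l).trans (hKE.trans hBl)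
  have hw : (M + 1) ^ t * (6 * t) + G * (6 * (q + 1)) ≤ width t β N := by
    calc _ ≤ N * (6 * t) + N * (6 * (q + 1)) := by gcongr
      _ = width t β N := by rw [width, hq1]; ring
  have h12 : 12 * N ≤ width t β N := by
    rw [width, ← hq1]
    gcongr
    omega
  -- With `m + 2`, each multiplication has `m + 5` layers and accuracy `2^{-(m+3)}`. The gain of
  -- `1/8` over `2^{-m}` absorbs the constants of the local error.
  have hnet := exists_network (m + 2) B hM hdtD hdqD (w₁ := 6 * t)
    (w₂ := 6 * (q + 1)) (by omega) (by omega) (by omega) hw (by omega) (by omega) u v c hc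
  rw [show 8 + (m + 2 + 3) * (1 + D) = depth t β m from rfl] at hnet
  obtain ⟨Φ, hΦ, hact, heval⟩ := hnet
  set p : (Fin t → Fin (M + 1)) → (Fin t → ℝ) → ℝ :=
    fun l x => ∑ γ ∈ monoIdx t q, c₀ l γ * ∏ j, x j ^ γ j with hp
  have hpf : ∀ l, ∀ x ∈ unitCube t, |p l x - f x| ≤ K * ‖x - node l‖ ^ β := hcf
  have hpc : ∀ l x, ∑ γ, B * c l γ * ∏ j, x j ^ γ.1 j = p l x := by
    intro l x
    change _ = ∑ γ ∈ monoIdx t q, c₀ l γ * ∏ j, x j ^ γ j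
    rw [← Finset.sum_coe_sort (monoIdx t q)]
    refine Finset.sum_congr rfl fun γ _ => ?_
    rw [hcdef, mul_div_cancel₀ _ hB0.ne']
  simp only [hpc] at heval
  set η : ℝ := (2 ^ (m + 2 + 1))⁻¹ with hη
  have hηθ : η = θ / 8 := by
    rw [hη, hθ, inv_pow, pow_succ, pow_add]
    field_simp
    norm_num
  set e : (Fin t → ℝ) → (Fin t → Fin (M + 1)) → ℝ :=
    fun x l => localErr (m + 2 + 1) u v (c l) l x with he
  have he0 : ∀ {x l}, l ∉ active M x → e x l = 0 := fun hl => localErr_eq_zero hu hM hl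
  refine ⟨Φ, hΦ, ?_, fun x hx => ?_, fun hβ1 hK1 x hx y hy => ?_⟩
  · refine le_trans (Nat.cast_le.2 hact) (param_count_le ht (by linarith) hMN hGN hBN hN1
      (hGq'.trans (by gcongr; linarith)) ?_ ?_ (Nat.sub_le _ _) (Nat.sub_le _ _) ?_)
    · push_cast; linarith
    · push_cast; linarith
    · refine (ceil_logb_le hmax).trans ?_
      rw [add_le_add_iff_right]
      exact max_le (by linarith) (by linarith)
  · have h1 := (abs_sum_prodHat_mul_sub_le hM hβ hK hpf hx).trans
      (mul_le_mul_of_nonneg_left (hMβ β hβ) hK.le)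
    have h2 : |∑ l, e x l| ≤ 2 ^ t * (ρ * θ) := by
      refine abs_sum_le_of_inactive hM (fun l hl => he0 hl) (fun l _ =>
        (abs_localErr_le hu hv hM (hc l) hx).trans ?_) (by positivity)
      have h3 : (2 : ℝ) + 2 ^ dq + 2 ^ dt ≤ 8 * ρ := by
        linarith [sq_nonneg ((t : ℝ) - 1), sq_nonneg (β - 1), sq_nonneg (t : ℝ), sq_nonneg β]
      calc _ ≤ 8 * ρ * η := by gcongr
        _ = ρ * θ := by rw [hηθ]; ring
    have h4 : (B : ℝ) ≤ (2 * K + 1) * 3 ^ t := by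
      have := exp_le_three_pow t
      have h3 : (1 : ℝ) ≤ 3 ^ t := one_le_pow₀ (by norm_num)
      have h5 : K * E ≤ K * 3 ^ t := by gcongr
      have : 0 ≤ K * 3 ^ t := by positivity
      linarith
    have h5 : |B * M ^ t * ∑ l, e x l| ≤ (2 * K + 1) * ρ * 6 ^ t * N * θ := by
      rw [abs_mul, abs_of_nonneg (by positivity)]
      calc _ ≤ (2 * K + 1) * 3 ^ t * N * (2 ^ t * (ρ * θ)) := by gcongr
        _ = (2 * K + 1) * ρ * (3 * 2) ^ t * N * θ := by rw [mul_pow]; ring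
        _ = _ := by norm_num
    rw [heval x hx, add_sub_right_comm, add_comm]
    refine (abs_add_le _ _).trans (add_le_add h5 (h1.trans_eq ?_))
    ring
  · obtain ⟨hC₁, hC₂⟩ := lipschitz_constants_le ht hβ1 hK
    have hpL : ∀ l, ∀ x ∈ unitCube t, ∀ y ∈ unitCube t,
        |p l x - p l y| ≤ β * (K * 2 ^ t) * ‖x - y‖ := fun l x hx y hy =>
      abs_sum_monomials_sub_le hβ (by positivity) (hc₀ l) hx hy
    have h1 := abs_sum_prodHat_mul_sub_sum_le hM hβ1 hK hpf hpL
      (fun x hx y hy => abs_sub_le_of_mem_holderBall hβ1 hK hf hx hy) hC₁ hC₂ hx hy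
    -- Here smallness enters: `4 * ρ` dominates `4^dt` and `4^dq`, so this is the condition for the
    -- increment bounds of the trees.
    have hρ6 : 4 * ρ * η ≤ 1 := by
      rw [hηθ]
      have h6 : (1 : ℝ) ≤ 6 ^ t := one_le_pow₀ (by norm_num)
      have : ρ * 1 * 1 * θ ≤ ρ * 6 ^ t * N * θ := by gcongr
      linarith
    have h2 : |∑ l, (e x l - e y l)| ≤
        2 * 2 ^ t * (7 * (4 * ρ) * (t * β) * η * ‖x - y‖) := by
      refine abs_sum_le_of_inactive₂ hM (fun l hl hl' => by rw [he0 hl, he0 hl', sub_zero])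
        (fun l _ => abs_localErr_sub_le hu hv hM (hc l) (by linarith) ?_ ?_ hρ6
          (hqβ.le.trans (le_mul_of_one_le_left hβ.le ht'))
          (le_mul_of_one_le_right (by linarith) hβ1) hx hy) (by positivity)
      · exact (four_pow_clog_le t).trans (by linarith [sq_nonneg β])
      · have : (q : ℝ) ^ 2 ≤ β ^ 2 := by gcongr
        exact (four_pow_clog_le q).trans (by linarith [sq_nonneg (t : ℝ)])
    have h3 : |B * M ^ t * ∑ l, (e x l - e y l)| ≤ 3 * (t * β * (K * E)) * ‖x - y‖ := by
      rw [abs_mul, abs_of_nonneg (by positivity)]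
      have hKE1 : 1 ≤ K * E := one_le_mul_of_one_le_of_one_le hK1 (by linarith)
      -- From `hsmall` and `6^t ≥ 3 · 2^t`. The network error then adds only `3` to the constant `6`
      -- of the glued approximation.
      have h4 : 6 * (2 ^ t * (N * (ρ * θ))) ≤ 1 := by
        have h5 : (3 : ℝ) ≤ 3 ^ t := le_self_pow₀ (by norm_num) (by omega)
        have h6 : (6 : ℝ) ^ t = 3 ^ t * 2 ^ t := by rw [← mul_pow]; norm_num
        have : 3 * (2 ^ t * (N * (ρ * θ))) ≤ 3 ^ t * (2 ^ t * (N * (ρ * θ))) := by gcongr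
        rw [h6] at hsmall
        linarith
      calc _ ≤ 2 * (K * E) * N * (2 * 2 ^ t * (7 * (4 * ρ) * (t * β) * η * ‖x - y‖)) := by
            gcongr; linarith
        _ = 14 * (2 ^ t * (N * (ρ * θ))) * (t * β * (K * E) * ‖x - y‖) := by rw [hηθ]; ring
        _ ≤ 3 * (t * β * (K * E) * ‖x - y‖) := by gcongr; linarith
        _ = _ := by ring
    rw [Finset.sum_sub_distrib] at h3
    rw [heval x hx, heval y hy, add_sub_add_comm, ← mul_sub]
    refine (abs_add_le _ _).trans ((add_le_add h1 h3).trans_eq ?_)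
    ring

end HolderNet

theorem mainTheorem8 (t : ℕ) (ht : 1 ≤ t) (β K : ℝ) (hβ : 0 < β) (hK : 0 < K)
    (f : (Fin t → ℝ) → ℝ) (hf : f ∈ HolderNet.holderBall (HolderNet.unitCube t) β K)
    (m N : ℕ) (hm : 1 ≤ m)
    (hN : max ((β + 1) ^ t) ((K + 1) * Real.exp t) ≤ (N : ℝ)) :
    ∃ s : ℕ, (s : ℝ) ≤ 141 * ((t : ℝ) + β + 1) ^ (3 + t) * N * ((m : ℝ) + 6) ∧
      ∃ g ∈ HolderNet.netClass t
          (List.replicate (HolderNet.depth t β m) (HolderNet.width t β N)) 1 s,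
        (∀ x ∈ HolderNet.unitCube t,
          |g x 0 - f x| ≤
            (2 * K + 1) * (1 + (t : ℝ) ^ 2 + β ^ 2) * 6 ^ t * N * (2 : ℝ)⁻¹ ^ m
              + K * (3 : ℝ) ^ β * (N : ℝ) ^ (-(β / t))) ∧
        (1 ≤ β → 1 ≤ K → ∀ F : ℝ, K ≤ F →
          ∀ x ∈ HolderNet.unitCube t, ∀ y ∈ HolderNet.unitCube t,
            |g x 0 - g y 0| ≤ HolderNet.lipConst t β K F N m * ‖x - y‖) := by
  have hlip : 1 ≤ K → ∀ F : ℝ, K ≤ F →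
      9 * (t * β * (K * Real.exp t)) ≤ HolderNet.lipConst t β K F N m := by
    intro hK1 F hF
    have hF0 : 0 < F := hK.trans_le hF
    -- Since `K + 1 ≥ 2`, the summand `3t` alone yields `12 t β K e^t`, more than the required `9`.
    calc _ ≤ 2 * β * K * (1 + 1) * Real.exp t * (0 + 3 * t) := by
          have : 0 ≤ t * β * (K * Real.exp t) := by positivity
          linarith
      _ ≤ _ := by
          rw [HolderNet.lipConst]
          gcongr
          positivity
  by_cases hsmall : 2 * ((1 + (t : ℝ) ^ 2 + β ^ 2) * 6 ^ t * N * (2 : ℝ)⁻¹ ^ m) ≤ 1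
  · obtain ⟨Φ, hΦ, hact, happ, hLip⟩ := HolderNet.exists_approx_network ht hβ hK hf
      ((le_max_left _ _).trans hN) ((le_max_right _ _).trans hN) hsmall
    exact ⟨Φ.active, hact, Φ.eval, ⟨Φ, hΦ, le_rfl, rfl⟩, happ, fun hβ1 hK1 F hF x hx y hy =>
      (hLip hβ1 hK1 x hx y hy).trans
        (mul_le_mul_of_nonneg_right (hlip hK1 F hF) (norm_nonneg _))⟩
  -- Now `2K` times the network error factor is at least `K ≥ |f|`, so the zero network satisfies
  -- the error bound.
  · obtain ⟨Φ, hΦ, hact, hzero⟩ := HolderNet.exists_zero_net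
      (List.replicate (HolderNet.depth t β m) (HolderNet.width t β N)) t 1
    refine ⟨0, ?_, Φ.eval, ⟨Φ, hΦ, hact.le, rfl⟩, fun x hx => ?_, fun _ hK1 F hF x _ y _ => ?_⟩
    · rw [Nat.cast_zero]
      positivity
    · have h1 := HolderNet.abs_le_of_mem_holderBall hK hf hx
      have h2 : 0 ≤ K * (3 : ℝ) ^ β * (N : ℝ) ^ (-(β / t)) := by positivity
      rw [hzero, Pi.zero_apply, zero_sub, abs_neg]
      have h3 := mul_le_mul_of_nonneg_left (not_le.1 hsmall).le hK.le
      have h4 : 0 ≤ (1 + (t : ℝ) ^ 2 + β ^ 2) * 6 ^ t * N * (2 : ℝ)⁻¹ ^ m := by positivity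
      linarith
    · rw [hzero, hzero, sub_self, abs_zero]
      exact mul_nonneg (le_trans (by positivity) (hlip hK1 F hF)) (norm_nonneg _)
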